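/- Let $R$ be a commutative ring, $q\in R^\times$, and suppose that $Q:=q-q^{-1}$ is invertible in $R$. Let $n\ge 0$, let $J=[j_1,\dots,j_r]$ and $K=[k_1,\dots,k_\ell]$, $\ell=\ell(K)$, be compositions of $n$ (finite sequences of positive integers with sum $n$), and let $z_1,\dots,z_r$ be indeterminates. Let $\mathcal H_n$ be the Hecke algebra of $\mathfrak S_n$ over $R[z_1,\dots,z_r]$, generated by $T_1,\dots,T_{n-1}$ subject to $T_iT_{i+1}T_i=T_{i+1}T_iT_{i+1}$, $T_iT_j=T_jT_i$ for $|i-j|>1$, and $T_i^2=QT_i+1$. Let $(T_w)_{w\in\mathfrak S_n}$ be its standard basis ($T_w$ is the product of the generators along any reduced decomposition of $w$), and let $(\cdot\,,\cdot)$ be the bilinear form with $(T_v,T_w)=\delta_{v,w}$. For a composition $I=[i_1,\dots,i_p]$ of $n$, let $\mathfrak S_I=\mathfrak S_{i_1}\times\mathfrak S_{i_2}\times\cdots\subseteq\mathfrak S_n$ be the Young subgroup. Given $h_a\in\mathcal H_{i_a}$, let $h_1\times\cdots\times h_p\in\mathcal H_n$ be the product of the images of the $h_a$ under the morphisms $\mathcal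 H_{i_a}\to\mathcal H_n$, $T_i\mapsto T_{i_1+\cdots+i_{a-1}+i}$. Let $w\in\mathfrak S_n/\mathfrak S_I$ mean that $w$ runs over the representatives of minimal length of the cosets $w\mathfrak S_I$, and put $$\mathcal N_I(h)=\sum_{w\in\mathfrak S_n/\mathfrak S_I}T_w\,h\,T_{w^{-1}}.$$ Let $L[K]$ be the sum of all $T_w$ such that $w$ has maximal length in its coset $\mathfrak S_K\,w$. Put $\zeta_m=T_{m-1}\cdots T_2T_1$ and $\zeta_K=\zeta_{k_1}\times\cdots\times\zeta_{k_\ell}$. Let $\xi_i=T_{i-1}\cdots T_1\,T_1\cdots T_{i-1}$ be the Jucys–Murphy elements, and put $$E_m(z)=(1+zT_1)(1+zT_2T_1)\cdots(1+zT_{m-1}\cdots T_1),\qquad E_m^\xi(z)=(1+z\xi_2)(1+z\xi_3)\cdots(1+z\xi_m),$$ $$E_J(z_1,\dots,z_r)=E_{j_1}(z_1)\times\cdots\times E_{j_r}(z_r),\qquad E^\xi_J(z_1,\dots,z_r)=E^\xi_{j_1}(z_1)\times\cdots\times E^\xi_{j_r}(z_r).$$ Then $$\Bigl(\sum_{w\in\mathfrak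 S_n/\mathfrak S_J}T_w\,E_J(z_1,\dots,z_r)\,,\;L[K]\Bigr)=\bigl(\mathcal N_J(E_J^\xi(z_1,\dots,z_r))\,,\;\zeta_K\bigr)\,Q^{\ell(K)-n},$$ and this polynomial in $z_1,\dots,z_r$ is equal to the coefficient of the monomial symmetric function $m_K$ (that is, $m_\lambda$ for the partition $\lambda$ obtained by sorting $K$) in the expansion, in the basis of monomial symmetric functions $m_\lambda$, $\lambda\vdash n$, of the product $$\prod_{b=1}^{r}\bigl(S_{1^{j_b}}+z_b\,S_{2,1^{j_b-2}}+z_b^2\,S_{3,1^{j_b-3}}+\cdots+z_b^{j_b-1}\,S_{j_b}\bigr),$$ where $S_\mu$ denotes the Schur function of shape $\mu$ and the $b$-th factor is $\sum_{k=0}^{j_b-1}z_b^{k}\,S_{k+1,1^{j_b-1-k}}$. -/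

import Mathlib

namespace IwahoriHecke

open Equiv

/-! ### The symmetric group

A permutation `w : Perm (Fin n)` is identified with the word `w 0, w 1, …, w (n-1)`.  Everything is
indexed from `0`: the simple transposition usually called `s_{i+1}` is `s i`. -/

/-- The smaller of the two points exchanged by the `i`-th simple transposition. -/
def lo {n : ℕ} (i : Fin (n - 1)) : Fin n := ⟨i, by omega⟩

/-- The larger of the two points exchanged by the `i`-th simple transposition. -/
def hi {n : ℕ} (i : Fin (n - 1)) : Fin n := ⟨i + 1, by omega⟩

/-- The simple transposition exchanging `i` and `i + 1`. -/
def s {n : ℕ} (i : Fin (n - 1)) : Perm (Fin n) := swap (lo i) (hi i)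

/-- The length of a permutation: its number of inversions. -/
def len {n : ℕ} (w : Perm (Fin n)) : ℕ :=
  (Finset.univ.filter fun p : Fin n × Fin n => p.1 < p.2 ∧ w p.2 < w p.1).card

/-- The word `l` in the simple transpositions is a reduced decomposition of `w`. -/
def IsReducedWord {n : ℕ} (l : List (Fin (n - 1))) (w : Perm (Fin n)) : Prop :=
  (l.map s).prod = w ∧ l.length = len w

/-- The Young subgroup of a composition `J`: the permutations preserving each block of `J`. -/
def youngSubgroup {n : ℕ} (J : Composition n) : Subgroup (Perm (Fin n)) where
  carrier := {σ | ∀ p, J.index (σ p) = J.index p}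
  mul_mem' := fun {a b} ha hb p => (ha (b p)).trans (hb p)
  one_mem' := fun _ => rfl
  inv_mem' := fun {a} ha p => by
    have := ha (a⁻¹ p)
    simpa using this.symm

open scoped Classical in
/-- The representatives of minimal length of the left cosets `w 𝔖_J`. -/
noncomputable def minCosetReps {n : ℕ} (J : Composition n) : Finset (Perm (Fin n)) :=
  Finset.univ.filter fun w => ∀ σ ∈ youngSubgroup J, len w ≤ len (w * σ)

open scoped Classical in
/-- The representatives of maximal length of the right cosets `𝔖_K w`. -/
noncomputable def maxCosetReps {n : ℕ} (K : Composition n) : Finset (Perm (Fin n)) :=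
  Finset.univ.filter fun w => ∀ σ ∈ youngSubgroup K, len (σ * w) ≤ len w

/-! ### The Hecke algebra -/

section Hecke

variable {A : Type*} [CommRing A]

/-- The defining relations of the Hecke algebra with parameter `Q`. -/
inductive Rel (Q : A) (n : ℕ) :
    FreeAlgebra A (Fin (n - 1)) → FreeAlgebra A (Fin (n - 1)) → Prop
  | braid (i j : Fin (n - 1)) (h : (i : ℕ) + 1 = j) :
      Rel Q n (FreeAlgebra.ι A i * FreeAlgebra.ι A j * FreeAlgebra.ι A i)
        (FreeAlgebra.ι A j * FreeAlgebra.ι A i * FreeAlgebra.ι A j)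
  | comm (i j : Fin (n - 1)) (h : (i : ℕ) + 1 < j) :
      Rel Q n (FreeAlgebra.ι A i * FreeAlgebra.ι A j) (FreeAlgebra.ι A j * FreeAlgebra.ι A i)
  | quad (i : Fin (n - 1)) :
      Rel Q n (FreeAlgebra.ι A i * FreeAlgebra.ι A i) (Q • FreeAlgebra.ι A i + 1)

end Hecke

/-- The Hecke algebra `ℋ_n` of the symmetric group `𝔖_n` with parameter `Q` (where `Q = q - q⁻¹`),
presented by the generators `T_1, …, T_{n-1}`, the braid relations and `T_i ^ 2 = Q T_i + 1`. -/
def Hecke (A : Type*) [CommRing A] (Q : A) (n : ℕ) : Type _ := RingQuot (Rel Q n)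

section Hecke

variable {A : Type*} [CommRing A] {Q : A} {n : ℕ}

noncomputable instance : Ring (Hecke A Q n) := inferInstanceAs (Ring (RingQuot (Rel Q n)))

noncomputable instance : Algebra A (Hecke A Q n) :=
  inferInstanceAs (Algebra A (RingQuot (Rel Q n)))

variable (A Q n) in
/-- The quotient map from the free algebra to the Hecke algebra. -/
noncomputable def mk : FreeAlgebra A (Fin (n - 1)) →ₐ[A] Hecke A Q n :=
  RingQuot.mkAlgHom A (Rel Q n)

theorem mk_rel {x y : FreeAlgebra A (Fin (n - 1))} (h : Rel Q n x y) :
    mk A Q n x = mk A Q n y :=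
  RingQuot.mkAlgHom_rel A h

variable (A Q) in
/-- The generators of the Hecke algebra. -/
noncomputable def gen (i : Fin (n - 1)) : Hecke A Q n :=
  mk A Q n (FreeAlgebra.ι A i)

theorem gen_braid (i j : Fin (n - 1)) (h : (i : ℕ) + 1 = j) :
    gen A Q i * gen A Q j * gen A Q i = gen A Q j * gen A Q i * gen A Q j := by
  simpa only [map_mul, gen] using mk_rel (Rel.braid (Q := Q) i j h)

theorem gen_comm (i j : Fin (n - 1)) (h : (i : ℕ) + 1 < j) :
    gen A Q i * gen A Q j = gen A Q j * gen A Q i := by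
  simpa only [map_mul, gen] using mk_rel (Rel.comm (Q := Q) i j h)

theorem gen_quad (i : Fin (n - 1)) :
    gen A Q i * gen A Q i = Q • gen A Q i + 1 := by
  simpa only [map_mul, map_add, map_smul, map_one, gen] using mk_rel (Rel.quad (Q := Q) i)

/-- The universal property of the Hecke algebra. -/
noncomputable def lift {B : Type*} [Ring B] [Algebra A B] (f : Fin (n - 1) → B)
    (hb : ∀ i j : Fin (n - 1), (i : ℕ) + 1 = j → f i * f j * f i = f j * f i * f j)
    (hc : ∀ i j : Fin (n - 1), (i : ℕ) + 1 < j → f i * f j = f j * f i)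
    (hq : ∀ i, f i * f i = Q • f i + 1) : Hecke A Q n →ₐ[A] B :=
  RingQuot.liftAlgHom A ⟨FreeAlgebra.lift A f, by
    intro x y h
    cases h with
    | braid i j h => simpa only [map_mul, FreeAlgebra.lift_ι_apply] using hb i j h
    | comm i j h => simpa only [map_mul, FreeAlgebra.lift_ι_apply] using hc i j h
    | quad i =>
      simpa only [map_mul, map_add, map_smul, map_one, FreeAlgebra.lift_ι_apply] using hq i⟩

theorem lift_gen {B : Type*} [Ring B] [Algebra A B] (f : Fin (n - 1) → B) (hb) (hc) (hq)
    (i : Fin (n - 1)) : lift (Q := Q) f hb hc hq (gen A Q i) = f i :=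
  (RingQuot.liftAlgHom_mkAlgHom_apply A _ _ _).trans (FreeAlgebra.lift_ι_apply _ _)

theorem hecke_induction {p : Hecke A Q n → Prop} (h : Hecke A Q n)
    (h1 : p 1) (hadd : ∀ x y, p x → p y → p (x + y)) (hsmul : ∀ (a : A) x, p x → p (a • x))
    (hmul : ∀ i x, p x → p (gen A Q i * x)) : p h := by
  obtain ⟨x, rfl⟩ : ∃ x, mk A Q n x = h := RingQuot.mkAlgHom_surjective A (Rel Q n) h
  suffices H : ∀ y : Hecke A Q n, p y → p (mk A Q n x * y) by
    have := H 1 h1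
    rwa [mul_one] at this
  induction x using FreeAlgebra.induction with
  | grade0 r =>
    intro y hy
    rw [AlgHom.commutes, ← Algebra.smul_def]
    exact hsmul r y hy
  | grade1 i => exact fun y hy => hmul i y hy
  | mul a b ha hb =>
    intro y hy
    rw [map_mul, mul_assoc]
    exact ha _ (hb _ hy)
  | add a b ha hb =>
    intro y hy
    rw [map_add, add_mul]
    exact hadd _ _ (ha _ hy) (hb _ hy)

/-! ### Lengths and reduced words -/

theorem lo_lt_hi (i : Fin (n - 1)) : lo i < hi i := by
  simp [lo, hi, Fin.lt_def]

theorem s_mul_s (i : Fin (n - 1)) (w : Perm (Fin n)) : s i * (s i * w) = w := by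
  rw [← mul_assoc, s, swap_mul_self, one_mul]

theorem s_mul_inv_lo (i : Fin (n - 1)) (w : Perm (Fin n)) :
    (s i * w)⁻¹ (lo i) = w⁻¹ (hi i) := by
  simp [s]

theorem s_mul_inv_hi (i : Fin (n - 1)) (w : Perm (Fin n)) :
    (s i * w)⁻¹ (hi i) = w⁻¹ (lo i) := by
  simp [s]

theorem len_s_mul_of_lt {i : Fin (n - 1)} {w : Perm (Fin n)} (h : w⁻¹ (lo i) < w⁻¹ (hi i)) :
    len (s i * w) = len w + 1 := by
  have key : (Finset.univ.filter fun p : Fin n × Fin n =>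
      p.1 < p.2 ∧ (s i * w) p.2 < (s i * w) p.1) =
      insert (w⁻¹ (lo i), w⁻¹ (hi i))
        (Finset.univ.filter fun p : Fin n × Fin n => p.1 < p.2 ∧ w p.2 < w p.1) := by
    ext ⟨p, r⟩
    obtain ⟨x, rfl⟩ := (w⁻¹).surjective p
    obtain ⟨y, rfl⟩ := (w⁻¹).surjective r
    simp only [Finset.mem_filter, Finset.mem_univ, true_and, Finset.mem_insert, Prod.mk.injEq,
      EmbeddingLike.apply_eq_iff_eq, Perm.mul_apply, Perm.coe_inv, apply_symm_apply, s, swap_apply_def]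
    have e : ∀ a b : Fin n, a = b ↔ (a : ℕ) = b := fun a b => Fin.ext_iff
    have hl : (lo i : ℕ) = i := rfl
    have hh : (hi i : ℕ) = i + 1 := rfl
    by_cases hx1 : x = lo i <;> by_cases hx2 : x = hi i <;>
      by_cases hy1 : y = lo i <;> by_cases hy2 : y = hi i <;>
      simp_all [-Fin.val_fin_lt] <;> grind
  rw [len, key, Finset.card_insert_of_notMem, len]
  simp only [Finset.mem_filter, Finset.mem_univ, true_and, Perm.coe_inv, apply_symm_apply, not_and, not_lt]
  exact fun _ => (lo_lt_hi i).le

theorem len_s_mul_of_gt {i : Fin (n - 1)} {w : Perm (Fin n)} (h : w⁻¹ (hi i) < w⁻¹ (lo i)) :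
    len (s i * w) + 1 = len w := by
  have := len_s_mul_of_lt (i := i) (w := s i * w) (by rwa [s_mul_inv_lo, s_mul_inv_hi])
  rw [s_mul_s] at this
  exact this.symm

theorem lt_or_gt (i : Fin (n - 1)) (w : Perm (Fin n)) :
    w⁻¹ (lo i) < w⁻¹ (hi i) ∨ w⁻¹ (hi i) < w⁻¹ (lo i) :=
  lt_or_gt_of_ne fun h => (lo_lt_hi i).ne (w⁻¹.injective h)

theorem len_one : len (1 : Perm (Fin n)) = 0 := by
  simp only [len, Finset.card_eq_zero, Finset.filter_eq_empty_iff]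
  intro p _ h
  exact lt_asymm h.1 h.2

theorem eq_one_of_forall_lt {w : Perm (Fin n)}
    (h : ∀ i : Fin (n - 1), w⁻¹ (lo i) < w⁻¹ (hi i)) : w = 1 := by
  have hm : StrictMono (w⁻¹ : Perm (Fin n)) := by
    cases n with
    | zero => exact fun a => a.elim0
    | succ m => exact Fin.strictMono_iff_lt_succ.2 fun i => h i
  have h1 : hm.orderIsoOfSurjective _ (w⁻¹).surjective = OrderIso.refl _ := Subsingleton.elim _ _
  have h2 : (w⁻¹ : Perm (Fin n)) = 1 := Equiv.ext fun x => DFunLike.congr_fun h1 x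
  simpa using h2

theorem exists_isReducedWord (w : Perm (Fin n)) : ∃ l, IsReducedWord l w := by
  induction hk : len w generalizing w with
  | zero =>
    have : w = 1 := eq_one_of_forall_lt fun i => (lt_or_gt i w).resolve_right fun h => by
      have := len_s_mul_of_gt h
      omega
    subst this
    exact ⟨[], rfl, hk.symm⟩
  | succ k ih =>
    have : ∃ i : Fin (n - 1), w⁻¹ (hi i) < w⁻¹ (lo i) := by
      by_contra hne
      have : w = 1 := eq_one_of_forall_lt fun i =>
        (lt_or_gt i w).resolve_right fun h => hne ⟨i, h⟩
      rw [this, len_one] at hk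
      omega
    obtain ⟨i, hi⟩ := this
    have hlen := len_s_mul_of_gt hi
    obtain ⟨l, hl, hl'⟩ := ih (s i * w) (by omega)
    refine ⟨i :: l, ?_, ?_⟩
    · rw [List.map_cons, List.prod_cons, hl, s_mul_s]
    · rw [List.length_cons, hl', hlen]

theorem len_prod_le (l : List (Fin (n - 1))) : len (l.map s).prod ≤ l.length := by
  induction l with
  | nil => exact len_one.le
  | cons i l ih =>
    rw [List.map_cons, List.prod_cons, List.length_cons]
    rcases lt_or_gt i (l.map s).prod with h | h
    · rw [len_s_mul_of_lt h]
      omega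
    · have := len_s_mul_of_gt h
      omega

theorem IsReducedWord.cons {r : List (Fin (n - 1))} {i : Fin (n - 1)} {w : Perm (Fin n)}
    (hr : IsReducedWord r (s i * w)) (h : w⁻¹ (hi i) < w⁻¹ (lo i)) : IsReducedWord (i :: r) w := by
  refine ⟨?_, ?_⟩
  · rw [List.map_cons, List.prod_cons, hr.1, s_mul_s]
  · rw [List.length_cons, hr.2, len_s_mul_of_gt h]

theorem IsReducedWord.tail {r : List (Fin (n - 1))} {i : Fin (n - 1)} {w : Perm (Fin n)}
    (hr : IsReducedWord (i :: r) w) :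
    IsReducedWord r (s i * w) ∧ w⁻¹ (hi i) < w⁻¹ (lo i) := by
  obtain ⟨h1, h2⟩ := hr
  rw [List.map_cons, List.prod_cons] at h1
  rw [List.length_cons] at h2
  have h3 : (r.map s).prod = s i * w := by rw [← h1, s_mul_s]
  have h4 := len_prod_le r
  rw [h3] at h4
  have h5 : w⁻¹ (hi i) < w⁻¹ (lo i) := (lt_or_gt i w).resolve_left fun h => by
    have := len_s_mul_of_lt h
    omega
  have := len_s_mul_of_gt h5
  exact ⟨⟨h3, by omega⟩, h5⟩

theorem s_mul_inv (i : Fin (n - 1)) (w : Perm (Fin n)) (x : Fin n) :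
    (s i * w)⁻¹ x = w⁻¹ (s i x) := by
  simp [s]

theorem s_apply_of_ne {i : Fin (n - 1)} {x : Fin n} (h1 : (x : ℕ) ≠ i) (h2 : (x : ℕ) ≠ i + 1) :
    s i x = x :=
  swap_apply_of_ne_of_ne (fun h => h1 (congrArg Fin.val h)) (fun h => h2 (congrArg Fin.val h))

theorem s_apply_lo (i : Fin (n - 1)) : s i (lo i) = hi i := swap_apply_left _ _

theorem s_apply_hi (i : Fin (n - 1)) : s i (hi i) = lo i := swap_apply_right _ _

theorem s_comm {i j : Fin (n - 1)} (h : (i : ℕ) + 1 < j) : s i * s j = s j * s i := by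
  refine Perm.Disjoint.commute fun x => ?_
  by_cases h1 : (x : ℕ) = i ∨ (x : ℕ) = i + 1
  · exact Or.inr (s_apply_of_ne (by omega) (by omega))
  · exact Or.inl (s_apply_of_ne (by omega) (by omega))

theorem swap_braid {α : Type*} [DecidableEq α] {x y z : α} (hxy : x ≠ y) (hyz : y ≠ z)
    (hxz : x ≠ z) : swap x y * (swap y z * swap x y) = swap y z * (swap x y * swap y z) := by
  ext t
  simp only [Perm.mul_apply, swap_apply_def]
  split_ifs <;> simp_all

theorem lo_eq_hi {i j : Fin (n - 1)} (h : (i : ℕ) + 1 = j) : lo j = hi i := Fin.ext h.symm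

theorem s_braid {i j : Fin (n - 1)} (h : (i : ℕ) + 1 = j) :
    s i * (s j * s i) = s j * (s i * s j) := by
  have h1 := lo_lt_hi i
  have h2 := lo_lt_hi j
  rw [lo_eq_hi h] at h2
  rw [s, s, lo_eq_hi h]
  exact swap_braid h1.ne h2.ne (h1.trans h2).ne

/-- The product of the generators along a reduced word depends only on the permutation. -/
theorem prod_gen_eq {w : Perm (Fin n)} {l l' : List (Fin (n - 1))} (hl : IsReducedWord l w)
    (hl' : IsReducedWord l' w) : (l.map (gen A Q)).prod = (l'.map (gen A Q)).prod := by
  induction hk : len w generalizing w l l' with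
  | zero =>
    rw [List.eq_nil_of_length_eq_zero (hl.2.trans hk),
      List.eq_nil_of_length_eq_zero (hl'.2.trans hk)]
  | succ k ih =>
    obtain ⟨i, m, rfl⟩ := List.exists_cons_of_length_eq_add_one (hl.2.trans hk)
    obtain ⟨j, m', rfl⟩ := List.exists_cons_of_length_eq_add_one (hl'.2.trans hk)
    have main : ∀ (i j : Fin (n - 1)) (m m' : List (Fin (n - 1))), (i : ℕ) < j →
        IsReducedWord (i :: m) w → IsReducedWord (j :: m') w →
        gen A Q i * (m.map (gen A Q)).prod = gen A Q j * (m'.map (gen A Q)).prod := by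
      intro i j m m' hij h h'
      obtain ⟨hm, di⟩ := h.tail
      obtain ⟨hm', dj⟩ := h'.tail
      have li := len_s_mul_of_gt di
      have lj := len_s_mul_of_gt dj
      rcases (Nat.succ_le_of_lt hij).lt_or_eq with hc | hc
      · have e : s j * (s i * w) = s i * (s j * w) := by
          rw [← mul_assoc, ← mul_assoc, s_comm hc]
        obtain ⟨r, hr⟩ := exists_isReducedWord (s j * (s i * w))
        have r1 : IsReducedWord (j :: r) (s i * w) := hr.cons (by
          rw [s_mul_inv, s_mul_inv, s_apply_of_ne, s_apply_of_ne]
          · exact dj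
          all_goals simp only [lo, hi]; omega)
        have r2 : IsReducedWord (i :: r) (s j * w) := (e ▸ hr).cons (by
          rw [s_mul_inv, s_mul_inv, s_apply_of_ne, s_apply_of_ne]
          · exact di
          all_goals simp only [lo, hi]; omega)
        rw [ih hm r1 (by omega), ih hm' r2 (by omega)]
        simp only [List.map_cons, List.prod_cons, ← mul_assoc]
        rw [gen_comm i j hc]
      · have hc' : (i : ℕ) + 1 = j := hc
        have e : s i * (s j * (s i * w)) = s j * (s i * (s j * w)) := by
          have := congrArg (· * w) (s_braid hc')
          simpa only [mul_assoc] using this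
        have hlo := lo_eq_hi hc'
        obtain ⟨r, hr⟩ := exists_isReducedWord (s i * (s j * (s i * w)))
        have e1 : s i (hi j) = hi j := s_apply_of_ne (by simp only [hi]; omega)
          (by simp only [hi]; omega)
        have e2 : s j (lo i) = lo i := s_apply_of_ne (by simp only [lo]; omega)
          (by simp only [lo]; omega)
        have e3 : s j (hi i) = hi j := by rw [← hlo, s_apply_lo]
        have e4 : s i (lo j) = lo i := by rw [hlo, s_apply_hi]
        have e5 : s j (hi j) = hi i := by rw [s_apply_hi, hlo]
        have e6 : s i (lo i) = lo j := by rw [s_apply_lo, hlo]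
        have r1 : IsReducedWord (j :: i :: r) (s i * w) := by
          refine (hr.cons ?_).cons ?_
          · simp only [s_mul_inv, e2, e3, e1, e6]
            exact dj
          · simp only [s_mul_inv, e1, e4]
            exact dj.trans (hlo ▸ di)
        have r2 : IsReducedWord (i :: j :: r) (s j * w) := by
          refine ((e ▸ hr).cons ?_).cons ?_
          · simp only [s_mul_inv, e1, e4, e5, e2]
            exact di
          · simp only [s_mul_inv, e2, e3]
            exact dj.trans (hlo ▸ di)
        rw [ih hm r1 (by omega), ih hm' r2 (by omega)]
        simp only [List.map_cons, List.prod_cons, ← mul_assoc]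
        rw [gen_braid i j hc']
    rw [List.map_cons, List.map_cons, List.prod_cons, List.prod_cons]
    rcases lt_trichotomy (i : ℕ) j with h | h | h
    · exact main i j m m' h hl hl'
    · obtain rfl : i = j := Fin.ext h
      have := len_s_mul_of_gt hl.tail.2
      rw [ih hl.tail.1 hl'.tail.1 (by omega)]
    · exact (main j i m' m h hl' hl).symm

/-! ### The basis `T_w` and the scalar product -/

variable (A Q) in
/-- The element `T_w`: the product of the generators along a reduced decomposition of `w`. -/
noncomputable def T (w : Perm (Fin n)) : Hecke A Q n :=
  ((exists_isReducedWord w).choose.map (gen A Q)).prod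

theorem T_eq_of_isReducedWord {w : Perm (Fin n)} {l : List (Fin (n - 1))}
    (hl : IsReducedWord l w) : T A Q w = (l.map (gen A Q)).prod :=
  prod_gen_eq (exists_isReducedWord w).choose_spec hl

theorem T_one : T A Q (1 : Perm (Fin n)) = 1 :=
  T_eq_of_isReducedWord (l := []) ⟨rfl, len_one.symm⟩

theorem gen_mul_T_of_lt {i : Fin (n - 1)} {w : Perm (Fin n)} (h : w⁻¹ (lo i) < w⁻¹ (hi i)) :
    gen A Q i * T A Q w = T A Q (s i * w) := by
  obtain ⟨l, hl⟩ := exists_isReducedWord w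
  have : IsReducedWord (i :: l) (s i * w) :=
    IsReducedWord.cons (by rwa [s_mul_s]) (by rwa [s_mul_inv_lo, s_mul_inv_hi])
  rw [T_eq_of_isReducedWord hl, T_eq_of_isReducedWord this, List.map_cons, List.prod_cons]

theorem gen_mul_T_of_gt {i : Fin (n - 1)} {w : Perm (Fin n)} (h : w⁻¹ (hi i) < w⁻¹ (lo i)) :
    gen A Q i * T A Q w = T A Q (s i * w) + Q • T A Q w := by
  have h1 : gen A Q i * T A Q (s i * w) = T A Q w := by
    rw [gen_mul_T_of_lt (by rwa [s_mul_inv_lo, s_mul_inv_hi]), s_mul_s]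
  rw [← h1, ← mul_assoc, gen_quad, add_mul, one_mul, smul_mul_assoc, h1, add_comm]

variable (Q) in
/-- The operator on the free module on permutations modelling left multiplication by a generator,
the transposition involved being `(x y)`. -/
noncomputable def op (x y : Fin n) : Module.End A (Perm (Fin n) →₀ A) :=
  Finsupp.linearCombination A fun w =>
    if w⁻¹ x < w⁻¹ y then Finsupp.single (swap x y * w) (1 : A)
    else Finsupp.single (swap x y * w) 1 + Q • Finsupp.single w 1

theorem op_single (x y : Fin n) (w : Perm (Fin n)) :
    op Q x y (Finsupp.single w 1) = if w⁻¹ x < w⁻¹ y then Finsupp.single (swap x y * w) (1 : A)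
    else Finsupp.single (swap x y * w) 1 + Q • Finsupp.single w 1 := by
  simp [op]

theorem end_ext {f g : Module.End A (Perm (Fin n) →₀ A)}
    (h : ∀ w, f (Finsupp.single w 1) = g (Finsupp.single w 1)) : f = g := by
  ext w : 2
  exact h w

theorem op_quad {x y : Fin n} (hxy : x ≠ y) : op Q x y * op Q x y = Q • op Q x y + 1 := by
  refine end_ext fun w => ?_
  have h : w⁻¹ x ≠ w⁻¹ y := fun e => hxy (w⁻¹.injective e)
  have hs : ∀ t, (swap x y * w)⁻¹ t = w⁻¹ (swap x y t) := by simp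
  have h2 : swap x y * (swap x y * w) = w := by rw [← mul_assoc, swap_mul_self, one_mul]
  rw [Module.End.mul_apply, LinearMap.add_apply, LinearMap.smul_apply, Module.End.one_apply]
  rcases lt_or_gt_of_ne h with h | h
  · simp only [op_single, if_pos h, hs, swap_apply_left, swap_apply_right, if_neg h.asymm, h2]
    abel
  · simp only [op_single, if_neg h.asymm, map_add, map_smul, hs, swap_apply_left, swap_apply_right,
      if_pos h, h2]
    abel

theorem op_comm {x y z t : Fin n} (hxz : x ≠ z) (hxt : x ≠ t) (hyz : y ≠ z) (hyt : y ≠ t) :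
    op Q x y * op Q z t = op Q z t * op Q x y := by
  refine end_ext fun w => ?_
  have hs : ∀ a b t, (swap a b * w)⁻¹ t = w⁻¹ (swap a b t) := by simp
  have hc : swap x y * (swap z t * w) = swap z t * (swap x y * w) := by
    rw [← mul_assoc, ← mul_assoc]
    congr 1
    ext a
    simp only [Perm.mul_apply, swap_apply_def]
    split_ifs <;> simp_all
  rw [Module.End.mul_apply, Module.End.mul_apply]
  by_cases h1 : w⁻¹ x < w⁻¹ y <;> by_cases h2 : w⁻¹ z < w⁻¹ t <;>
    simp only [op_single, h1, h2, if_true, if_false, map_add, map_smul, hs,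
      swap_apply_of_ne_of_ne hxz hxt, swap_apply_of_ne_of_ne hyz hyt,
      swap_apply_of_ne_of_ne hxz.symm hyz.symm, swap_apply_of_ne_of_ne hxt.symm hyt.symm, hc,
      smul_add]
  abel

theorem op_braid {x y z : Fin n} (hxy : x ≠ y) (hyz : y ≠ z) (hxz : x ≠ z) :
    op Q x y * op Q y z * op Q x y = op Q y z * op Q x y * op Q y z := by
  refine end_ext fun w => ?_
  have hs : ∀ a b (v : Perm (Fin n)) t, (swap a b * v)⁻¹ t = v⁻¹ (swap a b t) := by simp
  have hc : swap x y * (swap y z * (swap x y * w)) = swap y z * (swap x y * (swap y z * w)) := by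
    have := congrArg (· * w) (swap_braid hxy hyz hxz)
    simpa only [mul_assoc] using this
  have h2 : ∀ (a b : Fin n) (v : Perm (Fin n)), swap a b * (swap a b * v) = v := fun a b v => by
    rw [← mul_assoc, swap_mul_self, one_mul]
  have n1 : w⁻¹ x ≠ w⁻¹ y := fun e => hxy (w⁻¹.injective e)
  have n2 : w⁻¹ y ≠ w⁻¹ z := fun e => hyz (w⁻¹.injective e)
  have n3 : w⁻¹ x ≠ w⁻¹ z := fun e => hxz (w⁻¹.injective e)
  have e1 : swap x y z = z := swap_apply_of_ne_of_ne hxz.symm hyz.symm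
  have e2 : swap y z x = x := swap_apply_of_ne_of_ne hxy hxz
  simp only [Module.End.mul_apply]
  rcases lt_or_gt_of_ne n1 with h1 | h1 <;> rcases lt_or_gt_of_ne n2 with h2' | h2' <;>
    rcases lt_or_gt_of_ne n3 with h3 | h3 <;>
    first
    | exact absurd (h1.trans h2') h3.asymm
    | exact absurd (h2'.trans h1) h3.asymm
    | simp only [op_single, hs, map_add, map_smul, swap_apply_left, swap_apply_right, e1, e2, h1,
        h2', h3, h1.asymm, h2'.asymm, h3.asymm, if_true, if_false, h2, hc, smul_add]
      try abel

variable (A Q n) in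
/-- The left regular representation of the Hecke algebra in the basis `T_w`. -/
noncomputable def regRep : Hecke A Q n →ₐ[A] Module.End A (Perm (Fin n) →₀ A) :=
  lift (fun i => op Q (lo i) (hi i))
    (fun i j h => by
      have h1 := lo_lt_hi i
      have h2 := lo_lt_hi j
      rw [lo_eq_hi h] at h2 ⊢
      exact op_braid h1.ne h2.ne (h1.trans h2).ne)
    (fun i j h => by
      apply op_comm <;> simp only [lo, hi, ne_eq, Fin.mk.injEq] <;> omega)
    (fun i => op_quad (lo_lt_hi i).ne)

theorem regRep_gen (i : Fin (n - 1)) : regRep A Q n (gen A Q i) = op Q (lo i) (hi i) :=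
  lift_gen _ _ _ _ i

theorem regRep_T (w : Perm (Fin n)) :
    regRep A Q n (T A Q w) (Finsupp.single 1 1) = Finsupp.single w 1 := by
  obtain ⟨l, hl⟩ := exists_isReducedWord w
  rw [T_eq_of_isReducedWord hl]
  induction l generalizing w with
  | nil =>
    rw [← hl.1]
    simp
  | cons i l ih =>
    obtain ⟨h1, h2⟩ := hl.tail
    rw [List.map_cons, List.prod_cons, map_mul, Module.End.mul_apply, ih _ h1, regRep_gen,
      op_single, s_mul_inv_lo, s_mul_inv_hi, if_pos h2]
    exact congrArg (fun v => Finsupp.single v (1 : A)) (s_mul_s i w)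

variable (A Q n) in
/-- The linear isomorphism between the free module on permutations and the Hecke algebra
sending `w` to `T_w`. -/
noncomputable def equivT : (Perm (Fin n) →₀ A) ≃ₗ[A] Hecke A Q n :=
  LinearEquiv.ofLinearMap (Finsupp.linearCombination A (T A Q))
    ((LinearMap.applyₗ (Finsupp.single 1 1)).comp (regRep A Q n).toLinearMap)
    (by
      have key : ∀ (i : Fin (n - 1)) (f : Perm (Fin n) →₀ A),
          Finsupp.linearCombination A (T A Q) (op Q (lo i) (hi i) f) =
            gen A Q i * Finsupp.linearCombination A (T A Q) f := by
        intro i f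
        induction f using Finsupp.induction_linear with
        | zero => simp
        | add f g hf hg => rw [map_add, map_add, hf, hg, map_add, mul_add]
        | single w a =>
          rw [← mul_one a, ← smul_eq_mul, ← Finsupp.smul_single, map_smul, map_smul, map_smul,
            mul_smul_comm, op_single]
          congr 1
          rcases lt_or_gt i w with h | h
          · rw [if_pos h]
            simp [gen_mul_T_of_lt h, ← s.eq_1]
          · rw [if_neg h.asymm]
            simp [gen_mul_T_of_gt h, ← s.eq_1]
      ext h
      simp only [LinearMap.comp_apply, LinearMap.id_apply, AlgHom.toLinearMap_apply,
        LinearMap.applyₗ_apply_apply]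
      induction h using hecke_induction with
      | h1 => simp [T_one]
      | hadd x y hx hy => rw [map_add, LinearMap.add_apply, map_add, hx, hy]
      | hsmul a x hx => rw [map_smul, LinearMap.smul_apply, map_smul, hx]
      | hmul i x hx => rw [map_mul, Module.End.mul_apply, regRep_gen, key, hx])
    (by
      ext w : 2
      simp [regRep_T])

variable (A Q n) in
/-- The elements `T_w` form a basis of the Hecke algebra. -/
noncomputable def basisT : Module.Basis (Perm (Fin n)) A (Hecke A Q n) :=
  Module.Basis.ofRepr (equivT A Q n).symm

theorem basisT_apply (w : Perm (Fin n)) : basisT A Q n w = T A Q w := by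
  rw [basisT, Module.Basis.coe_ofRepr]
  simp [equivT]

/-- The scalar product on the Hecke algebra for which the basis `T_w` is orthonormal. -/
noncomputable def pairing (g h : Hecke A Q n) : A := (basisT A Q n).toDual g h

theorem pairing_T (v w : Perm (Fin n)) :
    pairing (T A Q v) (T A Q w) = if v = w then 1 else 0 := by
  rw [pairing, ← basisT_apply, ← basisT_apply, Module.Basis.toDual_apply]

/-! ### Direct products -/

/-- The morphism from the Hecke algebra of the `b`-th factor of `𝔖_J` to `ℋ_n`, which shifts the
indices of the generators. -/
noncomputable def blockHom (J : Composition n) (b : Fin J.length) :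
    Hecke A Q (J.blocksFun b) →ₐ[A] Hecke A Q n :=
  lift (fun i => gen A Q ⟨J.sizeUpTo b + i, by
      have h1 := J.sizeUpTo_succ' b
      have h2 := J.sizeUpTo_le (b + 1)
      omega⟩)
    (fun i j h => gen_braid _ _ (by simp only; omega))
    (fun i j h => gen_comm _ _ (by simp only; omega))
    (fun i => gen_quad _)

/-- The direct product `h_1 × h_2 × ⋯ × h_r`, an element of `ℋ(𝔖_J) ⊆ ℋ_n`. -/
noncomputable def directProd (J : Composition n)
    (h : ∀ b : Fin J.length, Hecke A Q (J.blocksFun b)) : Hecke A Q n :=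
  (List.ofFn fun b => blockHom J b (h b)).prod

/-! ### The elements of the Hecke algebra involved -/

variable (A Q) in
/-- `T_k ⋯ T_2 T_1` (the index `k` being counted from `0`). -/
noncomputable def down (k : Fin (n - 1)) : Hecke A Q n :=
  (List.ofFn fun i : Fin (k + 1) => gen A Q ⟨k - i, by omega⟩).prod

variable (A Q) in
/-- `T_1 T_2 ⋯ T_k` (the index `k` being counted from `0`). -/
noncomputable def up (k : Fin (n - 1)) : Hecke A Q n :=
  (List.ofFn fun i : Fin (k + 1) => gen A Q ⟨i, by omega⟩).prod

variable (A Q) in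
/-- The Jucys-Murphy elements other than `ξ_1 = 1`: for `k = 0, 1, …, n - 2`, this is
`ξ_{k+2} = T_{k+1} ⋯ T_1 T_1 ⋯ T_{k+1}`. -/
noncomputable def jucysMurphy (k : Fin (n - 1)) : Hecke A Q n := down A Q k * up A Q k

variable (A Q n) in
/-- `ζ_n = T_{n-1} ⋯ T_2 T_1`. -/
noncomputable def zetaOne : Hecke A Q n :=
  (List.ofFn fun i : Fin (n - 1) => gen A Q i.rev).prod

variable (A Q) in
/-- `ζ_K = ζ_{k_1} × ζ_{k_2} × ⋯`. -/
noncomputable def zeta (K : Composition n) : Hecke A Q n :=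
  directProd K fun b => zetaOne A Q (K.blocksFun b)

variable (Q n) in
/-- `E_n(z) = (1 + z T_1) (1 + z T_2 T_1) ⋯ (1 + z T_{n-1} ⋯ T_1)`. -/
noncomputable def EOne (z : A) : Hecke A Q n :=
  (List.ofFn fun k : Fin (n - 1) => 1 + z • down A Q k).prod

variable (Q) in
/-- `E_J(z_1, …, z_r) = E_{j_1}(z_1) × ⋯ × E_{j_r}(z_r)`. -/
noncomputable def E (J : Composition n) (z : Fin J.length → A) : Hecke A Q n :=
  directProd J fun b => EOne Q (J.blocksFun b) (z b)

variable (Q n) in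
/-- `E_n^ξ(z) = (1 + z ξ_2) (1 + z ξ_3) ⋯ (1 + z ξ_n)`. -/
noncomputable def EXiOne (z : A) : Hecke A Q n :=
  (List.ofFn fun k : Fin (n - 1) => 1 + z • jucysMurphy A Q k).prod

variable (Q) in
/-- `E_J^ξ(z_1, …, z_r) = E_{j_1}^ξ(z_1) × ⋯ × E_{j_r}^ξ(z_r)`. -/
noncomputable def EXi (J : Composition n) (z : Fin J.length → A) : Hecke A Q n :=
  directProd J fun b => EXiOne Q (J.blocksFun b) (z b)

/-- The normalization `𝒩_J(h) = ∑ T_w h T_{w⁻¹}`, summed over minimal coset representatives `w`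
of `𝔖_n / 𝔖_J`. -/
noncomputable def normalization (J : Composition n) (h : Hecke A Q n) : Hecke A Q n :=
  ∑ w ∈ minCosetReps J, T A Q w * h * T A Q w⁻¹

variable (A Q) in
/-- `L[K]`: the sum of all `T_w` with `w` of maximal length in its coset `𝔖_K w`. -/
noncomputable def L (K : Composition n) : Hecke A Q n :=
  ∑ w ∈ maxCosetReps K, T A Q w

end Hecke

/-! ### Symmetric functions

Symmetric functions are realized as power series in the countably many variables
`x_0, x_1, x_2, …`. -/

section Symmetric

variable (A : Type*) [CommRing A]

/-- The monomial symmetric function `m_λ`: the sum of all distinct monomials whose exponents are,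
up to order, the parts of `λ`. -/
noncomputable def monomialSymm {n : ℕ} (p : n.Partition) : MvPowerSeries ℕ A :=
  open scoped Classical in fun d => if d.support.val.map d = p.parts then 1 else 0

/-- The Schur function `S_μ`: the generating function of semistandard Young tableaux of shape `μ`,
a tableau contributing the monomial `∏ x_a ^ (number of entries equal to a)`. -/
noncomputable def schur (μ : YoungDiagram) : MvPowerSeries ℕ A := fun d =>
  (Nat.card {t : SemistandardYoungTableau μ //
    ∀ a, (μ.cells.filter fun c => t c.1 c.2 = a).card = d a} : A)

/-- The hook-shaped Young diagram of the partition `(a + 1, 1 ^ b)`. -/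
def hook (a b : ℕ) : YoungDiagram :=
  YoungDiagram.ofRowLens ((a + 1) :: List.replicate b 1) (by
    rw [List.sortedGE_iff_pairwise, List.pairwise_cons]
    refine ⟨fun x hx => ?_, List.pairwise_replicate.2 (Or.inr le_rfl)⟩
    rw [List.eq_of_mem_replicate hx]
    omega)

/-- The product over the parts `j_b` of `J` of
`S_{1^{j_b}} + z_b S_{2,1^{j_b-2}} + ⋯ + z_b^{j_b-1} S_{j_b}`. -/
noncomputable def hookProd {n : ℕ} (J : Composition n) (z : Fin J.length → A) :
    MvPowerSeries ℕ A :=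
  ∏ b, ∑ k ∈ Finset.range (J.blocksFun b), z b ^ k • schur A (hook k (J.blocksFun b - 1 - k))

end Symmetric

end IwahoriHecke

/-!
Both scalar products are sums over the minimal representatives `w` of `𝔖_n / 𝔖_J`, and they agree
term by term, up to the factor `Q ^ (n - ℓ(K))`, with an explicit `weight J K z w`.  This weight is
nonzero only when `w` is *block-decreasing*: inside each block of `K`, the block of `J` containing
the position of a value weakly decreases as the value increases.  It is then the product, over the
generators `j` of `𝔖_J`, of `z` if the values of `w` at `j` and `j + 1` lie in the same block of
`K` (`j` is *forced*), and of `1 + z` otherwise.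

* First scalar product (`pairing_T_mul_E_L`).  Expanding `E_J` gives `∑ z^S T_v`, over subsets `S`
  of the generators of `𝔖_J`, where `v = valley S` is decreasing and then increasing on each block;
  `S` is the set of the `j` such that `j + 1` occurs before `j` in `v`.  The permutation `w v` is
  maximal in `𝔖_K w v` exactly when `w` is block-decreasing and `S` contains all forced `j`.

* Second scalar product (`pairing_T_mul_EXi_zeta`).  The term of `w` in the normalization is
  `(T_w h, ζ_K T_w)`.  Apply the generators of `ζ_K` to `T_w` one after the other.  A generator
  exchanging two values from different blocks of `J` moves to another coset, and there is no way
  back, since no later generator involves the smaller of the two points; so it contributes only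
  through the term `Q T_w` of the quadratic relation, or not at all.  A generator exchanging two
  values of the same block acts as a generator of `ℋ(𝔖_J)` on the right.  What remains is the
  scalar product of `E_J^ξ` with a product of distinct generators of `𝔖_J`
  (`pairing_prod_one_add_internalJM`), computed from `ξ_m = 1 + Q ∑_{i < m} T_{(i m)}` and the
  fact that `ξ_m` commutes with the earlier generators.

* Symmetric functions.  A semistandard tableau of hook shape is determined by its content and by
  the set of entries below the corner, so a sum of hook Schur functions has coefficient
  `z^(j-ℓ) (1+z)^(ℓ-1)` at a monomial of degree `j` in `ℓ` variables (`coeff_hookSum`).  The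
  coefficient of a product is a sum over matrices with row sums `J` and column sums `K`.
  Counting, for a block-decreasing `w`, the positions in a block of `J` with value in a block of `K`
  is a bijection onto these matrices, which turns the sum into the sum of the weights
  (`coeff_hookProd_exponent`).
-/

namespace IwahoriHecke

open Equiv

/-! ### Multiplication on the right and adjointness -/

section Hecke

variable {A : Type*} [CommRing A] {Q : A} {n : ℕ}

theorem s_inv (i : Fin (n - 1)) : (s i)⁻¹ = s i := swap_inv _ _

theorem mul_s_mul_s (i : Fin (n - 1)) (w : Perm (Fin n)) : w * s i * s i = w := by
  rw [mul_assoc, s, swap_mul_self, mul_one]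

theorem inv_prod_map_s (l : List (Fin (n - 1))) :
    ((l.map s).prod)⁻¹ = (l.reverse.map s).prod := by
  rw [List.prod_inv_reverse, List.map_map, ← List.map_reverse]
  exact congrArg (fun f => (l.reverse.map f).prod) (funext s_inv)

theorem len_inv_le (w : Perm (Fin n)) : len w⁻¹ ≤ len w := by
  obtain ⟨l, h1, h2⟩ := exists_isReducedWord w
  rw [← h1, inv_prod_map_s, h1, ← h2, ← List.length_reverse]
  exact len_prod_le _

theorem len_inv (w : Perm (Fin n)) : len w⁻¹ = len w :=
  (len_inv_le w).antisymm (by simpa using len_inv_le w⁻¹)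

theorem IsReducedWord.reverse {l : List (Fin (n - 1))} {w : Perm (Fin n)}
    (h : IsReducedWord l w) : IsReducedWord l.reverse w⁻¹ := by
  refine ⟨?_, ?_⟩
  · rw [← inv_prod_map_s, h.1]
  · rw [List.length_reverse, h.2, len_inv]

theorem mul_s_eq_inv (i : Fin (n - 1)) (w : Perm (Fin n)) : w * s i = (s i * w⁻¹)⁻¹ := by
  rw [mul_inv_rev, inv_inv, s_inv]

theorem len_mul_s_of_lt {i : Fin (n - 1)} {w : Perm (Fin n)} (h : w (lo i) < w (hi i)) :
    len (w * s i) = len w + 1 := by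
  rw [mul_s_eq_inv, len_inv, len_s_mul_of_lt (by simpa using h), len_inv]

theorem len_mul_s_of_gt {i : Fin (n - 1)} {w : Perm (Fin n)} (h : w (hi i) < w (lo i)) :
    len (w * s i) + 1 = len w := by
  rw [mul_s_eq_inv, len_inv, len_s_mul_of_gt (by simpa using h), len_inv]

theorem mul_s_lo (i : Fin (n - 1)) (w : Perm (Fin n)) : (w * s i) (lo i) = w (hi i) := by
  rw [Perm.mul_apply, s_apply_lo]

theorem mul_s_hi (i : Fin (n - 1)) (w : Perm (Fin n)) : (w * s i) (hi i) = w (lo i) := by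
  rw [Perm.mul_apply, s_apply_hi]

theorem lt_or_gt' (i : Fin (n - 1)) (w : Perm (Fin n)) :
    w (lo i) < w (hi i) ∨ w (hi i) < w (lo i) := by
  simpa using lt_or_gt i w⁻¹

theorem T_mul_gen_of_lt {i : Fin (n - 1)} {w : Perm (Fin n)} (h : w (lo i) < w (hi i)) :
    T A Q w * gen A Q i = T A Q (w * s i) := by
  obtain ⟨l, hl⟩ := exists_isReducedWord w
  have : IsReducedWord (l ++ [i]) (w * s i) := by
    refine ⟨?_, ?_⟩
    · rw [List.map_append, List.prod_append, hl.1, List.map_singleton, List.prod_singleton]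
    · rw [List.length_append, hl.2, len_mul_s_of_lt h, List.length_singleton]
  rw [T_eq_of_isReducedWord hl, T_eq_of_isReducedWord this, List.map_append, List.prod_append,
    List.map_singleton, List.prod_singleton]

theorem T_mul_gen_of_gt {i : Fin (n - 1)} {w : Perm (Fin n)} (h : w (hi i) < w (lo i)) :
    T A Q w * gen A Q i = T A Q (w * s i) + Q • T A Q w := by
  have h1 : T A Q (w * s i) * gen A Q i = T A Q w := by
    rw [T_mul_gen_of_lt (by rwa [mul_s_lo, mul_s_hi]), mul_s_mul_s]
  rw [← h1, mul_assoc, gen_quad, mul_add, mul_one, mul_smul_comm, h1, add_comm]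

theorem T_s (i : Fin (n - 1)) : T A Q (s i) = gen A Q i := by
  have := T_mul_gen_of_lt (A := A) (Q := Q) (w := 1) (i := i) (lo_lt_hi i)
  rwa [T_one, one_mul, one_mul, eq_comm] at this

theorem pairing_add_left (x y g : Hecke A Q n) :
    pairing (x + y) g = pairing x g + pairing y g := by
  simp [pairing]

theorem pairing_add_right (x y g : Hecke A Q n) :
    pairing g (x + y) = pairing g x + pairing g y := by
  simp [pairing]

theorem pairing_smul_left (a : A) (x g : Hecke A Q n) :
    pairing (a • x) g = a * pairing x g := by
  simp [pairing]

theorem pairing_smul_right (a : A) (x g : Hecke A Q n) :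
    pairing g (a • x) = a * pairing g x := by
  simp [pairing]

theorem pairing_zero_left (g : Hecke A Q n) : pairing 0 g = 0 := by
  simp [pairing]

theorem pairing_zero_right (g : Hecke A Q n) : pairing g 0 = 0 := by
  simp [pairing]

theorem pairing_sum_left {ι : Type*} (t : Finset ι) (f : ι → Hecke A Q n) (g : Hecke A Q n) :
    pairing (∑ i ∈ t, f i) g = ∑ i ∈ t, pairing (f i) g := by
  simp [pairing]

theorem pairing_sum_right {ι : Type*} (t : Finset ι) (f : ι → Hecke A Q n) (g : Hecke A Q n) :
    pairing g (∑ i ∈ t, f i) = ∑ i ∈ t, pairing g (f i) := by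
  simp [pairing]

theorem mem_span_T (x : Hecke A Q n) : x ∈ Submodule.span A (Set.range (T A Q (n := n))) := by
  have : Set.range (T A Q (n := n)) = Set.range (basisT A Q n) := by
    congr 1
    exact funext fun w => (basisT_apply w).symm
  rw [this, Module.Basis.span_eq]
  trivial

theorem T_induction {p : Hecke A Q n → Prop} (x : Hecke A Q n) (hT : ∀ w, p (T A Q w))
    (h0 : p 0) (hadd : ∀ x y, p x → p y → p (x + y)) (hsmul : ∀ (a : A) x, p x → p (a • x)) :
    p x := by
  induction mem_span_T x using Submodule.span_induction with
  | mem x h => obtain ⟨w, rfl⟩ := h; exact hT w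
  | zero => exact h0
  | add x y _ _ hx hy => exact hadd x y hx hy
  | smul a x _ hx => exact hsmul a x hx

/-- Left multiplication by a generator is self-adjoint. -/
theorem pairing_gen_mul (i : Fin (n - 1)) (x y : Hecke A Q n) :
    pairing (gen A Q i * x) y = pairing x (gen A Q i * y) := by
  induction x using T_induction with
  | h0 => simp [pairing_zero_left]
  | hadd x x' hx hx' => rw [mul_add, pairing_add_left, pairing_add_left, hx, hx']
  | hsmul a x hx => rw [mul_smul_comm, pairing_smul_left, pairing_smul_left, hx]
  | hT v =>
    induction y using T_induction with
    | h0 => simp [pairing_zero_right]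
    | hadd x x' hx hx' => rw [mul_add, pairing_add_right, pairing_add_right, hx, hx']
    | hsmul a x hx => rw [mul_smul_comm, pairing_smul_right, pairing_smul_right, hx]
    | hT w =>
      have e : s i * v = w ↔ v = s i * w :=
        ⟨fun h => by rw [← h, s_mul_s], fun h => by rw [h, s_mul_s]⟩
      rcases lt_or_gt i v with hv | hv <;> rcases lt_or_gt i w with hw | hw <;>
        simp only [gen_mul_T_of_lt, gen_mul_T_of_gt, hv, hw, pairing_add_left, pairing_add_right,
          pairing_smul_left, pairing_smul_right, pairing_T, e]
      · have h : v ≠ w := fun h => by subst h; exact hv.asymm hw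
        simp [h]
      · have h : v ≠ w := fun h => by subst h; exact hv.asymm hw
        simp [h]

/-- Right multiplication by a generator is self-adjoint. -/
theorem pairing_mul_gen (i : Fin (n - 1)) (x y : Hecke A Q n) :
    pairing (x * gen A Q i) y = pairing x (y * gen A Q i) := by
  induction x using T_induction with
  | h0 => simp [pairing_zero_left]
  | hadd x x' hx hx' => rw [add_mul, pairing_add_left, pairing_add_left, hx, hx']
  | hsmul a x hx => rw [smul_mul_assoc, pairing_smul_left, pairing_smul_left, hx]
  | hT v =>
    induction y using T_induction with
    | h0 => simp [pairing_zero_right]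
    | hadd x x' hx hx' => rw [add_mul, pairing_add_right, pairing_add_right, hx, hx']
    | hsmul a x hx => rw [smul_mul_assoc, pairing_smul_right, pairing_smul_right, hx]
    | hT w =>
      have e : v * s i = w ↔ v = w * s i :=
        ⟨fun h => by rw [← h, mul_s_mul_s], fun h => by rw [h, mul_s_mul_s]⟩
      rcases lt_or_gt' i v with hv | hv <;> rcases lt_or_gt' i w with hw | hw <;>
        simp only [T_mul_gen_of_lt, T_mul_gen_of_gt, hv, hw, pairing_add_left, pairing_add_right,
          pairing_smul_left, pairing_smul_right, pairing_T, e]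
      · have h : v ≠ w := fun h => by subst h; exact hv.asymm hw
        simp [h]
      · have h : v ≠ w := fun h => by subst h; exact hv.asymm hw
        simp [h]

theorem pairing_prod_mul (l : List (Fin (n - 1))) (x y : Hecke A Q n) :
    pairing ((l.map (gen A Q)).prod * x) y = pairing x ((l.reverse.map (gen A Q)).prod * y) := by
  induction l generalizing y with
  | nil => simp
  | cons i l ih =>
    rw [List.map_cons, List.prod_cons, mul_assoc, pairing_gen_mul, ih, List.reverse_cons,
      List.map_append, List.prod_append, List.map_singleton, List.prod_singleton, mul_assoc]

theorem pairing_mul_prod (l : List (Fin (n - 1))) (x y : Hecke A Q n) :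
    pairing (x * (l.map (gen A Q)).prod) y = pairing x (y * (l.reverse.map (gen A Q)).prod) := by
  induction l generalizing x with
  | nil => simp
  | cons i l ih =>
    rw [List.map_cons, List.prod_cons, ← mul_assoc, ih, pairing_mul_gen, List.reverse_cons,
      List.map_append, List.prod_append, List.map_singleton, List.prod_singleton, mul_assoc]

theorem pairing_T_mul (w : Perm (Fin n)) (x y : Hecke A Q n) :
    pairing (T A Q w * x) y = pairing x (T A Q w⁻¹ * y) := by
  obtain ⟨l, hl⟩ := exists_isReducedWord w
  rw [T_eq_of_isReducedWord hl, T_eq_of_isReducedWord hl.reverse, pairing_prod_mul]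

theorem pairing_mul_T (w : Perm (Fin n)) (x y : Hecke A Q n) :
    pairing (x * T A Q w) y = pairing x (y * T A Q w⁻¹) := by
  obtain ⟨l, hl⟩ := exists_isReducedWord w
  rw [T_eq_of_isReducedWord hl, T_eq_of_isReducedWord hl.reverse, pairing_mul_prod]

/-! ### Young subgroups and their minimal and maximal coset representatives -/

/-- A generator index is internal to `J` when the two points exchanged by the corresponding simple
transposition lie in the same block, that is, when this transposition lies in `𝔖_J`. -/
def Internal (J : Composition n) (i : Fin (n - 1)) : Prop := J.index (lo i) = J.index (hi i)

instance (J : Composition n) : DecidablePred (Internal J) := fun _ =>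
  inferInstanceAs (Decidable (_ = _))

theorem index_mono (J : Composition n) : Monotone J.index := by
  intro a b h
  by_contra! hlt
  have h1 := J.lt_sizeUpTo_index_succ b
  have h2 := J.sizeUpTo_index_le a
  have h3 : J.sizeUpTo (J.index b).succ ≤ J.sizeUpTo (J.index a) :=
    J.monotone_sizeUpTo (Nat.succ_le_of_lt hlt)
  have : (a : ℕ) ≤ b := h
  omega

theorem s_mem_youngSubgroup {J : Composition n} {i : Fin (n - 1)} (h : Internal J i) :
    s i ∈ youngSubgroup J := by
  intro p
  rw [s, swap_apply_def]
  split_ifs with h1 h2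
  · rw [h1, h]
  · rw [h2, h]
  · rfl

theorem internal_of_index_eq {J : Composition n} {a b : Fin n} {i : Fin (n - 1)}
    (hab : J.index a = J.index b) (h1 : a ≤ lo i) (h2 : hi i ≤ b) : Internal J i := by
  refine le_antisymm (index_mono J (lo_lt_hi i).le) ?_
  exact (index_mono J h2).trans (hab ▸ index_mono J h1)

/-- Induction on an element of a Young subgroup, along a reduced word. -/
theorem youngSubgroup_induction {J : Composition n} {p : Perm (Fin n) → Prop} (h1 : p 1)
    (hmul : ∀ v i, v ∈ youngSubgroup J → Internal J i → v (lo i) < v (hi i) → p v → p (v * s i))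
    {v : Perm (Fin n)} (hv : v ∈ youngSubgroup J) : p v := by
  induction hk : len v generalizing v with
  | zero =>
    have : v⁻¹ = 1 := eq_one_of_forall_lt fun i => by
      rw [inv_inv]
      refine (lt_or_gt' i v).resolve_right fun h => ?_
      have := len_mul_s_of_gt h
      omega
    rwa [inv_eq_one.1 this]
  | succ k ih =>
    have : ∃ i : Fin (n - 1), v (hi i) < v (lo i) := by
      by_contra hne
      have : v⁻¹ = 1 := eq_one_of_forall_lt fun i => by
        rw [inv_inv]
        exact (lt_or_gt' i v).resolve_right fun h => hne ⟨i, h⟩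
      rw [inv_eq_one.1 this, len_one] at hk
      omega
    obtain ⟨i, hi'⟩ := this
    have hi : Internal J i := by
      refine le_antisymm (index_mono J (lo_lt_hi i).le) ?_
      rw [← hv (hi i), ← hv (lo i)]
      exact index_mono J hi'.le
    have hl := len_mul_s_of_gt hi'
    have hm := (youngSubgroup J).mul_mem hv (s_mem_youngSubgroup hi)
    have := hmul (v * s i) i hm hi (by rwa [mul_s_lo, mul_s_hi]) (ih hm (by omega))
    rwa [mul_s_mul_s] at this

/-- A function on `Fin n` that increases at each step inside the blocks of `J` increases on each
block. -/
theorem lt_of_forall_internal {α : Type*} [Preorder α] {J : Composition n} {f : Fin n → α}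
    (h : ∀ i, Internal J i → f (lo i) < f (hi i)) {a b : Fin n} (hab : J.index a = J.index b)
    (hlt : a < b) : f a < f b := by
  obtain ⟨b, hb⟩ := b
  obtain ⟨a, ha⟩ := a
  induction b with
  | zero => exact absurd hlt (Nat.not_lt_zero _)
  | succ b ih =>
    have hab' : a ≤ b := Nat.lt_succ_iff.1 hlt
    set i : Fin (n - 1) := ⟨b, by omega⟩
    have hi : Internal J i := internal_of_index_eq hab hab' le_rfl
    have h1 := h i hi
    rcases hab'.eq_or_lt with rfl | h2
    · exact h1
    · exact (ih (by omega) (hab.trans hi.symm) h2).trans h1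

/-- Lengths add up in the product of a permutation increasing on the blocks of `J` with an element
of `𝔖_J`. -/
theorem len_mul_of_increasing {J : Composition n} {w : Perm (Fin n)}
    (hw : ∀ i, Internal J i → w (lo i) < w (hi i)) {v : Perm (Fin n)} (hv : v ∈ youngSubgroup J) :
    len (w * v) = len w + len v ∧ T A Q w * T A Q v = T A Q (w * v) := by
  refine youngSubgroup_induction (p := fun v => len (w * v) = len w + len v ∧
    T A Q w * T A Q v = T A Q (w * v)) ?_ (fun v i hv hi hlt ih => ?_) hv
  · simp [len_one, T_one]
  · have h : (w * v) (lo i) < (w * v) (IwahoriHecke.hi i) :=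
      lt_of_forall_internal (f := w) hw (by rw [hv, hv, hi]) hlt
    rw [← mul_assoc, len_mul_s_of_lt h, len_mul_s_of_lt hlt, ih.1, ← T_mul_gen_of_lt h,
      ← T_mul_gen_of_lt hlt, ← mul_assoc, ih.2]
    exact ⟨add_assoc _ _ _, rfl⟩

/-- Lengths subtract in the product of a permutation decreasing on the blocks of `J` with an
element of `𝔖_J`. -/
theorem len_mul_of_decreasing {J : Composition n} {w : Perm (Fin n)}
    (hw : ∀ i, Internal J i → w (hi i) < w (lo i)) {v : Perm (Fin n)} (hv : v ∈ youngSubgroup J) :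
    len (w * v) + len v = len w := by
  refine youngSubgroup_induction (p := fun v => len (w * v) + len v = len w) ?_
    (fun v i hv hi hlt ih => ?_) hv
  · simp [len_one]
  · have h : (w * v) (IwahoriHecke.hi i) < (w * v) (lo i) :=
      lt_of_forall_internal (α := (Fin n)ᵒᵈ) (f := w) hw (by rw [hv, hv, hi]) hlt
    have := len_mul_s_of_gt h
    rw [← mul_assoc, len_mul_s_of_lt hlt]
    omega

/-- The minimal representatives of `𝔖_n / 𝔖_J` are the permutations increasing on the blocks
of `J`. -/
theorem mem_minCosetReps {J : Composition n} {w : Perm (Fin n)} :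
    w ∈ minCosetReps J ↔ ∀ i, Internal J i → w (lo i) < w (hi i) := by
  simp only [minCosetReps, Finset.mem_filter, Finset.mem_univ, true_and]
  refine ⟨fun h i hi => (lt_or_gt' i w).resolve_right fun hlt => ?_, fun h σ hσ => ?_⟩
  · have h1 := h _ (s_mem_youngSubgroup hi)
    have h2 := len_mul_s_of_gt hlt
    omega
  · -- the choice of coefficients is irrelevant for the statement on lengths
    rw [(len_mul_of_increasing (A := ℤ) (Q := 0) h hσ).1]
    omega

/-- The maximal representatives of `𝔖_K \ 𝔖_n` are the permutations whose inverse is decreasing on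
the blocks of `K`. -/
theorem mem_maxCosetReps {K : Composition n} {w : Perm (Fin n)} :
    w ∈ maxCosetReps K ↔ ∀ i, Internal K i → w⁻¹ (hi i) < w⁻¹ (lo i) := by
  simp only [maxCosetReps, Finset.mem_filter, Finset.mem_univ, true_and]
  refine ⟨fun h i hi => (lt_or_gt i w).resolve_left fun hlt => ?_, fun h σ hσ => ?_⟩
  · have h1 := h _ (s_mem_youngSubgroup hi)
    have h2 := len_s_mul_of_lt hlt
    omega
  · have h1 := len_mul_of_decreasing h ((youngSubgroup K).inv_mem hσ)
    rw [← mul_inv_rev, len_inv, len_inv, len_inv] at h1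
    omega

theorem T_mul_T_of_mem {J : Composition n} {w v : Perm (Fin n)} (hw : w ∈ minCosetReps J)
    (hv : v ∈ youngSubgroup J) : T A Q w * T A Q v = T A Q (w * v) :=
  (len_mul_of_increasing (mem_minCosetReps.1 hw) hv).2

variable (A Q) in
/-- The Hecke algebra of the Young subgroup `𝔖_J`, as a subalgebra of `ℋ_n`. -/
noncomputable def parabolic (J : Composition n) : Subalgebra A (Hecke A Q n) :=
  Algebra.adjoin A (gen A Q '' {i | Internal J i})

theorem gen_mem_parabolic {J : Composition n} {i : Fin (n - 1)} (h : Internal J i) :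
    gen A Q i ∈ parabolic A Q J := Algebra.subset_adjoin ⟨i, h, rfl⟩

/-- A submodule containing `1` and stable under left multiplication by some generators contains the
subalgebra they generate. -/
theorem adjoin_gen_le {I : Set (Fin (n - 1))} (V : Submodule A (Hecke A Q n)) (h1 : 1 ∈ V)
    (hmul : ∀ i ∈ I, ∀ x ∈ V, gen A Q i * x ∈ V) {x : Hecke A Q n}
    (hx : x ∈ Algebra.adjoin A (gen A Q '' I)) : x ∈ V := by
  suffices H : ∀ y ∈ V, x * y ∈ V by simpa using H 1 h1
  induction hx using Algebra.adjoin_induction with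
  | mem x hx =>
    obtain ⟨i, hi, rfl⟩ := hx
    exact hmul i hi
  | algebraMap r =>
    intro y hy
    rw [← Algebra.smul_def]
    exact V.smul_mem r hy
  | add x x' _ _ h h' =>
    intro y hy
    rw [add_mul]
    exact V.add_mem (h y hy) (h' y hy)
  | mul x x' _ _ h h' =>
    intro y hy
    rw [mul_assoc]
    exact h _ (h' y hy)

theorem gen_mul_T_mem (V : Submodule A (Hecke A Q n)) {i : Fin (n - 1)} {w : Perm (Fin n)}
    (h1 : T A Q w ∈ V) (h2 : T A Q (s i * w) ∈ V) : gen A Q i * T A Q w ∈ V := by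
  rcases lt_or_gt i w with h | h
  · rwa [gen_mul_T_of_lt h]
  · rw [gen_mul_T_of_gt h]
    exact V.add_mem h2 (V.smul_mem _ h1)

theorem T_mul_gen_mem (V : Submodule A (Hecke A Q n)) {i : Fin (n - 1)} {w : Perm (Fin n)}
    (h1 : T A Q w ∈ V) (h2 : T A Q (w * s i) ∈ V) : T A Q w * gen A Q i ∈ V := by
  rcases lt_or_gt' i w with h | h
  · rwa [T_mul_gen_of_lt h]
  · rw [T_mul_gen_of_gt h]
    exact V.add_mem h2 (V.smul_mem _ h1)

/-- A subalgebra generated by generators lies in the span of the `T_w` for `w` in any subgroup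
containing the corresponding simple transpositions. -/
theorem mem_span_T_of_mem_adjoin {I : Set (Fin (n - 1))} (G : Subgroup (Perm (Fin n)))
    (hI : ∀ i ∈ I, s i ∈ G) {x : Hecke A Q n} (hx : x ∈ Algebra.adjoin A (gen A Q '' I)) :
    x ∈ Submodule.span A (T A Q '' G) := by
  refine adjoin_gen_le _ ?_ ?_ hx
  · exact Submodule.subset_span ⟨1, G.one_mem, T_one⟩
  · intro i hi x hx
    induction hx using Submodule.span_induction with
    | mem x h =>
      obtain ⟨w, hw, rfl⟩ := h
      exact gen_mul_T_mem _ (Submodule.subset_span ⟨w, hw, rfl⟩)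
        (Submodule.subset_span ⟨_, G.mul_mem (hI i hi) hw, rfl⟩)
    | zero => simp
    | add x y _ _ hx hy => rw [mul_add]; exact Submodule.add_mem _ hx hy
    | smul a x _ hx => rw [mul_smul_comm]; exact Submodule.smul_mem _ _ hx

theorem parabolic_le_span {J : Composition n} {x : Hecke A Q n} (hx : x ∈ parabolic A Q J) :
    x ∈ Submodule.span A (T A Q '' (youngSubgroup J : Set (Perm (Fin n)))) :=
  mem_span_T_of_mem_adjoin _ (fun _ h => s_mem_youngSubgroup h) hx

/-- Left multiplication by `T_w`, for a minimal coset representative `w` of `𝔖_n / 𝔖_J`, is an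
isometry on the Hecke algebra of `𝔖_J`. -/
theorem pairing_T_mul_T_mul {J : Composition n} {w : Perm (Fin n)} (hw : w ∈ minCosetReps J)
    {x y : Hecke A Q n} (hx : x ∈ parabolic A Q J) (hy : y ∈ parabolic A Q J) :
    pairing (T A Q w * x) (T A Q w * y) = pairing x y := by
  replace hx := parabolic_le_span hx
  replace hy := parabolic_le_span hy
  induction hx using Submodule.span_induction with
  | zero => simp [pairing_zero_left]
  | add x x' _ _ hx hx' => rw [mul_add, pairing_add_left, pairing_add_left, hx, hx']
  | smul a x _ hx => rw [mul_smul_comm, pairing_smul_left, pairing_smul_left, hx]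
  | mem x h =>
    obtain ⟨v, hv, rfl⟩ := h
    induction hy using Submodule.span_induction with
    | zero => simp [pairing_zero_right]
    | add x x' _ _ hx hx' => rw [mul_add, pairing_add_right, pairing_add_right, hx, hx']
    | smul a x _ hx => rw [mul_smul_comm, pairing_smul_right, pairing_smul_right, hx]
    | mem y h =>
      obtain ⟨u, hu, rfl⟩ := h
      rw [T_mul_T_of_mem hw hv, T_mul_T_of_mem hw hu, pairing_T, pairing_T]
      simp only [mul_right_inj]

end Hecke

/-! ### Direct products as products over internal generators -/

section Hecke

variable {A : Type*} [CommRing A] {Q : A} {n : ℕ}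

theorem index_eq_iff {J : Composition n} {x : Fin n} {b : Fin J.length} :
    J.index x = b ↔ J.sizeUpTo b ≤ x ∧ (x : ℕ) < J.sizeUpTo (b + 1) := by
  constructor
  · rintro rfl
    exact ⟨J.sizeUpTo_index_le x, J.lt_sizeUpTo_index_succ x⟩
  · rintro ⟨h1, h2⟩
    have h3 := J.lt_sizeUpTo_index_succ x
    have h4 := J.sizeUpTo_index_le x
    by_contra hne
    rcases lt_or_gt_of_ne hne with h | h
    · have := J.monotone_sizeUpTo (Nat.succ_le_of_lt (Fin.lt_def.1 h))
      simp only [Nat.succ_eq_add_one, Fin.val_succ] at this h3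
      omega
    · have := J.monotone_sizeUpTo (Nat.succ_le_of_lt (Fin.lt_def.1 h))
      simp only [Nat.succ_eq_add_one, Fin.val_succ] at this h3
      omega

theorem sizeUpTo_add_lt (J : Composition n) (b : Fin J.length) (k : Fin (J.blocksFun b - 1)) :
    J.sizeUpTo b + k < n - 1 := by
  have h1 := J.sizeUpTo_succ' b
  have h2 := J.sizeUpTo_le (b + 1)
  omega

/-- The generator of `ℋ_n` corresponding to the `k`-th generator of the `b`-th factor of `𝔖_J`. -/
def blockGen (J : Composition n) (b : Fin J.length) (k : Fin (J.blocksFun b - 1)) : Fin (n - 1) :=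
  ⟨J.sizeUpTo b + k, sizeUpTo_add_lt J b k⟩

theorem index_lo_blockGen (J : Composition n) (b : Fin J.length) (k : Fin (J.blocksFun b - 1)) :
    J.index (lo (blockGen J b k)) = b := by
  have h1 := J.sizeUpTo_succ' b
  rw [index_eq_iff]
  simp only [lo, blockGen]
  omega

theorem internal_blockGen (J : Composition n) (b : Fin J.length) (k : Fin (J.blocksFun b - 1)) :
    Internal J (blockGen J b k) := by
  rw [Internal, index_lo_blockGen, eq_comm, index_eq_iff]
  have h1 := J.sizeUpTo_succ' b
  simp only [hi, blockGen]
  omega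

/-- The first generator of the block of `J` containing `i`. -/
def start (J : Composition n) (i : Fin (n - 1)) : ℕ := J.sizeUpTo (J.index (lo i))

theorem start_le (J : Composition n) (i : Fin (n - 1)) : start J i ≤ i :=
  J.sizeUpTo_index_le (lo i)

theorem start_blockGen (J : Composition n) (b : Fin J.length) (k : Fin (J.blocksFun b - 1)) :
    start J (blockGen J b k) = J.sizeUpTo b := by
  rw [start, index_lo_blockGen]

theorem Internal.exists_blockGen {J : Composition n} {i : Fin (n - 1)} (h : Internal J i) :
    ∃ b k, blockGen J b k = i := by
  have h1 := index_eq_iff.1 (Eq.symm h)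
  have h2 := start_le J i
  have h3 := J.sizeUpTo_succ' (J.index (lo i))
  simp only [start, hi] at h1 h2
  refine ⟨J.index (lo i), ⟨i - start J i, ?_⟩, ?_⟩
  · simp only [start]
    omega
  · ext
    simp only [blockGen, start]
    omega

/-- The indices of the generators internal to `J`, in increasing order. -/
def internalList (J : Composition n) : List (Fin (n - 1)) :=
  (List.ofFn fun b => List.ofFn (blockGen J b)).flatten

/-- The indices of the generators internal to `K`, in the order in which they appear in `ζ_K`. -/
def zetaList (K : Composition n) : List (Fin (n - 1)) :=
  (List.ofFn fun b => (List.ofFn (blockGen K b)).reverse).flatten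

theorem mem_internalList {J : Composition n} {i : Fin (n - 1)} :
    i ∈ internalList J ↔ Internal J i := by
  simp only [internalList, List.mem_flatten, List.mem_ofFn]
  constructor
  · rintro ⟨_, ⟨b, rfl⟩, hi⟩
    obtain ⟨k, rfl⟩ := List.mem_ofFn.1 hi
    exact internal_blockGen J b k
  · intro h
    obtain ⟨b, k, rfl⟩ := h.exists_blockGen
    exact ⟨_, ⟨b, rfl⟩, List.mem_ofFn.2 ⟨k, rfl⟩⟩

theorem mem_zetaList {K : Composition n} {i : Fin (n - 1)} :
    i ∈ zetaList K ↔ Internal K i := by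
  rw [← mem_internalList]
  simp [zetaList, internalList, List.mem_flatten, List.mem_ofFn]

theorem blockGen_lt_blockGen {J : Composition n} {b c : Fin J.length} (h : b < c)
    (k : Fin (J.blocksFun b - 1)) (l : Fin (J.blocksFun c - 1)) :
    (blockGen J b k : ℕ) + 1 < blockGen J c l := by
  have h1 := J.sizeUpTo_succ' b
  have h2 := J.monotone_sizeUpTo (Nat.succ_le_of_lt (Fin.lt_def.1 h))
  simp only [blockGen, Nat.succ_eq_add_one] at h2 ⊢
  omega

theorem internalList_pairwise (J : Composition n) : (internalList J).Pairwise (· < ·) := by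
  rw [internalList, List.pairwise_flatten]
  constructor
  · simp only [List.mem_ofFn, forall_exists_index, forall_apply_eq_imp_iff]
    intro b
    rw [List.pairwise_ofFn]
    intro k l h
    exact Nat.add_lt_add_left h _
  · rw [List.pairwise_ofFn]
    intro b c h x hx y hy
    obtain ⟨k, rfl⟩ := List.mem_ofFn.1 hx
    obtain ⟨l, rfl⟩ := List.mem_ofFn.1 hy
    have := blockGen_lt_blockGen h k l
    rw [Fin.lt_def]
    omega

/-- In `ζ_K`, read from right to left, once the generator `i` has been met, neither `i` nor `i - 1`
is met any more. -/
theorem zetaList_pairwise (K : Composition n) :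
    (zetaList K).Pairwise fun i j : Fin (n - 1) => i ≠ j ∧ (i : ℕ) + 1 ≠ j := by
  rw [zetaList, List.pairwise_flatten]
  constructor
  · simp only [List.mem_ofFn, forall_exists_index, forall_apply_eq_imp_iff]
    intro b
    rw [List.pairwise_reverse, List.pairwise_ofFn]
    intro k l h
    rw [Fin.lt_def] at h
    simp only [blockGen, ne_eq, Fin.mk.injEq]
    omega
  · rw [List.pairwise_ofFn]
    intro b c h x hx y hy
    obtain ⟨k, rfl⟩ := List.mem_ofFn.1 (List.mem_reverse.1 hx)
    obtain ⟨l, rfl⟩ := List.mem_ofFn.1 (List.mem_reverse.1 hy)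
    have := blockGen_lt_blockGen h k l
    rw [ne_eq, Fin.ext_iff]
    omega

theorem length_zetaList (K : Composition n) : (zetaList K).length + K.length = n := by
  have h : (zetaList K).length = ∑ b, (K.blocksFun b - 1) := by
    simp [zetaList, List.length_flatten, List.map_ofFn, List.sum_ofFn, Function.comp_def]
  have h2 : ∑ b, (K.blocksFun b - 1) + ∑ _b : Fin K.length, 1 = n := by
    rw [← Finset.sum_add_distrib]
    refine Eq.trans (Finset.sum_congr rfl fun b _ => ?_) K.sum_blocksFun
    have := K.one_le_blocksFun b
    omega
  simpa [h] using h2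

theorem blockHom_gen (J : Composition n) (b : Fin J.length) (k : Fin (J.blocksFun b - 1)) :
    blockHom J b (gen A Q k) = gen A Q (blockGen J b k) :=
  lift_gen _ _ _ _ k

/-- A direct product of products of factors indexed by the generators is a product over
`internalList J`. -/
theorem directProd_prod_ofFn (J : Composition n)
    (f : ∀ b : Fin J.length, Fin (J.blocksFun b - 1) → Hecke A Q (J.blocksFun b))
    (g : Fin (n - 1) → Hecke A Q n) (h : ∀ b k, blockHom J b (f b k) = g (blockGen J b k)) :
    directProd J (fun b => (List.ofFn (f b)).prod) = ((internalList J).map g).prod := by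
  simp only [directProd, internalList, List.map_flatten, List.prod_flatten, List.map_ofFn,
    map_list_prod]
  congr 2
  funext b
  simp only [Function.comp_apply, List.map_ofFn]
  congr 2
  funext k
  exact h b k

theorem zeta_eq (K : Composition n) : zeta A Q K = ((zetaList K).map (gen A Q)).prod := by
  simp only [zeta, directProd, zetaOne, zetaList, List.map_flatten, List.prod_flatten,
    List.map_ofFn, map_list_prod]
  congr 2
  funext b
  simp only [Function.comp_apply, List.map_reverse, List.map_ofFn]
  congr 1
  refine List.ext_getElem (by simp) fun k h1 h2 => ?_
  simp only [List.getElem_ofFn, List.getElem_reverse, Function.comp_apply, blockHom_gen,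
    List.length_ofFn]
  congr 2
  ext
  simp [Fin.val_rev]
  omega

/-- The word `o + k, …, o + 1, o`. -/
def downWord (o k : ℕ) (h : o + k < n - 1) : List (Fin (n - 1)) :=
  List.ofFn fun i : Fin (k + 1) => ⟨o + (k - i), by omega⟩

theorem downWord_zero (o : ℕ) (h : o + 0 < n - 1) : downWord o 0 h = [⟨o, h⟩] := by
  simp [downWord]

theorem downWord_succ (o k : ℕ) (h : o + (k + 1) < n - 1) :
    downWord o (k + 1) h = ⟨o + (k + 1), h⟩ :: downWord o k (by omega) := by
  rw [downWord, List.ofFn_succ, downWord]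
  simp

theorem reverse_downWord (o k : ℕ) (h : o + k < n - 1) :
    (downWord o k h).reverse = List.ofFn fun i : Fin (k + 1) => ⟨o + i, by omega⟩ := by
  refine List.ext_getElem (by simp [downWord]) fun i h1 h2 => ?_
  simp only [downWord, List.length_reverse, List.length_ofFn] at h1
  simp only [downWord, List.getElem_reverse, List.getElem_ofFn, List.length_ofFn, Fin.mk.injEq]
  omega

variable (A Q) in
/-- `T_{o+k} ⋯ T_{o+1} T_o`. -/
noncomputable def downFrom (o k : ℕ) (h : o + k < n - 1) : Hecke A Q n :=
  ((downWord o k h).map (gen A Q)).prod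

variable (A Q) in
/-- `T_{o+k} ⋯ T_{o+1} T_o T_o T_{o+1} ⋯ T_{o+k}`. -/
noncomputable def jucysMurphyFrom (o k : ℕ) (h : o + k < n - 1) : Hecke A Q n :=
  downFrom A Q o k h * ((downWord o k h).reverse.map (gen A Q)).prod

theorem start_add_lt (J : Composition n) (i : Fin (n - 1)) :
    start J i + (i - start J i) < n - 1 := by
  have := start_le J i
  omega

variable (A Q) in
/-- The product `T_i ⋯ T_o` where `o` is the first generator of the block of `i`. -/
noncomputable def internalDown (J : Composition n) (i : Fin (n - 1)) : Hecke A Q n :=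
  downFrom A Q (start J i) (i - start J i) (start_add_lt J i)

variable (A Q) in
/-- The product `T_i ⋯ T_o T_o ⋯ T_i` where `o` is the first generator of the block of `i`. -/
noncomputable def internalJM (J : Composition n) (i : Fin (n - 1)) : Hecke A Q n :=
  jucysMurphyFrom A Q (start J i) (i - start J i) (start_add_lt J i)

theorem internalDown_blockGen (J : Composition n) (b : Fin J.length)
    (k : Fin (J.blocksFun b - 1)) :
    internalDown A Q J (blockGen J b k) =
      downFrom A Q (J.sizeUpTo b) k (sizeUpTo_add_lt J b k) := by
  simp only [internalDown, start_blockGen]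
  congr 1
  simp [blockGen]

theorem internalJM_blockGen (J : Composition n) (b : Fin J.length)
    (k : Fin (J.blocksFun b - 1)) :
    internalJM A Q J (blockGen J b k) =
      jucysMurphyFrom A Q (J.sizeUpTo b) k (sizeUpTo_add_lt J b k) := by
  simp only [internalJM, start_blockGen]
  congr 1
  simp [blockGen]

theorem blockHom_down (J : Composition n) (b : Fin J.length) (k : Fin (J.blocksFun b - 1)) :
    blockHom J b (down A Q k) = internalDown A Q J (blockGen J b k) := by
  rw [internalDown_blockGen, down, downFrom, downWord, map_list_prod, List.map_ofFn, List.map_ofFn]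
  congr 2
  funext i
  exact blockHom_gen _ _ _

theorem blockHom_jucysMurphy (J : Composition n) (b : Fin J.length)
    (k : Fin (J.blocksFun b - 1)) :
    blockHom J b (jucysMurphy A Q k) = internalJM A Q J (blockGen J b k) := by
  rw [jucysMurphy, map_mul, blockHom_down, internalDown_blockGen, internalJM_blockGen,
    jucysMurphyFrom, reverse_downWord]
  congr 1
  rw [up, map_list_prod, List.map_ofFn, List.map_ofFn]
  congr 2
  funext i
  exact blockHom_gen _ _ _

theorem E_eq (J : Composition n) (z : Fin J.length → A) :
    E Q J z = ((internalList J).map fun i =>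
      1 + z (J.index (lo i)) • internalDown A Q J i).prod :=
  directProd_prod_ofFn J _ _ fun b k => by
    simp [blockHom_down, index_lo_blockGen]

theorem EXi_eq (J : Composition n) (z : Fin J.length → A) :
    EXi Q J z = ((internalList J).map fun i =>
      1 + z (J.index (lo i)) • internalJM A Q J i).prod :=
  directProd_prod_ofFn J _ _ fun b k => by
    simp [blockHom_jucysMurphy, index_lo_blockGen]

theorem internal_of_mem_downWord {J : Composition n} {i j : Fin (n - 1)} (hi : Internal J i)
    (hj : j ∈ downWord (start J i) (i - start J i) (start_add_lt J i)) : Internal J j := by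
  obtain ⟨b, k, rfl⟩ := hi.exists_blockGen
  obtain ⟨t, rfl⟩ := List.mem_ofFn.1 hj
  have hs := start_blockGen J b k
  have hk : (blockGen J b k : ℕ) = J.sizeUpTo b + k := rfl
  have := internal_blockGen J b
    ⟨(blockGen J b k : ℕ) - start J (blockGen J b k) - t, by omega⟩
  exact (congrArg (Internal J) (Fin.ext (congrArg (· + _) hs))).mpr this

theorem prod_gen_mem {B : Subalgebra A (Hecke A Q n)} {l : List (Fin (n - 1))}
    (h : ∀ i ∈ l, gen A Q i ∈ B) : (l.map (gen A Q)).prod ∈ B :=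
  B.list_prod_mem (by simpa using h)

theorem internalJM_mem_parabolic {J : Composition n} {i : Fin (n - 1)} (hi : Internal J i) :
    internalJM A Q J i ∈ parabolic A Q J :=
  mul_mem (prod_gen_mem fun _ hj => gen_mem_parabolic (internal_of_mem_downWord hi hj))
    (prod_gen_mem fun _ hj =>
    gen_mem_parabolic (internal_of_mem_downWord hi (List.mem_reverse.1 hj)))

theorem EXi_mem_parabolic (J : Composition n) (z : Fin J.length → A) :
    EXi Q J z ∈ parabolic A Q J := by
  rw [EXi_eq]
  refine list_prod_mem fun x hx => ?_
  obtain ⟨i, hi, rfl⟩ := List.mem_map.1 hx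
  exact add_mem (one_mem _) (Subalgebra.smul_mem _
    (internalJM_mem_parabolic (mem_internalList.1 hi)) _)

end Hecke

/-! ### The expansion of `E_J` and its scalar product with `L[K]` -/

section Hecke

variable {A : Type*} [CommRing A] {Q : A} {n : ℕ}

theorem inv_apply_apply (w : Perm (Fin n)) (x : Fin n) : w⁻¹ (w x) = x := w.symm_apply_apply x

theorem apply_inv_apply (w : Perm (Fin n)) (x : Fin n) : w (w⁻¹ x) = x := w.apply_symm_apply x

/-- The cycle `s_{o+k} ⋯ s_{o+1} s_o`. -/
def cycFrom (o k : ℕ) (h : o + k < n - 1) : Perm (Fin n) := ((downWord o k h).map s).prod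

/-- Multiplying `T_u` by `T_{o+k} ⋯ T_o` on the right stays within reduced decompositions when the
value of `u` at the last point concerned exceeds the values at all the previous ones. -/
theorem T_mul_downFrom (o k : ℕ) (h : o + k < n - 1) (u : Perm (Fin n))
    (hu : ∀ x : Fin n, o ≤ x → (x : ℕ) ≤ o + k → u x < u (hi ⟨o + k, h⟩)) :
    T A Q u * downFrom A Q o k h = T A Q (u * cycFrom o k h) := by
  induction k generalizing u with
  | zero =>
    simp only [downFrom, cycFrom, downWord_zero, List.map_singleton, List.prod_singleton]
    exact T_mul_gen_of_lt (hu _ le_rfl le_rfl)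
  | succ k ih =>
    have h1 := hu (lo ⟨o + (k + 1), h⟩) (by simp [lo]) (by simp [lo])
    simp only [downFrom, cycFrom, downWord_succ, List.map_cons, List.prod_cons] at ih ⊢
    rw [← mul_assoc, T_mul_gen_of_lt h1, ih, mul_assoc]
    intro x hx1 hx2
    have e : hi (⟨o + k, by omega⟩ : Fin (n - 1)) = lo ⟨o + (k + 1), h⟩ := rfl
    rw [e, mul_s_lo, Perm.mul_apply, s_apply_of_ne (by simp only; omega) (by simp only; omega)]
    exact hu x hx1 (by omega)

theorem cycFrom_inv_apply (o k : ℕ) (h : o + k < n - 1) (x : Fin n) :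
    (((cycFrom o k h)⁻¹ x : Fin n) : ℕ) =
      if (x : ℕ) = o + k + 1 then o else if o ≤ x ∧ (x : ℕ) ≤ o + k then (x : ℕ) + 1 else x := by
  have hs : ∀ (i : Fin (n - 1)) (x : Fin n), ((s i x : Fin n) : ℕ) =
      if (x : ℕ) = i then (i : ℕ) + 1 else if (x : ℕ) = i + 1 then (i : ℕ) else x := by
    intro i x
    split_ifs with h1 h2
    · rw [show x = lo i from Fin.ext h1, s_apply_lo]; rfl
    · rw [show x = hi i from Fin.ext h2, s_apply_hi]; rfl
    · rw [s_apply_of_ne h1 h2]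
  induction k generalizing x with
  | zero =>
    simp only [cycFrom, downWord_zero, List.map_singleton, List.prod_singleton, s_inv, hs]
    split_ifs <;> omega
  | succ k ih =>
    have e : cycFrom o (k + 1) h = s ⟨o + (k + 1), h⟩ * cycFrom o k (by omega) := by
      simp only [cycFrom, downWord_succ, List.map_cons, List.prod_cons]
    rw [e, mul_inv_rev, Perm.mul_apply, ih, s_inv, hs]
    simp only
    split_ifs <;> omega

/-- The cycle `s_i ⋯ s_o` where `o` is the first generator of the block of `i`. -/
def internalCyc (J : Composition n) (i : Fin (n - 1)) : Perm (Fin n) :=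
  cycFrom (start J i) (i - start J i) (start_add_lt J i)

theorem internalCyc_mem {J : Composition n} {i : Fin (n - 1)} (hi : Internal J i) :
    internalCyc J i ∈ youngSubgroup J := by
  refine Subgroup.list_prod_mem _ fun x hx => ?_
  obtain ⟨j, hj, rfl⟩ := List.mem_map.1 hx
  exact s_mem_youngSubgroup (internal_of_mem_downWord hi hj)

theorem internalCyc_inv_apply (J : Composition n) (i : Fin (n - 1)) (x : Fin n) :
    (((internalCyc J i)⁻¹ x : Fin n) : ℕ) =
      if x = hi i then start J i else if start J i ≤ x ∧ x < hi i then (x : ℕ) + 1 else x := by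
  have h := start_le J i
  rw [internalCyc, cycFrom_inv_apply]
  simp only [Fin.ext_iff, Fin.lt_def, hi]
  split_ifs <;> omega

/-- The product of the cycles `internalCyc J i` for the elements `i` of the list `l` lying in `S`.
When `l` runs over the generators internal to `J`, these are the permutations whose restriction to
each block of `J` is decreasing and then increasing. -/
def valley (J : Composition n) (l : List (Fin (n - 1))) (S : Finset (Fin (n - 1))) :
    Perm (Fin n) :=
  ((l.filter (· ∈ S)).map (internalCyc J)).prod

theorem valley_append_singleton (J : Composition n) (l : List (Fin (n - 1))) (p : Fin (n - 1))
    (S : Finset (Fin (n - 1))) :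
    valley J (l ++ [p]) S = valley J l S * if p ∈ S then internalCyc J p else 1 := by
  rw [valley, List.filter_append, List.map_append, List.prod_append, valley]
  split_ifs with h <;> simp [h]

theorem valley_mem {J : Composition n} {l : List (Fin (n - 1))} (hl : ∀ i ∈ l, Internal J i)
    (S : Finset (Fin (n - 1))) : valley J l S ∈ youngSubgroup J := by
  refine Subgroup.list_prod_mem _ fun x hx => ?_
  obtain ⟨j, hj, rfl⟩ := List.mem_map.1 hx
  exact internalCyc_mem (hl j (List.mem_filter.1 hj).1)

theorem valley_insert {J : Composition n} {l : List (Fin (n - 1))} {p : Fin (n - 1)} (hp : p ∉ l)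
    (S : Finset (Fin (n - 1))) : valley J l (insert p S) = valley J l S := by
  rw [valley, valley]
  congr 2
  refine List.filter_congr fun i hi => ?_
  have : i ≠ p := fun h => hp (h ▸ hi)
  simp [this]

theorem valley_inv_apply_of_gt {J : Composition n} {l : List (Fin (n - 1))}
    (S : Finset (Fin (n - 1))) {x : Fin n} (hx : ∀ i ∈ l, hi i < x) :
    (valley J l S)⁻¹ x = x := by
  induction l using List.reverseRecOn with
  | nil => simp [valley]
  | append_singleton l p ih =>
    rw [valley_append_singleton, mul_inv_rev, Perm.mul_apply,
      ih fun i hi => hx i (List.mem_append_left _ hi)]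
    have h := hx p (by simp)
    split_ifs
    · ext
      rw [internalCyc_inv_apply, if_neg h.ne', if_neg fun h' => h'.2.asymm h]
    · simp

theorem inv_apply_lt_of_fixed {v : Perm (Fin n)} {m y : Fin n} (hv : ∀ x, m ≤ x → v⁻¹ x = x)
    (hy : y < m) : v⁻¹ y < m := by
  by_contra! h
  have h1 := hv _ h
  rw [EmbeddingLike.apply_eq_iff_eq] at h1
  exact absurd hy (not_lt.2 (h1 ▸ h))

/-- The set `S` can be read off from the inverse of `valley J l S`. -/
theorem valley_inv_lt_iff {J : Composition n} {l : List (Fin (n - 1))}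
    (hl : ∀ i ∈ l, Internal J i) (hs : l.Pairwise (· < ·)) (S : Finset (Fin (n - 1)))
    {i : Fin (n - 1)} (hi' : i ∈ l) :
    (valley J l S)⁻¹ (hi i) < (valley J l S)⁻¹ (lo i) ↔ i ∈ S := by
  induction l using List.reverseRecOn with
  | nil => simp at hi'
  | append_singleton l p ih =>
    rw [List.pairwise_append] at hs
    have hlp : ∀ j ∈ l, j < p := fun j hj => hs.2.2 j hj p (by simp)
    have hl' : ∀ j ∈ l, Internal J j := fun j hj => hl j (List.mem_append_left _ hj)
    have hfix : ∀ x, hi p ≤ x → (valley J l S)⁻¹ x = x := fun x hx =>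
      valley_inv_apply_of_gt S fun j hj => lt_of_lt_of_le (by
        have := Fin.lt_def.1 (hlp j hj)
        simp only [hi, Fin.mk_lt_mk]
        omega) hx
    have hmem := (youngSubgroup J).inv_mem (valley_mem hl' S)
    rw [valley_append_singleton, mul_inv_rev, Perm.mul_apply, Perm.mul_apply]
    rcases List.mem_append.1 hi' with hil | hip
    · have hlt : hi i < hi p := by
        have := Fin.lt_def.1 (hlp i hil)
        simp only [hi, Fin.mk_lt_mk]
        omega
      have h1 := inv_apply_lt_of_fixed hfix hlt
      have h2 := inv_apply_lt_of_fixed hfix ((lo_lt_hi i).trans hlt)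
      rw [← ih hl' hs.1 hil]
      split_ifs
      · rw [Fin.lt_def, internalCyc_inv_apply, internalCyc_inv_apply, if_neg h1.ne, if_neg h2.ne]
        simp only [h1, h2, and_true]
        conv_rhs => rw [Fin.lt_def]
        split_ifs <;> omega
      · simp
    · obtain rfl := List.mem_singleton.1 hip
      have h2 := inv_apply_lt_of_fixed hfix (lo_lt_hi i)
      rw [hfix _ le_rfl]
      have h3 : start J i ≤ (valley J l S)⁻¹ (lo i) := by
        rw [start, ← hmem (lo i)]
        exact J.sizeUpTo_index_le _
      split_ifs with hiS
      · simp only [hiS, iff_true]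
        rw [Fin.lt_def, internalCyc_inv_apply, internalCyc_inv_apply, if_pos rfl, if_neg h2.ne,
          if_pos ⟨h3, h2⟩]
        omega
      · simp only [hiS, iff_false, inv_one, Perm.one_apply, not_lt]
        exact h2.le

theorem T_valley_mul_internalDown {J : Composition n} {l : List (Fin (n - 1))} {p : Fin (n - 1)}
    (hlp : ∀ j ∈ l, j < p) (S : Finset (Fin (n - 1))) :
    T A Q (valley J l S) * internalDown A Q J p = T A Q (valley J l S * internalCyc J p) := by
  have hp := start_le J p
  have hfix : ∀ x, hi p ≤ x → (valley J l S)⁻¹ x = x := fun x hx =>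
    valley_inv_apply_of_gt S fun j hj => lt_of_lt_of_le (by
      have := Fin.lt_def.1 (hlp j hj)
      simp only [hi, Fin.mk_lt_mk]
      omega) hx
  refine T_mul_downFrom _ _ _ _ fun x _ hx => ?_
  have e : hi (⟨start J p + (p - start J p), start_add_lt J p⟩ : Fin (n - 1)) = hi p := by
    ext
    simp only [hi]
    omega
  have hxp : x < hi p := by
    simp only [hi, Fin.lt_def]
    omega
  rw [e]
  have h1 : valley J l S (hi p) = hi p := by
    rw [← Perm.eq_inv_iff_eq, hfix _ le_rfl]
  rw [h1]
  by_contra! h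
  have h2 := hfix _ h
  rw [inv_apply_apply] at h2
  exact absurd hxp (not_lt.2 (h2 ▸ h))

/-- Expanding the product `E_J`: all the products of cycles which occur are reduced. -/
theorem prod_one_add_internalDown {J : Composition n} (c : Fin (n - 1) → A)
    {l : List (Fin (n - 1))} (hs : l.Pairwise (· < ·)) :
    (l.map fun i => 1 + c i • internalDown A Q J i).prod =
      ∑ S ∈ l.toFinset.powerset, (∏ i ∈ S, c i) • T A Q (valley J l S) := by
  induction l using List.reverseRecOn with
  | nil => simp [valley, T_one]
  | append_singleton l p ih =>
    rw [List.pairwise_append] at hs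
    have hlp : ∀ j ∈ l, j < p := fun j hj => hs.2.2 j hj p (by simp)
    have hp : p ∉ l := fun h => (hlp p h).false
    have e : (l ++ [p]).toFinset = insert p l.toFinset := by
      ext x
      simp
    rw [List.map_append, List.prod_append, ih hs.1, List.map_singleton, List.prod_singleton, e,
      Finset.sum_powerset_insert (by simpa using hp), mul_add, mul_one]
    refine congrArg₂ (· + ·) ?_ ?_
    · refine Finset.sum_congr rfl fun S hS => ?_
      have hpS : p ∉ S := fun h => hp (List.mem_toFinset.1 (Finset.mem_powerset.1 hS h))
      rw [valley_append_singleton, if_neg hpS, mul_one]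
    · rw [Finset.sum_mul]
      refine Finset.sum_congr rfl fun S hS => ?_
      have hpS : p ∉ S := fun h => hp (List.mem_toFinset.1 (Finset.mem_powerset.1 hS h))
      rw [valley_append_singleton, if_pos (Finset.mem_insert_self _ _), Finset.prod_insert hpS,
        valley_insert hp, smul_mul_assoc, mul_smul_comm, T_valley_mul_internalDown hlp, smul_smul,
        mul_comm]

/-- The block of `J` containing the position of `x` in the word `w` weakly decreases as `x`
increases inside a block of `K`. -/
def BlockDecreasing (J K : Composition n) (w : Perm (Fin n)) : Prop :=
  ∀ i, Internal K i → J.index (w⁻¹ (hi i)) ≤ J.index (w⁻¹ (lo i))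

/-- The values of `w` at the positions `j` and `j + 1` are two consecutive elements of one block
of `K`. -/
def Forced (K : Composition n) (w : Perm (Fin n)) (j : Fin (n - 1)) : Prop :=
  ∃ i, Internal K i ∧ w (lo j) = lo i ∧ w (hi j) = hi i

open scoped Classical in
/-- The contribution of a minimal coset representative `w` of `𝔖_n / 𝔖_J` to both scalar
products. -/
noncomputable def weight (J K : Composition n) (z : Fin J.length → A) (w : Perm (Fin n)) : A :=
  if BlockDecreasing J K w then
    ∏ j ∈ (internalList J).toFinset,
      if Forced K w j then z (J.index (lo j)) else 1 + z (J.index (lo j))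
  else 0

/-- Consecutive values of a minimal coset representative occurring in the same block of `J` occur at
consecutive positions. -/
theorem exists_internal_of_index_eq {J : Composition n} {w : Perm (Fin n)}
    (hw : w ∈ minCosetReps J) {i : Fin (n - 1)}
    (h : J.index (w⁻¹ (lo i)) = J.index (w⁻¹ (hi i))) :
    ∃ j, Internal J j ∧ w (lo j) = lo i ∧ w (hi j) = hi i := by
  rw [mem_minCosetReps] at hw
  have hmono := fun a b => lt_of_forall_internal (f := w) hw (a := a) (b := b)
  have h1 : w⁻¹ (lo i) < w⁻¹ (hi i) := by
    refine (lt_or_gt i w).resolve_right fun hlt => ?_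
    have := hmono _ _ h.symm hlt
    simp only [apply_inv_apply] at this
    exact this.asymm (lo_lt_hi i)
  have h2 : ((w⁻¹ (hi i) : Fin n) : ℕ) = (w⁻¹ (lo i) : Fin n) + 1 := by
    by_contra hne
    have hlt := Fin.lt_def.1 h1
    -- an intermediate position would carry a value strictly between `i` and `i + 1`
    let t : Fin n := ⟨(w⁻¹ (lo i) : Fin n) + 1, by omega⟩
    have ht1 : w⁻¹ (lo i) < t := Fin.lt_def.2 (Nat.lt_succ_self _)
    have ht2 : t < w⁻¹ (hi i) := Fin.lt_def.2 (by simp only [t]; omega)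
    have hidx : J.index (w⁻¹ (lo i)) = J.index t :=
      (index_mono J ht1.le).antisymm (h ▸ index_mono J ht2.le)
    have a1 := hmono _ _ hidx ht1
    have a2 := hmono _ _ (hidx.symm.trans h) ht2
    simp only [apply_inv_apply, lo, hi, Fin.lt_def] at a1 a2
    omega
  have hlt := (w⁻¹ (hi i)).2
  let j : Fin (n - 1) := ⟨(w⁻¹ (lo i) : Fin n), by omega⟩
  have e1 : lo j = w⁻¹ (lo i) := rfl
  have e2 : hi j = w⁻¹ (hi i) := Fin.ext h2.symm
  refine ⟨j, ?_, ?_, ?_⟩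
  · rw [Internal, e1, e2, h]
  · rw [e1, apply_inv_apply]
  · rw [e2, apply_inv_apply]

theorem mul_mem_maxCosetReps_iff {J K : Composition n} {w v : Perm (Fin n)}
    (hw : w ∈ minCosetReps J) (hv : v ∈ youngSubgroup J) :
    w * v ∈ maxCosetReps K ↔ BlockDecreasing J K w ∧
      ∀ j, Internal J j → Forced K w j → v⁻¹ (hi j) < v⁻¹ (lo j) := by
  have hv' := (youngSubgroup J).inv_mem hv
  simp only [mem_maxCosetReps, mul_inv_rev, Perm.mul_apply]
  constructor
  · intro h
    refine ⟨fun i hi' => ?_, fun j _ ⟨i, hi', h1, h2⟩ => ?_⟩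
    · rw [← hv' (w⁻¹ (hi i)), ← hv' (w⁻¹ (lo i))]
      exact index_mono J (h i hi').le
    · have := h i hi'
      rwa [← h1, ← h2, inv_apply_apply, inv_apply_apply] at this
  · rintro ⟨h1, h2⟩ i hi'
    rcases (h1 i hi').eq_or_lt with h | h
    · obtain ⟨j, hj, e1, e2⟩ := exists_internal_of_index_eq hw h.symm
      have := h2 j hj ⟨i, hi', e1, e2⟩
      rwa [← e1, ← e2, inv_apply_apply, inv_apply_apply]
    · by_contra! hle
      have := index_mono J hle
      rw [hv', hv'] at this
      exact this.not_gt h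

open scoped Classical in
theorem pairing_T_L (K : Composition n) (u : Perm (Fin n)) :
    pairing (T A Q u) (L A Q K) = if u ∈ maxCosetReps K then 1 else 0 := by
  rw [L, pairing_sum_right]
  simp [pairing_T]

theorem pairing_T_mul_E_L {J : Composition n} (K : Composition n) (z : Fin J.length → A)
    {w : Perm (Fin n)} (hw : w ∈ minCosetReps J) :
    pairing (T A Q w * E Q J z) (L A Q K) = weight J K z w := by
  classical
  have hint : ∀ i ∈ internalList J, Internal J i := fun i => mem_internalList.1
  have hs := internalList_pairwise J
  rw [E_eq, prod_one_add_internalDown (fun i => z (J.index (lo i))) hs, Finset.mul_sum,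
    pairing_sum_left]
  simp only [mul_smul_comm, pairing_smul_left, T_mul_T_of_mem hw (valley_mem hint _), pairing_T_L,
    mul_mem_maxCosetReps_iff hw (valley_mem hint _)]
  rw [weight]
  split_ifs with hd
  · have key : ∀ j ∈ (internalList J).toFinset,
        (if Forced K w j then z (J.index (lo j)) else 1 + z (J.index (lo j))) =
          z (J.index (lo j)) + if Forced K w j then 0 else 1 := by
      intro j _
      split_ifs <;> ring
    rw [Finset.prod_congr rfl key, Finset.prod_add]
    refine Finset.sum_congr rfl fun S hS => ?_
    congr 1
    simp only [hd, true_and]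
    split_ifs with h
    · refine (Finset.prod_eq_one fun j hj => if_neg fun hf => ?_).symm
      obtain ⟨h1, h2⟩ := Finset.mem_sdiff.1 hj
      have hj' := List.mem_toFinset.1 h1
      exact h2 ((valley_inv_lt_iff hint hs S hj').1 (h j (hint j hj') hf))
    · push Not at h
      obtain ⟨j, hj, hf, hlt⟩ := h
      have hj' := mem_internalList.2 hj
      rw [← not_lt, valley_inv_lt_iff hint hs S hj'] at hlt
      symm
      refine Finset.prod_eq_zero (Finset.mem_sdiff.2 ⟨List.mem_toFinset.2 hj', hlt⟩) ?_
      exact if_pos hf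
  · simp [hd]

end Hecke

/-! ### The diagonal coefficients of `ζ_K` in the induced module -/

section Hecke

variable {A : Type*} [CommRing A] {Q : A} {n : ℕ}

variable (A Q) in
/-- The span of the `T_u` for which the position of `x` in the word `u` lies in the block `b`
of `J`. -/
noncomputable def blockSpan (J : Composition n) (x : Fin n) (b : Fin J.length) :
    Submodule A (Hecke A Q n) :=
  Submodule.span A (T A Q '' {u | J.index (u⁻¹ x) = b})

theorem T_mem_blockSpan {J : Composition n} {x : Fin n} {b : Fin J.length} {u : Perm (Fin n)}
    (h : J.index (u⁻¹ x) = b) : T A Q u ∈ blockSpan A Q J x b :=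
  Submodule.subset_span ⟨u, h, rfl⟩

theorem pairing_eq_zero_of_mem_blockSpan {J : Composition n} {x : Fin n} {b b' : Fin J.length}
    (hb : b ≠ b') {y y' : Hecke A Q n} (hy : y ∈ blockSpan A Q J x b)
    (hy' : y' ∈ blockSpan A Q J x b') : pairing y y' = 0 := by
  induction hy using Submodule.span_induction with
  | zero => exact pairing_zero_left _
  | add _ _ _ _ h h' => rw [pairing_add_left, h, h', add_zero]
  | smul a _ _ h => rw [pairing_smul_left, h, mul_zero]
  | mem y h =>
    obtain ⟨u, hu, rfl⟩ := h
    induction hy' using Submodule.span_induction with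
    | zero => exact pairing_zero_right _
    | add _ _ _ _ h h' => rw [pairing_add_right, h, h', add_zero]
    | smul a _ _ h => rw [pairing_smul_right, h, mul_zero]
    | mem y h =>
      obtain ⟨v, hv, rfl⟩ := h
      rw [pairing_T, if_neg]
      rintro rfl
      exact hb (hu.symm.trans hv)

theorem gen_mul_mem_blockSpan {J : Composition n} {x : Fin n} {b : Fin J.length}
    {i : Fin (n - 1)} (h1 : lo i ≠ x) (h2 : hi i ≠ x) {y : Hecke A Q n}
    (hy : y ∈ blockSpan A Q J x b) : gen A Q i * y ∈ blockSpan A Q J x b := by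
  induction hy using Submodule.span_induction with
  | zero => simp
  | add _ _ _ _ h h' => rw [mul_add]; exact add_mem h h'
  | smul a _ _ h => rw [mul_smul_comm]; exact Submodule.smul_mem _ _ h
  | mem y h =>
    obtain ⟨u, hu, rfl⟩ := h
    refine gen_mul_T_mem _ (T_mem_blockSpan hu) (T_mem_blockSpan ?_)
    rw [s_mul_inv, s_apply_of_ne (fun h => h1 (Fin.ext h.symm)) fun h => h2 (Fin.ext h.symm)]
    exact hu

theorem prod_mul_mem_blockSpan {J : Composition n} {x : Fin n} {b : Fin J.length}
    {l : List (Fin (n - 1))} (hl : ∀ i ∈ l, lo i ≠ x ∧ hi i ≠ x) {y : Hecke A Q n}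
    (hy : y ∈ blockSpan A Q J x b) : (l.map (gen A Q)).prod * y ∈ blockSpan A Q J x b := by
  induction l with
  | nil => simpa using hy
  | cons i l ih =>
    rw [List.map_cons, List.prod_cons, mul_assoc]
    exact gen_mul_mem_blockSpan (hl i (by simp)).1 (hl i (by simp)).2
      (ih fun j hj => hl j (List.mem_cons_of_mem _ hj))

theorem mul_mem_blockSpan {J : Composition n} {x : Fin n} {b : Fin J.length} {g : Hecke A Q n}
    (hg : g ∈ parabolic A Q J) {y : Hecke A Q n} (hy : y ∈ blockSpan A Q J x b) :
    y * g ∈ blockSpan A Q J x b := by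
  induction hg using Algebra.adjoin_induction generalizing y with
  | algebraMap r => rw [← Algebra.commutes, ← Algebra.smul_def]; exact Submodule.smul_mem _ _ hy
  | add _ _ _ _ h h' => rw [mul_add]; exact add_mem (h hy) (h' hy)
  | mul _ _ _ _ h h' => rw [← mul_assoc]; exact h' (h hy)
  | mem g h =>
    obtain ⟨i, hi, rfl⟩ := h
    induction hy using Submodule.span_induction with
    | zero => simp
    | add _ _ _ _ h h' => rw [add_mul]; exact add_mem h h'
    | smul a _ _ h => rw [smul_mul_assoc]; exact Submodule.smul_mem _ _ h
    | mem y h =>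
      obtain ⟨u, hu, rfl⟩ := h
      refine T_mul_gen_mem _ (T_mem_blockSpan hu) (T_mem_blockSpan ?_)
      rw [mul_inv_rev, s_inv, Perm.mul_apply, s_mem_youngSubgroup hi]
      exact hu

/-- If `x` sits in different blocks of `J` in `w` and `w'`, then no product of generators fixing
`x` has a nonzero coefficient between the summands of `ℋ_n` attached to `w` and `w'`. -/
theorem pairing_prod_mul_eq_zero {J : Composition n} {w w' : Perm (Fin n)} {x : Fin n}
    (hx : J.index (w⁻¹ x) ≠ J.index (w'⁻¹ x)) {l : List (Fin (n - 1))}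
    (hl : ∀ i ∈ l, lo i ≠ x ∧ hi i ≠ x) {g h : Hecke A Q n} (hg : g ∈ parabolic A Q J)
    (hh : h ∈ parabolic A Q J) :
    pairing (T A Q w * g) ((l.map (gen A Q)).prod * (T A Q w' * h)) = 0 :=
  pairing_eq_zero_of_mem_blockSpan hx (mul_mem_blockSpan hg (T_mem_blockSpan rfl))
    (prod_mul_mem_blockSpan hl (mul_mem_blockSpan hh (T_mem_blockSpan rfl)))

theorem prod_append_mul (l : List (Fin (n - 1))) (i : Fin (n - 1)) (y : Hecke A Q n) :
    ((l ++ [i]).map (gen A Q)).prod * y = (l.map (gen A Q)).prod * (gen A Q i * y) := by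
  rw [List.map_append, List.prod_append, List.map_singleton, List.prod_singleton, mul_assoc]

/-- A simple transposition which, applied to a minimal coset representative `w`, exchanges two
values of one block of `J`, acts on `T_w` like a generator of the parabolic subalgebra acting on
the right. -/
theorem gen_mul_T_eq_T_mul_gen {J : Composition n} {w : Perm (Fin n)} (hw : w ∈ minCosetReps J)
    {i j : Fin (n - 1)} (hj : Internal J j) (h1 : w (lo j) = lo i) (h2 : w (hi j) = hi i) :
    gen A Q i * T A Q w = T A Q w * gen A Q j := by
  rw [gen_mul_T_of_lt, T_mul_gen_of_lt (mem_minCosetReps.1 hw j hj), s, s, mul_swap_eq_swap_mul, h1,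
    h2]
  rw [← h1, ← h2, inv_apply_apply, inv_apply_apply]
  exact lo_lt_hi j

/-- In the situation of `zetaList_pairwise`, the generators applied after `i` fix the point
`lo i`. -/
theorem touch_ne {l : List (Fin (n - 1))} {i : Fin (n - 1)}
    (h : ∀ a ∈ l, a ≠ i ∧ (a : ℕ) + 1 ≠ i) : ∀ a ∈ l, lo a ≠ lo i ∧ hi a ≠ lo i := by
  intro a ha
  obtain ⟨h1, h2⟩ := h a ha
  rw [ne_eq, Fin.ext_iff] at h1
  simp only [lo, hi, ne_eq, Fin.mk.injEq]
  exact ⟨h1, h2⟩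

/-- A generator lengthening `T_w` leads to another coset, with no way back: the diagonal coefficient
vanishes. -/
theorem pairing_zetaWord_of_lt {J : Composition n} {w : Perm (Fin n)} (hw : w ∈ minCosetReps J)
    {l : List (Fin (n - 1))} (hl : l.Pairwise fun i j : Fin (n - 1) => i ≠ j ∧ (i : ℕ) + 1 ≠ j)
    (hlt : ∃ i ∈ l, J.index (w⁻¹ (lo i)) < J.index (w⁻¹ (hi i))) {g h : Hecke A Q n}
    (hg : g ∈ parabolic A Q J) (hh : h ∈ parabolic A Q J) :
    pairing (T A Q w * g) ((l.map (gen A Q)).prod * (T A Q w * h)) = 0 := by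
  induction l using List.reverseRecOn generalizing h with
  | nil => simp at hlt
  | append_singleton l i ih =>
    rw [List.pairwise_append] at hl
    have hli := touch_ne fun a ha => hl.2.2 a ha i (by simp)
    have hsw : ∀ hne : J.index (w⁻¹ (lo i)) ≠ J.index (w⁻¹ (hi i)),
        pairing (T A Q w * g) ((l.map (gen A Q)).prod * (T A Q (s i * w) * h)) = 0 := fun hne =>
      pairing_prod_mul_eq_zero (by rwa [s_mul_inv_lo]) hli hg hh
    rw [prod_append_mul, ← mul_assoc (gen A Q i)]
    have hl' : ¬ J.index (w⁻¹ (lo i)) < J.index (w⁻¹ (hi i)) →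
        ∃ i ∈ l, J.index (w⁻¹ (lo i)) < J.index (w⁻¹ (hi i)) := by
      intro hn
      obtain ⟨a, ha, hlt⟩ := hlt
      rcases List.mem_append.1 ha with ha | ha
      · exact ⟨a, ha, hlt⟩
      · exact absurd (List.mem_singleton.1 ha ▸ hlt) hn
    rcases lt_trichotomy (J.index (w⁻¹ (lo i))) (J.index (w⁻¹ (hi i))) with hc | hc | hc
    · rw [gen_mul_T_of_lt ((index_mono J).reflect_lt hc), hsw hc.ne]
    · obtain ⟨j, hj, h1, h2⟩ := exists_internal_of_index_eq hw hc
      rw [gen_mul_T_eq_T_mul_gen hw hj h1 h2, mul_assoc]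
      exact ih hl.1 (hl' hc.not_lt) (mul_mem (gen_mem_parabolic hj) hh)
    · rw [gen_mul_T_of_gt ((index_mono J).reflect_lt hc), add_mul, smul_mul_assoc, mul_add,
        mul_smul_comm, pairing_add_right, hsw hc.ne', pairing_smul_right, zero_add,
        ih hl.1 (hl' hc.asymm) hh, mul_zero]

/-- When no generator lengthens `T_w` modulo `𝔖_J`, each generator contributes to the diagonal
coefficient either the scalar `Q` or a generator of the parabolic subalgebra. -/
theorem pairing_zetaWord {J : Composition n} {w : Perm (Fin n)} (hw : w ∈ minCosetReps J)
    {l : List (Fin (n - 1))} (hl : l.Pairwise fun i j : Fin (n - 1) => i ≠ j ∧ (i : ℕ) + 1 ≠ j)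
    (hle : ∀ i ∈ l, J.index (w⁻¹ (hi i)) ≤ J.index (w⁻¹ (lo i))) {g : Hecke A Q n}
    (hg : g ∈ parabolic A Q J) :
    ∃ (F : List (Fin (n - 1))) (k : ℕ), F.Nodup ∧ F.length + k = l.length ∧
      (∀ j, j ∈ F ↔ ∃ i ∈ l, w (lo j) = lo i ∧ w (hi j) = hi i) ∧ (∀ j ∈ F, Internal J j) ∧
      ∀ h ∈ parabolic A Q J, pairing (T A Q w * g) ((l.map (gen A Q)).prod * (T A Q w * h)) =
        Q ^ k * pairing g ((F.map (gen A Q)).prod * h) := by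
  induction l using List.reverseRecOn with
  | nil =>
    refine ⟨[], 0, List.nodup_nil, rfl, by simp, by simp, fun h hh => ?_⟩
    simp [pairing_T_mul_T_mul hw hg hh]
  | append_singleton l i ih =>
    rw [List.pairwise_append] at hl
    have hli := touch_ne fun a ha => hl.2.2 a ha i (by simp)
    obtain ⟨F, k, hF, hlen, hmem, hint, hpair⟩ :=
      ih hl.1 fun a ha => hle a (List.mem_append_left _ ha)
    rcases (hle i (by simp)).eq_or_lt with hc | hc
    · obtain ⟨j, hj, h1, h2⟩ := exists_internal_of_index_eq hw hc.symm
      refine ⟨F ++ [j], k, ?_, ?_, ?_, ?_, fun h hh => ?_⟩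
      · rw [List.nodup_append]
        refine ⟨hF, List.nodup_singleton j, fun a ha b hb => ?_⟩
        obtain rfl := List.mem_singleton.1 hb
        rintro rfl
        obtain ⟨c, hc, e, _⟩ := (hmem a).1 ha
        exact (hli c hc).1 (e.symm.trans h1)
      · simp only [List.length_append, List.length_singleton]
        omega
      · intro a
        simp only [List.mem_append, List.mem_singleton, hmem]
        constructor
        · rintro (⟨c, hc, e⟩ | rfl)
          · exact ⟨c, Or.inl hc, e⟩
          · exact ⟨i, Or.inr rfl, h1, h2⟩
        · rintro ⟨c, hc | rfl, e⟩
          · exact Or.inl ⟨c, hc, e⟩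
          · refine Or.inr (Fin.ext ?_)
            have := w.injective (e.1.trans h1.symm)
            simpa [lo] using this
      · intro a ha
        rcases List.mem_append.1 ha with ha | ha
        · exact hint a ha
        · exact List.mem_singleton.1 ha ▸ hj
      · rw [prod_append_mul, ← mul_assoc (gen A Q i), gen_mul_T_eq_T_mul_gen hw hj h1 h2, mul_assoc,
          hpair _ (mul_mem (gen_mem_parabolic hj) hh), prod_append_mul]
    · refine ⟨F, k + 1, hF, ?_, ?_, hint, fun h hh => ?_⟩
      · simp only [List.length_append, List.length_singleton]
        omega
      · intro a
        rw [hmem]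
        constructor
        · rintro ⟨c, hc, e⟩
          exact ⟨c, List.mem_append_left _ hc, e⟩
        · rintro ⟨c, hc', e1, e2⟩
          rcases List.mem_append.1 hc' with hc' | hc'
          · exact ⟨c, hc', e1, e2⟩
          · obtain rfl := List.mem_singleton.1 hc'
            -- the two positions are adjacent but in different blocks, in the wrong order
            rw [← e1, ← e2, inv_apply_apply, inv_apply_apply] at hc
            exact absurd (index_mono J (lo_lt_hi a).le) hc.not_ge
      · rw [prod_append_mul, ← mul_assoc (gen A Q i), gen_mul_T_of_gt ((index_mono J).reflect_lt hc), add_mul,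
          smul_mul_assoc, mul_add, mul_smul_comm, pairing_add_right, pairing_smul_right,
          pairing_prod_mul_eq_zero (by rw [s_mul_inv_lo]; exact hc.ne') hli hg hh, zero_add,
          hpair h hh, pow_succ', mul_assoc]

/-! ### Jucys–Murphy elements -/

theorem jucysMurphyFrom_zero (o : ℕ) (h : o + 0 < n - 1) :
    jucysMurphyFrom A Q o 0 h = gen A Q ⟨o, h⟩ * gen A Q ⟨o, h⟩ := by
  simp [jucysMurphyFrom, downFrom, downWord_zero]

theorem jucysMurphyFrom_succ (o k : ℕ) (h : o + (k + 1) < n - 1) :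
    jucysMurphyFrom A Q o (k + 1) h = gen A Q ⟨o + (k + 1), h⟩ *
      jucysMurphyFrom A Q o k (by omega) * gen A Q ⟨o + (k + 1), h⟩ := by
  simp [jucysMurphyFrom, downFrom, downWord_succ, mul_assoc]

theorem gen_comm' {i j : Fin (n - 1)} (h : (i : ℕ) + 1 < j ∨ (j : ℕ) + 1 < i) :
    Commute (gen A Q i) (gen A Q j) :=
  h.elim (gen_comm i j) fun h => (gen_comm j i h).symm

theorem commute_jucysMurphyFrom_of_lt {a : Fin (n - 1)} (o k : ℕ) (h : o + k < n - 1)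
    (ha : (a : ℕ) + 1 < o ∨ o + k + 1 < a) : Commute (gen A Q a) (jucysMurphyFrom A Q o k h) := by
  induction k with
  | zero =>
    rw [jucysMurphyFrom_zero]
    have : Commute (gen A Q a) (gen A Q ⟨o, h⟩) := gen_comm' (by simp only; omega)
    exact this.mul_right this
  | succ k ih =>
    rw [jucysMurphyFrom_succ]
    have : Commute (gen A Q a) (gen A Q ⟨o + (k + 1), h⟩) := gen_comm' (by simp only; omega)
    exact (this.mul_right (ih _ (by omega))).mul_right this

/-- A Jucys–Murphy element commutes with the earlier generators of its block. -/
theorem commute_jucysMurphyFrom {a : Fin (n - 1)} (o k : ℕ) (h : o + k < n - 1) (h1 : o ≤ a)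
    (h2 : (a : ℕ) < o + k) : Commute (gen A Q a) (jucysMurphyFrom A Q o k h) := by
  induction k with
  | zero => omega
  | succ k ih =>
    rcases (show (a : ℕ) ≤ o + k by omega).eq_or_lt with e | hlt
    · have hb := gen_braid (A := A) (Q := Q) a ⟨o + (k + 1), h⟩ (by simp only; omega)
      rw [jucysMurphyFrom_succ]
      cases k with
      | zero =>
        rw [jucysMurphyFrom_zero]
        have ea : (⟨o, by omega⟩ : Fin (n - 1)) = a := Fin.ext e.symm
        rw [ea]
        set t := gen A Q a
        set r := gen A Q (⟨o + (0 + 1), h⟩ : Fin (n - 1))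
        calc t * (r * (t * t) * r) = (t * r * t) * (t * r) := by simp only [mul_assoc]
          _ = r * t * (r * t * r) := by rw [hb]; simp only [mul_assoc]
          _ = r * (t * t) * r * t := by rw [← hb]; simp only [mul_assoc]
      | succ k =>
        rw [jucysMurphyFrom_succ]
        have ea : (⟨o + (k + 1), by omega⟩ : Fin (n - 1)) = a := Fin.ext e.symm
        have hx : Commute (gen A Q ⟨o + (k + 1 + 1), h⟩)
            (jucysMurphyFrom A Q o k (by omega)) :=
          commute_jucysMurphyFrom_of_lt o k _ (by simp only; omega)
        rw [ea]
        set t := gen A Q a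
        set r := gen A Q (⟨o + (k + 1 + 1), h⟩ : Fin (n - 1))
        set x := jucysMurphyFrom A Q o k (by omega : o + k < n - 1)
        calc t * (r * (t * x * t) * r) = (t * r * t) * (x * t * r) := by simp only [mul_assoc]
          _ = r * t * (r * x) * (t * r) := by rw [hb]; simp only [mul_assoc]
          _ = r * t * x * (r * t * r) := by rw [hx.eq]; simp only [mul_assoc]
          _ = r * (t * x * t) * r * t := by rw [← hb]; simp only [mul_assoc]
    · rw [jucysMurphyFrom_succ]
      have : Commute (gen A Q a) (gen A Q ⟨o + (k + 1), h⟩) := gen_comm' (by simp only; omega)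
      exact (this.mul_right (ih _ hlt)).mul_right this

theorem commute_internalJM {J : Composition n} {a p : Fin (n - 1)} (ha : Internal J a)
    (hap : a < p) : Commute (gen A Q a) (internalJM A Q J p) := by
  have h1 := start_le J p
  have h2 := Fin.lt_def.1 hap
  by_cases h : start J p ≤ a
  · exact commute_jucysMurphyFrom _ _ _ h (by omega)
  · refine commute_jucysMurphyFrom_of_lt _ _ _ (Or.inl ?_)
    by_contra hne
    -- otherwise `hi a` would be the first point of the block of `p`
    have e : (hi a : Fin n) ≤ lo p := by
      simp only [hi, lo, Fin.mk_le_mk]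
      omega
    have h3 : J.index (hi a) = J.index (lo p) := by
      refine (index_mono J e).antisymm ?_
      by_contra! hlt
      have h4 := J.monotone_sizeUpTo (Nat.succ_le_of_lt (Fin.lt_def.1 hlt))
      have h5 := J.lt_sizeUpTo_index_succ (hi a)
      simp only [Nat.succ_eq_add_one, Fin.val_succ, hi, start] at h4 h5 h hne
      omega
    have h4 := J.sizeUpTo_index_le (lo a)
    rw [ha, h3] at h4
    exact h h4

theorem gen_mul_T_swap_mul_gen {p : Fin (n - 1)} {x : Fin n} (hx : x < lo p) :
    gen A Q p * T A Q (swap x (lo p)) * gen A Q p = T A Q (swap x (hi p)) := by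
  have hxh := hx.trans (lo_lt_hi p)
  have e1 : swap x (lo p) (hi p) = hi p := swap_apply_of_ne_of_ne hxh.ne' (lo_lt_hi p).ne'
  have e2 : s p x = x := swap_apply_of_ne_of_ne hx.ne hxh.ne
  have e3 : s p * swap x (lo p) = swap x (hi p) * s p := by
    rw [mul_swap_eq_swap_mul, e2, s_apply_lo]
  rw [gen_mul_T_of_lt, T_mul_gen_of_lt]
  · rw [e3, mul_s_mul_s]
  · rw [Perm.mul_apply, Perm.mul_apply, swap_apply_right, e2, e1, s_apply_hi]
    exact hx
  · rw [swap_inv, swap_apply_right, e1]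
    exact hxh

/-- A Jucys–Murphy element is `1` plus `Q` times the sum of the `T_w` for the transpositions `w`
exchanging its last point with an earlier one. -/
theorem jucysMurphyFrom_eq (o k : ℕ) (h : o + k < n - 1) :
    jucysMurphyFrom A Q o k h =
      1 + Q • ∑ t : Fin (k + 1), T A Q (swap ⟨o + t, by omega⟩ (hi ⟨o + k, h⟩)) := by
  induction k with
  | zero =>
    rw [jucysMurphyFrom_zero, gen_quad, add_comm]
    congr 2
    rw [Fin.sum_univ_one, ← T_s]
    rfl
  | succ k ih =>
    have e : hi (⟨o + k, by omega⟩ : Fin (n - 1)) = lo ⟨o + (k + 1), h⟩ := rfl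
    rw [jucysMurphyFrom_succ, ih, mul_add, add_mul, mul_one, gen_quad, mul_smul_comm,
      smul_mul_assoc, Finset.mul_sum, Finset.sum_mul, add_comm (Q • _) 1, add_assoc,
      add_comm (Q • gen A Q _)]
    conv_rhs => rw [Fin.sum_univ_castSucc, smul_add]
    refine congrArg₂ _ rfl (congrArg₂ _ (congrArg _ (Finset.sum_congr rfl fun t _ => ?_)) ?_)
    · rw [e, gen_mul_T_swap_mul_gen]
      · rfl
      · simp only [lo, Fin.lt_def]
        omega
    · rw [← T_s]
      rfl

variable (A Q) in
/-- The subalgebra generated by the generators preceding `p`. -/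
noncomputable def below (p : Fin (n - 1)) : Subalgebra A (Hecke A Q n) :=
  Algebra.adjoin A (gen A Q '' {i | i < p})

theorem gen_mem_below {i p : Fin (n - 1)} (h : i < p) : gen A Q i ∈ below A Q p :=
  Algebra.subset_adjoin ⟨i, h, rfl⟩

theorem below_le_span {p : Fin (n - 1)} {x : Hecke A Q n} (hx : x ∈ below A Q p) :
    x ∈ Submodule.span A (T A Q '' {u | ∀ x, hi p ≤ x → u x = x}) := by
  have := mem_span_T_of_mem_adjoin (fixingSubgroup (Perm (Fin n)) (Set.Ici (hi p))) (fun i h => by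
    rw [mem_fixingSubgroup_iff]
    intro y hy
    have h1 : (i : ℕ) < p := h
    have h2 : (p : ℕ) + 1 ≤ y := hy
    exact s_apply_of_ne (by omega) (by omega)) hx
  refine Submodule.span_mono (Set.image_mono fun u hu => ?_) this
  exact fun x hx => (mem_fixingSubgroup_iff _).1 hu x hx

theorem pairing_below_gen {p : Fin (n - 1)} {x : Hecke A Q n} (hx : x ∈ below A Q p) :
    pairing x (gen A Q p) = 0 := by
  replace hx := below_le_span hx
  induction hx using Submodule.span_induction with
  | zero => exact pairing_zero_left _
  | add _ _ _ _ h h' => rw [pairing_add_left, h, h', add_zero]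
  | smul a _ _ h => rw [pairing_smul_left, h, mul_zero]
  | mem y h =>
    obtain ⟨u, hu, rfl⟩ := h
    rw [← T_s, pairing_T, if_neg]
    rintro rfl
    exact (lo_lt_hi p).ne (by rw [← s_apply_hi, hu _ le_rfl])

theorem internalJM_eq (J : Composition n) (p : Fin (n - 1)) :
    internalJM A Q J p = 1 + Q • ∑ t : Fin (p - start J p + 1),
      T A Q (swap ⟨start J p + t, by have := start_le J p; omega⟩ (hi p)) := by
  have e : hi (⟨start J p + (p - start J p), start_add_lt J p⟩ : Fin (n - 1)) = hi p := by
    have := start_le J p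
    ext
    simp only [hi]
    omega
  rw [internalJM, jucysMurphyFrom_eq]
  simp only [e]

theorem swap_ne_of_fixed {u : Perm (Fin n)} {x y : Fin n} (hxy : x ≠ y) (hu : u y = y) :
    swap x y ≠ u := by
  rintro rfl
  rw [swap_apply_right] at hu
  exact hxy hu

theorem pairing_below_mul_internalJM (J : Composition n) {p : Fin (n - 1)} {x : Hecke A Q n}
    (hx : x ∈ below A Q p) : pairing (x * internalJM A Q J p) 1 = pairing x 1 := by
  have hp := start_le J p
  replace hx := below_le_span hx
  induction hx using Submodule.span_induction with
  | zero => rw [zero_mul]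
  | add _ _ _ _ h h' => rw [add_mul, pairing_add_left, pairing_add_left, h, h']
  | smul a _ _ h => rw [smul_mul_assoc, pairing_smul_left, pairing_smul_left, h]
  | mem y h =>
    obtain ⟨u, hu, rfl⟩ := h
    have hu' : u⁻¹ (hi p) = hi p := by rw [Perm.inv_eq_iff_eq, hu _ le_rfl]
    rw [internalJM_eq, mul_add, mul_one, pairing_add_left, pairing_T_mul, mul_one,
      pairing_smul_left, pairing_sum_left, Finset.sum_eq_zero, mul_zero, add_zero]
    intro t _
    rw [pairing_T, if_neg]
    refine swap_ne_of_fixed (fun h => ?_) hu'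
    simp only [hi, Fin.mk.injEq] at h
    omega

theorem pairing_below_mul_internalJM_gen (J : Composition n) {p : Fin (n - 1)} {x : Hecke A Q n}
    (hx : x ∈ below A Q p) :
    pairing (x * internalJM A Q J p) (gen A Q p) = Q * pairing x 1 := by
  have hp := start_le J p
  replace hx := below_le_span hx
  induction hx using Submodule.span_induction with
  | zero => rw [zero_mul, pairing_zero_left, pairing_zero_left, mul_zero]
  | add _ _ _ _ h h' => rw [add_mul, pairing_add_left, pairing_add_left, h, h', mul_add]
  | smul a _ _ h => rw [smul_mul_assoc, pairing_smul_left, pairing_smul_left, h, mul_left_comm]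
  | mem y h =>
    obtain ⟨u, hu, rfl⟩ := h
    have hu' : ∀ x, hi p ≤ x → u⁻¹ x = x := fun x hx => by rw [Perm.inv_eq_iff_eq, hu _ hx]
    have hlt : u⁻¹ (lo p) < u⁻¹ (hi p) := by
      rw [hu' _ le_rfl]
      exact inv_apply_lt_of_fixed hu' (lo_lt_hi p)
    have h1 : (1 : Perm (Fin n)) ≠ u⁻¹ * s p := fun h => by
      have := congrArg (fun v : Perm (Fin n) => v (lo p)) h
      simp only [mul_s_lo, hu' _ le_rfl, Perm.one_apply] at this
      exact (lo_lt_hi p).ne this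
    have hlast : (⟨start J p + (Fin.last (p - start J p) : ℕ), by
        simp only [Fin.val_last]; omega⟩ : Fin n) = lo p := by
      ext
      simp only [Fin.val_last, lo]
      omega
    rw [internalJM_eq, pairing_T_mul, T_mul_gen_of_lt hlt, pairing_add_left, ← T_one, pairing_T,
      if_neg h1, zero_add, pairing_smul_left, pairing_sum_left,
      Finset.sum_eq_single (Fin.last (p - start J p))]
    · rw [pairing_T, pairing_T, hlast]
      congr 1
      refine if_congr ?_ rfl rfl
      rw [← s, right_eq_mul, inv_eq_one]
    · intro t _ ht
      rw [pairing_T, if_neg]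
      intro h
      have := congrArg (fun v : Perm (Fin n) => v (lo p)) h
      simp only [mul_s_lo, hu' _ le_rfl] at this
      rw [swap_apply_of_ne_of_ne] at this
      · exact (lo_lt_hi p).ne this
      · intro h
        refine ht (Fin.ext ?_)
        have := congrArg Fin.val (h.symm.trans hlast.symm)
        simpa using this
      · exact (lo_lt_hi p).ne
    · exact fun h => absurd (Finset.mem_univ _) h

theorem internalJM_mem_below {J : Composition n} {i p : Fin (n - 1)} (h : i < p) :
    internalJM A Q J i ∈ below A Q p := by
  have h1 := start_le J i
  have h2 := Fin.lt_def.1 h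
  have key : ∀ j ∈ downWord (start J i) (i - start J i) (start_add_lt J i), j < p := by
    intro j hj
    obtain ⟨t, rfl⟩ := List.mem_ofFn.1 hj
    rw [Fin.lt_def]
    simp only
    omega
  exact mul_mem (prod_gen_mem fun j hj => gen_mem_below (key j hj))
    (prod_gen_mem fun j hj => gen_mem_below (key j (List.mem_reverse.1 hj)))

theorem pairing_prod_gen_right (l : List (Fin (n - 1))) (x y : Hecke A Q n) :
    pairing x ((l.map (gen A Q)).prod * y) = pairing ((l.reverse.map (gen A Q)).prod * x) y := by
  rw [pairing_prod_mul, List.reverse_reverse]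

theorem pairing_mul_prod_gen_right (l : List (Fin (n - 1))) (x y : Hecke A Q n) :
    pairing x (y * (l.map (gen A Q)).prod) = pairing (x * (l.reverse.map (gen A Q)).prod) y := by
  rw [pairing_mul_prod, List.reverse_reverse]

/-- The scalar product of a product of factors `1 + c_i ξ_i` with a product of distinct generators,
in any order.  The largest index `p` is peeled off: `ξ_p` commutes with the other generators
involved, and its projections on the subalgebra `H` generated by the preceding generators and on
`H T_p` are `1` and `Q T_p`. -/
theorem pairing_prod_one_add_internalJM {J : Composition n} (c : Fin (n - 1) → A)
    {l : List (Fin (n - 1))} (hl : ∀ i ∈ l, Internal J i) (hs : l.Pairwise (· < ·))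
    {F : List (Fin (n - 1))} (hF : F.Nodup) (hFl : ∀ i ∈ F, i ∈ l) :
    pairing (l.map fun i => 1 + c i • internalJM A Q J i).prod (F.map (gen A Q)).prod =
      ∏ i ∈ l.toFinset, if i ∈ F then c i * Q else 1 + c i := by
  induction l using List.reverseRecOn generalizing F with
  | nil =>
    have : F = [] := List.eq_nil_iff_forall_not_mem.2 fun i hi => by simpa using hFl i hi
    subst this
    simp [← T_one, pairing_T]
  | append_singleton l p ih =>
    rw [List.pairwise_append] at hs
    have hlp : ∀ j ∈ l, j < p := fun j hj => hs.2.2 j hj p (by simp)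
    have hl' : ∀ j ∈ l, Internal J j := fun j hj => hl j (List.mem_append_left _ hj)
    have hp : p ∉ l := fun h => (hlp p h).false
    have e : (l ++ [p]).toFinset = insert p l.toFinset := by
      ext x
      simp
    rw [e, Finset.prod_insert (by simpa using hp), List.map_append, List.prod_append,
      List.map_singleton, List.prod_singleton]
    set E' := (l.map fun i => 1 + c i • internalJM A Q J i).prod with hE'
    have hmemE : E' ∈ below A Q p := by
      refine list_prod_mem fun x hx => ?_
      obtain ⟨i, hi, rfl⟩ := List.mem_map.1 hx
      exact add_mem (one_mem _) (Subalgebra.smul_mem _ (internalJM_mem_below (hlp i hi)) _)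
    have hsub : ∀ {B : List (Fin (n - 1))}, (∀ i ∈ B, i ∈ l) →
        (B.map (gen A Q)).prod ∈ below A Q p := fun hB =>
      prod_gen_mem fun i hi => gen_mem_below (hlp i (hB i hi))
    by_cases hpF : p ∈ F
    · obtain ⟨F₁, F₂, rfl⟩ := List.append_of_mem hpF
      rw [List.nodup_middle, List.nodup_cons] at hF
      have hF₁ : ∀ i ∈ F₁, i ∈ l := fun i hi => by
        have h1 := hFl i (by simp [hi])
        have h2 : i ≠ p := fun h => hF.1 (by simp [← h, hi])
        simpa [h2] using h1
      have hF₂ : ∀ i ∈ F₂, i ∈ l := fun i hi => by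
        have h1 := hFl i (by simp [hi])
        have h2 : i ≠ p := fun h => hF.1 (by simp [← h, hi])
        simpa [h2] using h1
      have hcomm : Commute (1 + c p • internalJM A Q J p)
          (F₂.reverse.map (gen A Q)).prod := by
        refine Commute.list_prod_right _ _ fun x hx => ?_
        obtain ⟨i, hi, rfl⟩ := List.mem_map.1 hx
        have hi := hF₂ i (List.mem_reverse.1 hi)
        exact (Commute.one_left _).add_left
          ((commute_internalJM (hl' i hi) (hlp i hi)).symm.smul_left _)
      rw [List.map_append, List.prod_append, List.map_cons, List.prod_cons,
        pairing_prod_gen_right, pairing_mul_prod_gen_right, ← mul_assoc, mul_assoc, hcomm.eq,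
        ← mul_assoc]
      set G := (F₁.reverse.map (gen A Q)).prod * E' * (F₂.reverse.map (gen A Q)).prod with hG
      have hGmem : G ∈ below A Q p :=
        mul_mem (mul_mem (hsub fun i hi => hF₁ i (List.mem_reverse.1 hi)) hmemE)
          (hsub fun i hi => hF₂ i (List.mem_reverse.1 hi))
      have hG1 : pairing G 1 = pairing E' ((F₁ ++ F₂).map (gen A Q)).prod := by
        rw [hG, ← pairing_mul_prod_gen_right, ← pairing_prod_gen_right, one_mul, List.map_append,
          List.prod_append]
      rw [mul_add, mul_one, mul_smul_comm, pairing_add_left, pairing_below_gen hGmem, zero_add,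
        pairing_smul_left, pairing_below_mul_internalJM_gen J hGmem, hG1,
        ih hl' hs.1 hF.2 (by simpa [or_imp, forall_and] using ⟨hF₁, hF₂⟩), if_pos hpF, ← mul_assoc]
      congr 1
      refine Finset.prod_congr rfl fun i hi => if_congr ?_ rfl rfl
      have : i ≠ p := fun h => hp (by simpa [h] using hi)
      simp [this]
    · have hFl' : ∀ i ∈ F, i ∈ l := fun i hi => by
        have h1 := hFl i hi
        have h2 : i ≠ p := fun h => hpF (h ▸ hi)
        simpa [h2] using h1
      rw [if_neg hpF, ← ih hl' hs.1 hF hFl', ← mul_one (F.map (gen A Q)).prod,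
        pairing_prod_gen_right, pairing_prod_gen_right, ← mul_assoc, mul_add, mul_one,
        mul_smul_comm, pairing_add_left, pairing_smul_left, pairing_below_mul_internalJM]
      · ring
      · exact mul_mem (hsub fun i hi => hFl' i (List.mem_reverse.1 hi)) hmemE

theorem pairing_T_mul_EXi_zeta {J K : Composition n} (z : Fin J.length → A)
    {w : Perm (Fin n)} (hw : w ∈ minCosetReps J) :
    pairing (T A Q w * EXi Q J z) (zeta A Q K * T A Q w) =
      Q ^ (n - K.length) * weight J K z w := by
  classical
  have hG := EXi_mem_parabolic (Q := Q) J z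
  rw [weight, zeta_eq]
  split_ifs with hd
  · obtain ⟨F, k, hF, hlen, hmem, hint, hpair⟩ :=
      pairing_zetaWord hw (zetaList_pairwise K) (fun i hi => hd i (mem_zetaList.1 hi)) hG
    have h1 := hpair 1 (one_mem _)
    rw [mul_one, mul_one] at h1
    have hFl : ∀ i ∈ F, i ∈ internalList J := fun i hi => mem_internalList.2 (hint i hi)
    have hforced : ∀ j, Forced K w j ↔ j ∈ F := fun j => by
      rw [hmem]
      exact exists_congr fun i => and_congr_left' mem_zetaList.symm
    have hQ : ∏ i ∈ (internalList J).toFinset, (if i ∈ F then Q else 1) = Q ^ F.length := by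
      rw [Finset.prod_ite, Finset.prod_const, Finset.prod_const_one, mul_one,
        ← List.toFinset_card_of_nodup hF]
      congr 2
      ext i
      simpa using hFl i
    have hexp : n - K.length = k + F.length := by
      have := length_zetaList K
      omega
    rw [h1, EXi_eq, pairing_prod_one_add_internalJM (fun i => z (J.index (lo i)))
      (fun i => mem_internalList.1) (internalList_pairwise J) hF hFl, hexp, pow_add, mul_assoc,
      ← hQ, ← Finset.prod_mul_distrib]
    congr 1
    refine Finset.prod_congr rfl fun i _ => ?_
    simp only [hforced]
    split_ifs <;> ring
  · rw [mul_zero]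
    simp only [BlockDecreasing, not_forall, not_le] at hd
    obtain ⟨i, hi', hlt⟩ := hd
    have := pairing_zetaWord_of_lt hw (zetaList_pairwise K) ⟨i, mem_zetaList.2 hi', hlt⟩ hG
      (one_mem _)
    rwa [mul_one] at this

theorem pairing_sum_E_L (J K : Composition n) (z : Fin J.length → A) :
    pairing (∑ w ∈ minCosetReps J, T A Q w * E Q J z) (L A Q K) =
      ∑ w ∈ minCosetReps J, weight J K z w := by
  rw [pairing_sum_left]
  exact Finset.sum_congr rfl fun w hw => pairing_T_mul_E_L K z hw

theorem pairing_normalization_EXi_zeta (J K : Composition n) (z : Fin J.length → A) :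
    pairing (normalization J (EXi Q J z)) (zeta A Q K) =
      Q ^ (n - K.length) * ∑ w ∈ minCosetReps J, weight J K z w := by
  rw [normalization, pairing_sum_left, Finset.mul_sum]
  refine Finset.sum_congr rfl fun w hw => ?_
  rw [pairing_mul_T, inv_inv, pairing_T_mul_EXi_zeta z hw]

end Hecke

/-! ### Monotone enumerations of multisets -/

section Sorting

theorem eq_of_monotone_of_map_eq {α : Type*} [LinearOrder α] {m : ℕ} {f g : Fin m → α}
    (hf : Monotone f) (hg : Monotone g)
    (h : (Finset.univ : Finset (Fin m)).val.map f = Finset.univ.val.map g) : f = g := by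
  have e : ∀ f : Fin m → α, (Finset.univ : Finset (Fin m)).val.map f = (List.ofFn f : List α) :=
    fun f => by
      rw [Fin.univ_val_map]
  rw [e, e, Multiset.coe_eq_coe] at h
  exact List.ofFn_injective (h.eq_of_pairwise' hf.sortedLE_ofFn.pairwise hg.sortedLE_ofFn.pairwise)

theorem exists_monotone_map_eq {α : Type*} [LinearOrder α] {m : ℕ} (t : Multiset α)
    (ht : t.card = m) :
    ∃ f : Fin m → α, Monotone f ∧ (Finset.univ : Finset (Fin m)).val.map f = t := by
  have hl : (t.sort (· ≤ ·)).length = m := by rw [Multiset.length_sort, ht]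
  subst hl
  refine ⟨(t.sort (· ≤ ·)).get, (t.pairwise_sort (· ≤ ·)).sortedLE.monotone_get, ?_⟩
  rw [Fin.univ_val_map, List.ofFn_get, Multiset.sort_eq]

end Sorting

/-! ### Hook Schur functions -/

section Symmetric

theorem mem_hook {a b i j : ℕ} : (i, j) ∈ hook a b ↔ (i = 0 ∧ j ≤ a) ∨ (j = 0 ∧ i ≤ b) := by
  rw [hook, YoungDiagram.mem_ofRowLens]
  cases i with
  | zero => simp; omega
  | succ i => simp; omega

theorem map_cells_hook {α : Type*} (a b : ℕ) (f : ℕ × ℕ → α) :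
    (hook a b).cells.val.map f = f (0, 0) ::ₘ
      ((Finset.univ : Finset (Fin b)).val.map (fun i : Fin b => f ((i : ℕ) + 1, 0)) +
        (Finset.univ : Finset (Fin a)).val.map (fun j : Fin a => f (0, (j : ℕ) + 1))) := by
  let e₁ : Fin b ↪ ℕ × ℕ := ⟨fun i => (i + 1, 0), fun i j h => by simpa [Fin.ext_iff] using h⟩
  let e₂ : Fin a ↪ ℕ × ℕ := ⟨fun j => (0, j + 1), fun i j h => by simpa [Fin.ext_iff] using h⟩
  have he₁ : ∀ i, e₁ i = ((i : ℕ) + 1, 0) := fun _ => rfl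
  have he₂ : ∀ j, e₂ j = (0, (j : ℕ) + 1) := fun _ => rfl
  have h₁ : Disjoint ((Finset.univ : Finset (Fin b)).map e₁)
      ((Finset.univ : Finset (Fin a)).map e₂) := by
    rw [Finset.disjoint_left]
    simp [he₁, he₂]
  have h₂ : (0, 0) ∉ ((Finset.univ : Finset (Fin b)).map e₁).disjUnion
      ((Finset.univ : Finset (Fin a)).map e₂) h₁ := by
    simp [he₁, he₂]
  have key : (hook a b).cells = Finset.cons (0, 0) _ h₂ := by
    ext ⟨i, j⟩
    rw [YoungDiagram.mem_cells, mem_hook]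
    simp only [Finset.mem_cons, Finset.mem_disjUnion, Finset.mem_map, Finset.mem_univ, true_and,
      he₁, he₂, Prod.mk.injEq]
    constructor
    · rintro (⟨rfl, h⟩ | ⟨rfl, h⟩)
      · cases j with
        | zero => simp
        | succ j => exact Or.inr (Or.inr ⟨⟨j, h⟩, rfl, rfl⟩)
      · cases i with
        | zero => simp
        | succ i => exact Or.inr (Or.inl ⟨⟨i, h⟩, rfl, rfl⟩)
    · rintro (⟨rfl, rfl⟩ | ⟨x, rfl, rfl⟩ | ⟨x, rfl, rfl⟩)
      · simp
      · simp
      · simp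
  rw [key, Finset.cons_val, Finset.disjUnion_val, Finset.map_val, Finset.map_val,
    Multiset.map_cons, Multiset.map_add, Multiset.map_map, Multiset.map_map]
  rfl

/-- The entries of the first column below the corner. -/
def hookCol {a b : ℕ} (t : SemistandardYoungTableau (hook a b)) (i : Fin b) : ℕ := t (i + 1) 0

/-- The entries of the first row to the right of the corner. -/
def hookRow {a b : ℕ} (t : SemistandardYoungTableau (hook a b)) (j : Fin a) : ℕ := t 0 (j + 1)

theorem hookCol_strictMono {a b : ℕ} (t : SemistandardYoungTableau (hook a b)) :
    StrictMono (hookCol t) := fun i j h =>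
  t.col_strict (by simpa using h) (mem_hook.2 (Or.inr ⟨rfl, j.2⟩))

theorem hookRow_monotone {a b : ℕ} (t : SemistandardYoungTableau (hook a b)) :
    Monotone (hookRow t) := fun i j h =>
  t.row_weak_of_le (by simpa using h) (mem_hook.2 (Or.inl ⟨rfl, j.2⟩))

theorem corner_lt_hookCol {a b : ℕ} (t : SemistandardYoungTableau (hook a b)) (i : Fin b) :
    t 0 0 < hookCol t i :=
  t.col_strict (Nat.succ_pos _) (mem_hook.2 (Or.inr ⟨rfl, i.2⟩))

theorem corner_le_hookRow {a b : ℕ} (t : SemistandardYoungTableau (hook a b)) (j : Fin a) :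
    t 0 0 ≤ hookRow t j :=
  t.row_weak (Nat.succ_pos _) (mem_hook.2 (Or.inl ⟨rfl, j.2⟩))

/-- The multiset of all entries of a tableau of hook shape. -/
def hookContent {a b : ℕ} (t : SemistandardYoungTableau (hook a b)) : Multiset ℕ :=
  t 0 0 ::ₘ ((Finset.univ : Finset (Fin b)).val.map (hookCol t) +
    (Finset.univ : Finset (Fin a)).val.map (hookRow t))

theorem content_iff {a b : ℕ} (t : SemistandardYoungTableau (hook a b)) (d : ℕ →₀ ℕ) :
    (∀ x, ((hook a b).cells.filter fun c => t c.1 c.2 = x).card = d x) ↔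
      hookContent t = d.toMultiset := by
  have h : hookContent t = (hook a b).cells.val.map fun c => t c.1 c.2 :=
    (map_cells_hook a b fun c => t c.1 c.2).symm
  rw [h, Multiset.ext]
  refine forall_congr' fun x => ?_
  rw [Finsupp.count_toMultiset, Multiset.count_map, ← Finset.filter_val, Finset.card_val]
  simp only [eq_comm]

theorem hook_ext {a b : ℕ} {t t' : SemistandardYoungTableau (hook a b)} (h0 : t 0 0 = t' 0 0)
    (hc : hookCol t = hookCol t') (hr : hookRow t = hookRow t') : t = t' := by
  ext i j
  by_cases hm : (i, j) ∈ hook a b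
  · rcases mem_hook.1 hm with ⟨rfl, h⟩ | ⟨rfl, h⟩
    · cases j with
      | zero => exact h0
      | succ j => exact congrFun hr ⟨j, h⟩
    · cases i with
      | zero => exact h0
      | succ i => exact congrFun hc ⟨i, h⟩
  · rw [t.zeros hm, t'.zeros hm]

/-- The filling of a hook with given corner, first column and first row. -/
def hookEntry {a b : ℕ} (m : ℕ) (col : Fin b → ℕ) (row : Fin a → ℕ) : ℕ → ℕ → ℕ
  | 0, 0 => m
  | i + 1, 0 => if h : i < b then col ⟨i, h⟩ else 0
  | 0, j + 1 => if h : j < a then row ⟨j, h⟩ else 0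
  | _ + 1, _ + 1 => 0

/-- The tableau of hook shape with given corner, first column and first row. -/
def hookTableau {a b : ℕ} (m : ℕ) (col : Fin b → ℕ) (row : Fin a → ℕ) (hcol : StrictMono col)
    (hrow : Monotone row) (hmc : ∀ i, m < col i) (hmr : ∀ j, m ≤ row j) :
    SemistandardYoungTableau (hook a b) where
  entry := hookEntry m col row
  row_weak' := by
    intro i j1 j2 hj hm
    rcases mem_hook.1 hm with ⟨rfl, h⟩ | ⟨rfl, h⟩
    · obtain ⟨j2, rfl⟩ := Nat.exists_eq_succ_of_ne_zero (Nat.ne_zero_of_lt hj)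
      have h2 : j2 < a := h
      cases j1 with
      | zero => simpa [hookEntry, h2] using hmr _
      | succ j1 =>
        have h1 : j1 < j2 := by omega
        simpa [hookEntry, h2, h1.trans h2] using hrow (Fin.mk_le_mk.2 h1.le)
    · omega
  col_strict' := by
    intro i1 i2 j hi hm
    rcases mem_hook.1 hm with ⟨rfl, h⟩ | ⟨rfl, h⟩
    · omega
    · obtain ⟨i2, rfl⟩ := Nat.exists_eq_succ_of_ne_zero (Nat.ne_zero_of_lt hi)
      have h2 : i2 < b := h
      cases i1 with
      | zero => simpa [hookEntry, h2] using hmc _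
      | succ i1 =>
        have h1 : i1 < i2 := by omega
        simpa [hookEntry, h2, h1.trans h2] using hcol (Fin.mk_lt_mk.2 h1)
  zeros' := by
    intro i j hm
    rw [mem_hook] at hm
    push Not at hm
    rcases i with _ | i <;> rcases j with _ | j
    · simp at hm
    · have : ¬ j < a := by omega
      simp [hookEntry, this]
    · have : ¬ i < b := by omega
      simp [hookEntry, this]
    · rfl

/-- In a tableau of hook shape the corner is the smallest entry, and the tableau is determined by
its content and by the set of entries of the first column. -/
theorem card_hook_tableaux (a b : ℕ) (d : ℕ →₀ ℕ) :
    Nat.card {t : SemistandardYoungTableau (hook a b) //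
      ∀ x, ((hook a b).cells.filter fun c => t c.1 c.2 = x).card = d x} =
      if d.degree = a + b + 1 then (d.support.card - 1).choose b else 0 := by
  simp only [content_iff]
  have hdeg : d.toMultiset.card = d.degree := by
    rw [Finsupp.card_toMultiset]
    rfl
  split_ifs with hd
  · have hne : d.support.Nonempty := by
      rw [Finsupp.support_nonempty_iff]
      rintro rfl
      simp at hd
    set m := d.support.min' hne with hm
    have hcorner : ∀ t : SemistandardYoungTableau (hook a b), hookContent t = d.toMultiset →
        t 0 0 = m := by
      intro t ht
      refine le_antisymm ?_ (Finset.min'_le _ _ ?_)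
      · refine Finset.le_min' _ _ _ fun x hx => ?_
        have hx' : x ∈ hookContent t := by rw [ht]; exact (Finsupp.mem_toMultiset d x).2 hx
        simp only [hookContent, Multiset.mem_cons, Multiset.mem_add, Multiset.mem_map] at hx'
        rcases hx' with rfl | ⟨i, _, rfl⟩ | ⟨j, _, rfl⟩
        · exact le_rfl
        · exact (corner_lt_hookCol t i).le
        · exact corner_le_hookRow t j
      · rw [← Finsupp.mem_toMultiset, ← ht]
        exact Multiset.mem_cons_self _ _
    have hcolmem : ∀ t : SemistandardYoungTableau (hook a b), hookContent t = d.toMultiset →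
        Finset.univ.map ⟨hookCol t, (hookCol_strictMono t).injective⟩ ∈
          (d.support.erase m).powersetCard b := by
      intro t ht
      rw [Finset.mem_powersetCard]
      refine ⟨fun x hx => ?_, by simp⟩
      obtain ⟨i, _, rfl⟩ := Finset.mem_map.1 hx
      rw [Finset.mem_erase]
      refine ⟨?_, ?_⟩
      · rw [← hcorner t ht]
        exact (corner_lt_hookCol t i).ne'
      · rw [← Finsupp.mem_toMultiset, ← ht]
        simp [hookContent]
    have hcard : ((d.support.erase m).powersetCard b).card = (d.support.card - 1).choose b := by
      rw [Finset.card_powersetCard, Finset.card_erase_of_mem (Finset.min'_mem _ _)]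
    let φ : {t : SemistandardYoungTableau (hook a b) // hookContent t = d.toMultiset} →
        {C // C ∈ (d.support.erase m).powersetCard b} :=
      fun t => ⟨_, hcolmem t.1 t.2⟩
    have hφ : Function.Bijective φ := by
      constructor
      · rintro ⟨t, ht⟩ ⟨t', ht'⟩ h
        have h0 : t 0 0 = t' 0 0 := by rw [hcorner t ht, hcorner t' ht']
        have hc : (Finset.univ : Finset (Fin b)).val.map (hookCol t) =
            Finset.univ.val.map (hookCol t') :=
          congrArg (fun C => (Subtype.val C).val) h
        have hr : (Finset.univ : Finset (Fin a)).val.map (hookRow t) =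
            Finset.univ.val.map (hookRow t') := by
          have := ht.trans ht'.symm
          rw [hookContent, hookContent, h0, hc] at this
          exact add_left_cancel ((Multiset.cons_inj_right _).1 this)
        exact Subtype.ext (hook_ext h0
          (eq_of_monotone_of_map_eq (hookCol_strictMono t).monotone
            (hookCol_strictMono t').monotone hc)
          (eq_of_monotone_of_map_eq (hookRow_monotone t) (hookRow_monotone t') hr))
      · rintro ⟨C, hC⟩
        obtain ⟨hCsub, hCcard⟩ := Finset.mem_powersetCard.1 hC
        have hmC : m ∉ C := fun h => Finset.notMem_erase m _ (hCsub h)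
        -- the row is filled with the entries left over by the corner and the column
        have hle : m ::ₘ C.val ≤ d.toMultiset := by
          rw [← Finset.cons_val hmC, Multiset.le_iff_subset (Finset.nodup _)]
          intro x hx
          rw [Finsupp.mem_toMultiset]
          rcases Finset.mem_cons.1 hx with rfl | hx
          · exact Finset.min'_mem _ _
          · exact Finset.mem_of_mem_erase (hCsub hx)
        obtain ⟨r, hr⟩ := Multiset.le_iff_exists_add.1 hle
        have hrcard : r.card = a := by
          have := congrArg Multiset.card hr
          rw [hdeg, hd] at this
          simp only [Multiset.card_add, Multiset.card_cons, Finset.card_val, hCcard] at this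
          omega
        obtain ⟨row, hrow, hrow'⟩ := exists_monotone_map_eq r hrcard
        obtain ⟨col, hcol, hcol'⟩ := exists_monotone_map_eq C.val hCcard
        have hcol'' : StrictMono col := by
          refine hcol.strictMono_of_injective fun i j hij => ?_
          have hnd : ((Finset.univ : Finset (Fin b)).val.map col).Nodup := hcol' ▸ C.nodup
          exact Multiset.inj_on_of_nodup_map hnd i (Finset.mem_univ i) j (Finset.mem_univ j) hij
        have hmin : ∀ x ∈ d.toMultiset, m ≤ x := fun x hx =>
          Finset.min'_le _ _ ((Finsupp.mem_toMultiset d x).1 hx)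
        have hmc : ∀ i, m < col i := fun i => by
          have hi : col i ∈ C := by
            rw [← Finset.mem_val, ← hcol']
            exact Multiset.mem_map_of_mem _ (Finset.mem_univ i)
          refine lt_of_le_of_ne (hmin _ ?_) fun h => hmC (h ▸ hi)
          rw [hr]
          exact Multiset.mem_add.2 (Or.inl (Multiset.mem_cons_of_mem hi))
        have hmr : ∀ j, m ≤ row j := fun j => by
          refine hmin _ ?_
          rw [hr, ← hrow']
          exact Multiset.mem_add.2 (Or.inr (Multiset.mem_map_of_mem _ (Finset.mem_univ j)))
        let t := hookTableau m col row hcol'' hrow hmc hmr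
        have h0 : t 0 0 = m := rfl
        have h1 : hookCol t = col := funext fun i => dif_pos i.2
        have h2 : hookRow t = row := funext fun j => dif_pos j.2
        have ht : hookContent t = d.toMultiset := by
          rw [hookContent, h0, h1, h2, hr, hcol', hrow', Multiset.cons_add]
        refine ⟨⟨t, ht⟩, Subtype.ext (Finset.val_injective ?_)⟩
        change (Finset.univ : Finset (Fin b)).val.map (hookCol t) = C.val
        rw [h1, hcol']
    rw [← hcard, Nat.card_congr (Equiv.ofBijective φ hφ), Nat.card_eq_fintype_card,
      Fintype.card_coe]
  · rw [Nat.card_eq_zero]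
    left
    refine ⟨fun t => hd ?_⟩
    have := congrArg Multiset.card t.2
    rw [hdeg] at this
    simp [hookContent] at this
    omega

variable {A : Type*} [CommRing A]

/-- The sum `S_{1^j} + z S_{2,1^{j-2}} + ⋯ + z^{j-1} S_j` of hook Schur functions. -/
noncomputable def hookSum (j : ℕ) (z : A) : MvPowerSeries ℕ A :=
  ∑ k ∈ Finset.range j, z ^ k • schur A (hook k (j - 1 - k))

/-- By the binomial theorem, the coefficient of a monomial in a sum of hook Schur functions
depends only on its degree and on the number of variables involved. -/
theorem coeff_hookSum {j : ℕ} (hj : 0 < j) (z : A) (d : ℕ →₀ ℕ) :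
    MvPowerSeries.coeff d (hookSum j z) =
      if d.degree = j then z ^ (j - d.support.card) * (1 + z) ^ (d.support.card - 1) else 0 := by
  have h1 : ∀ k ∈ Finset.range j,
      MvPowerSeries.coeff d (z ^ k • schur A (hook k (j - 1 - k))) =
        if d.degree = j then z ^ k * ((d.support.card - 1).choose (j - 1 - k) : A) else 0 := by
    intro k hk
    have hk := Finset.mem_range.1 hk
    have e : k + (j - 1 - k) + 1 = j := by omega
    have h2 : MvPowerSeries.coeff d (schur A (hook k (j - 1 - k))) =
        ((if d.degree = j then (d.support.card - 1).choose (j - 1 - k) else 0 : ℕ) : A) := by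
      have := card_hook_tableaux k (j - 1 - k) d
      rw [e] at this
      rw [← this]
      rfl
    rw [MvPowerSeries.coeff_smul, h2]
    split_ifs <;> simp
  rw [hookSum, map_sum, Finset.sum_congr rfl h1]
  split_ifs with hd
  · have hle : d.support.card ≤ j := by
      rw [← hd, Finsupp.degree_apply, Finset.card_eq_sum_ones]
      exact Finset.sum_le_sum fun i hi => Nat.one_le_iff_ne_zero.2 (Finsupp.mem_support_iff.1 hi)
    have hpos : 0 < d.support.card := by
      rw [Finset.card_pos, Finsupp.support_nonempty_iff]
      rintro rfl
      simp at hd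
      omega
    rw [← Finset.sum_range_reflect, add_pow, Finset.mul_sum]
    have hsub : Finset.range (d.support.card - 1 + 1) ⊆ Finset.range j :=
      Finset.range_subset_range.2 (by omega)
    symm
    rw [← Finset.sum_subset hsub]
    · refine Finset.sum_congr rfl fun b hb => ?_
      have hb := Finset.mem_range.1 hb
      have e1 : j - 1 - (j - 1 - b) = b := by omega
      have e2 : j - 1 - b = (j - d.support.card) + (d.support.card - 1 - b) := by omega
      rw [e1, e2, one_pow, one_mul, pow_add, mul_assoc]
    · intro b hb hb'
      have hb := Finset.mem_range.1 hb
      have e1 : j - 1 - (j - 1 - b) = b := by omega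
      rw [Finset.mem_range, not_lt] at hb'
      rw [e1, Nat.choose_eq_zero_of_lt (by omega), Nat.cast_zero, mul_zero]
  · simp

end Symmetric

/-! ### Coset representatives and matrices -/

section Matrices

variable {n : ℕ}

theorem card_index_eq (J : Composition n) (b : Fin J.length) :
    (Finset.univ.filter fun p => J.index p = b).card = J.blocksFun b := by
  have : (Finset.univ.filter fun p => J.index p = b) =
      Finset.univ.map (J.embedding b).toEmbedding := by
    ext p
    have := J.mem_range_embedding_iff' (j := p) (i := b)
    simp only [Set.mem_range] at this
    simp only [Finset.mem_filter, Finset.mem_univ, true_and, Finset.mem_map,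
      RelEmbedding.coe_toEmbedding, this]
    exact eq_comm
  rw [this, Finset.card_map, Finset.card_univ, Fintype.card_fin]

/-- The exponent of the monomial `x_0 ^ k_1 x_1 ^ k_2 ⋯` attached to the composition `K`. -/
noncomputable def exponent (K : Composition n) : ℕ →₀ ℕ :=
  ∑ x : Fin n, Finsupp.single (K.index x : ℕ) 1

/-- The row `b` of the matrix of a permutation `w`: its entry at `c` is the number of positions
in the block `b` of `J` at which the value of `w` lies in the block `c` of `K`. -/
noncomputable def matrixRow (J K : Composition n) (w : Perm (Fin n)) (b : Fin J.length) : ℕ →₀ ℕ :=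
  ∑ p ∈ Finset.univ.filter fun p => J.index p = b, Finsupp.single (K.index (w p) : ℕ) 1

theorem sum_single_apply {ι : Type*} (s : Finset ι) (g : ι → ℕ) (c : ℕ) :
    (∑ p ∈ s, Finsupp.single (g p) 1 : ℕ →₀ ℕ) c = (s.filter fun p => g p = c).card := by
  rw [Finsupp.finsetSum_apply, Finset.card_filter]
  exact Finset.sum_congr rfl fun p _ => Finsupp.single_apply

theorem degree_sum_single {ι : Type*} (s : Finset ι) (g : ι → ℕ) :
    (∑ p ∈ s, Finsupp.single (g p) 1 : ℕ →₀ ℕ).degree = s.card := by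
  simp [map_sum]

theorem support_sum_single {ι : Type*} (s : Finset ι) (g : ι → ℕ) :
    (∑ p ∈ s, Finsupp.single (g p) 1 : ℕ →₀ ℕ).support = s.image g := by
  ext c
  rw [Finsupp.mem_support_iff, sum_single_apply, Finset.card_ne_zero, Finset.mem_image,
    Finset.filter_nonempty_iff]

theorem degree_matrixRow (J K : Composition n) (w : Perm (Fin n)) (b : Fin J.length) :
    (matrixRow J K w b).degree = J.blocksFun b := by
  rw [matrixRow, degree_sum_single, card_index_eq]

theorem matrixRow_apply (J K : Composition n) (w : Perm (Fin n)) (b : Fin J.length) (c : ℕ) :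
    matrixRow J K w b c =
      (Finset.univ.filter fun p => J.index p = b ∧ (K.index (w p) : ℕ) = c).card := by
  rw [matrixRow, sum_single_apply, Finset.filter_filter]

theorem sum_matrixRow (J K : Composition n) (w : Perm (Fin n)) :
    ∑ b, matrixRow J K w b = exponent K := by
  simp only [matrixRow]
  rw [Finset.sum_fiberwise]
  exact Equiv.sum_comp w fun x => Finsupp.single (K.index x : ℕ) 1

/-- The values of a function `g` at the points of `Fin n`, together with the blocks of these
points. -/
def blockValue (J : Composition n) (g : Fin n → ℕ) (p : Fin n) : Fin J.length ×ₗ ℕ :=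
  toLex (J.index p, g p)

theorem count_blockValue (J : Composition n) (g : Fin n → ℕ) (b : Fin J.length) (c : ℕ) :
    ((Finset.univ : Finset (Fin n)).val.map (blockValue J g)).count (toLex (b, c)) =
      (Finset.univ.filter fun p => J.index p = b ∧ g p = c).card := by
  rw [Multiset.count_map, ← Finset.filter_val, Finset.card_val]
  refine congrArg Finset.card (Finset.filter_congr fun p _ => ?_)
  rw [blockValue, toLex_inj, Prod.mk.injEq, eq_comm, @eq_comm _ c]

theorem le_of_minCosetReps {J : Composition n} {w : Perm (Fin n)} (hw : w ∈ minCosetReps J)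
    {a b : Fin n} (hab : J.index a = J.index b) (h : a ≤ b) : w a ≤ w b := by
  rcases h.eq_or_lt with rfl | h
  · exact le_rfl
  · exact (lt_of_forall_internal (mem_minCosetReps.1 hw) hab h).le

theorem BlockDecreasing.le {J K : Composition n} {w : Perm (Fin n)} (hd : BlockDecreasing J K w)
    {x y : Fin n} (hxy : K.index x = K.index y) (h : x ≤ y) :
    J.index (w⁻¹ y) ≤ J.index (w⁻¹ x) := by
  obtain ⟨y, hy⟩ := y
  obtain ⟨x, hx⟩ := x
  induction y with
  | zero =>
    obtain rfl : x = 0 := Nat.le_zero.1 h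
    exact le_rfl
  | succ y ih =>
    rcases (show x ≤ y + 1 from h).eq_or_lt with rfl | hlt
    · exact le_rfl
    · have hxy' : x ≤ y := Nat.lt_succ_iff.1 hlt
      let i : Fin (n - 1) := ⟨y, by omega⟩
      have hi : Internal K i := internal_of_index_eq hxy hxy' le_rfl
      exact (hd i hi).trans (ih (by omega) (hxy.trans hi.symm) hxy')

theorem blockValue_monotone {J : Composition n} (K : Composition n) {w : Perm (Fin n)}
    (hw : w ∈ minCosetReps J) : Monotone (blockValue J fun p => (K.index (w p) : ℕ)) := by
  intro p p' h
  rw [blockValue, blockValue, Prod.Lex.toLex_le_toLex']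
  exact ⟨index_mono J h, fun e => index_mono K (le_of_minCosetReps hw e h)⟩

/-- The key by which the positions are sorted to recover a block-decreasing minimal coset
representative from the blocks of its values. -/
def sortKey (J : Composition n) (g : Fin n → ℕ) (p : Fin n) :
    ℕ ×ₗ ((Fin J.length)ᵒᵈ ×ₗ Fin n) :=
  toLex (g p, toLex (OrderDual.toDual (J.index p), p))

theorem sortKey_injective (J : Composition n) (g : Fin n → ℕ) :
    Function.Injective (sortKey J g) := by
  intro p p' h
  simp only [sortKey, toLex_inj, Prod.mk.injEq] at h
  exact h.2.2

theorem sortKey_le_iff {J : Composition n} {g : Fin n → ℕ} {p p' : Fin n} :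
    sortKey J g p ≤ sortKey J g p' ↔ g p ≤ g p' ∧ (g p = g p' →
      J.index p' ≤ J.index p ∧ (J.index p = J.index p' → p ≤ p')) := by
  rw [sortKey, sortKey, Prod.Lex.toLex_le_toLex', Prod.Lex.toLex_le_toLex']
  rfl

theorem sortKey_comp_inv_monotone {J K : Composition n} {w : Perm (Fin n)}
    (hw : w ∈ minCosetReps J) (hd : BlockDecreasing J K w) :
    Monotone (sortKey J (fun p => (K.index (w p) : ℕ)) ∘ (w⁻¹ : Perm (Fin n))) := by
  intro x y h
  simp only [Function.comp_apply, sortKey_le_iff, apply_inv_apply]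
  refine ⟨index_mono K h, fun e => ⟨hd.le (Fin.ext e) h, fun e' => ?_⟩⟩
  by_contra! hlt
  have := lt_of_forall_internal (mem_minCosetReps.1 hw) e'.symm hlt
  rw [apply_inv_apply, apply_inv_apply] at this
  exact this.not_ge h

/-- A block-decreasing minimal coset representative is determined by its matrix. -/
theorem eq_of_matrixRow_eq {J K : Composition n} {w w' : Perm (Fin n)}
    (hw : w ∈ minCosetReps J) (hd : BlockDecreasing J K w) (hw' : w' ∈ minCosetReps J)
    (hd' : BlockDecreasing J K w') (h : ∀ b, matrixRow J K w b = matrixRow J K w' b) : w = w' := by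
  have h1 : blockValue J (fun p => (K.index (w p) : ℕ)) =
      blockValue J (fun p => (K.index (w' p) : ℕ)) := by
    refine eq_of_monotone_of_map_eq (blockValue_monotone K hw) (blockValue_monotone K hw') ?_
    ext ⟨b, c⟩
    change Multiset.count (toLex (b, c)) _ = Multiset.count (toLex (b, c)) _
    rw [count_blockValue, count_blockValue, ← matrixRow_apply, ← matrixRow_apply, h]
  have h2 : (fun p => (K.index (w p) : ℕ)) = fun p => (K.index (w' p) : ℕ) := by
    funext p
    have := congrFun h1 p
    simp only [blockValue, toLex_inj, Prod.mk.injEq] at this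
    exact this.2
  have m1 := sortKey_comp_inv_monotone hw hd
  have m2 := sortKey_comp_inv_monotone hw' hd'
  rw [← h2] at m2
  have h3 := Tuple.unique_monotone m1 m2
  have h4 : w⁻¹ = w'⁻¹ := Equiv.ext fun x => sortKey_injective J _ (congrFun h3 x)
  exact inv_injective h4

/-- Every matrix with the prescribed row and column sums is the matrix of a block-decreasing
minimal coset representative. -/
theorem exists_matrixRow_eq {J K : Composition n} (l : Fin J.length → ℕ →₀ ℕ)
    (hrow : ∀ b, (l b).degree = J.blocksFun b) (hcol : ∑ b, l b = exponent K) :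
    ∃ w ∈ minCosetReps J, BlockDecreasing J K w ∧ ∀ b, matrixRow J K w b = l b := by
  classical
  let M : Multiset (Fin J.length ×ₗ ℕ) :=
    ∑ b, (l b).toMultiset.map fun c => toLex (b, c)
  have hMcount : ∀ b c, M.count (toLex (b, c)) = l b c := by
    intro b c
    rw [Multiset.count_sum', Finset.sum_eq_single b]
    · exact (Multiset.count_map_eq_count' (fun c => toLex (b, c)) _ (fun c c' h => by
        simpa using h) c).trans (Finsupp.count_toMultiset _ _)
    · intro b' _ hb'
      rw [Multiset.count_eq_zero, Multiset.mem_map]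
      rintro ⟨c', _, h⟩
      rw [toLex_inj, Prod.mk.injEq] at h
      exact hb' h.1
    · exact fun h => absurd (Finset.mem_univ _) h
  have hcard : ∀ b, (l b).toMultiset.card = J.blocksFun b := fun b => by
    rw [Finsupp.card_toMultiset, ← hrow b]
    rfl
  have hMcard : M.card = n := by
    refine Eq.trans (map_sum Multiset.cardHom _ _) ?_
    refine Eq.trans (Finset.sum_congr rfl fun b _ => ?_) J.sum_blocksFun
    change Multiset.card (Multiset.map _ _) = _
    rw [Multiset.card_map, hcard]
  obtain ⟨μ, hμ, hμM⟩ := exists_monotone_map_eq M hMcard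
  -- the first components of `μ` are the blocks of `J`
  have hμ1 : (fun p => (ofLex (μ p)).1) = J.index := by
    refine eq_of_monotone_of_map_eq
      (fun p p' h => Prod.Lex.monotone_fst_ofLex (hμ h)) (index_mono J) ?_
    have h1 : M.map (fun x => (ofLex x).1) =
        ∑ b, Multiset.replicate (J.blocksFun b) b := by
      refine Eq.trans (map_sum (Multiset.mapAddMonoidHom _) _ _) ?_
      refine Finset.sum_congr rfl fun b _ => ?_
      change Multiset.map _ (Multiset.map _ _) = _
      rw [Multiset.map_map, ← hcard b]
      exact Multiset.map_const _ _
    rw [← hμM, Multiset.map_map] at h1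
    refine h1.trans (Multiset.ext.2 fun b => ?_)
    rw [Multiset.count_sum', Multiset.count_map, ← Finset.filter_val, Finset.card_val]
    simp only [Multiset.count_replicate, @eq_comm _ b, card_index_eq]
    simp
  let g : Fin n → ℕ := fun p => (ofLex (μ p)).2
  have hμg : μ = blockValue J g := by
    funext p
    rw [blockValue, ← congrFun hμ1 p]
    rfl
  have hcount : ∀ b c, (Finset.univ.filter fun p => J.index p = b ∧ g p = c).card = l b c := by
    intro b c
    rw [← count_blockValue, ← hμg, hμM, hMcount]
  let σ := Tuple.sort (sortKey J g)
  have hσ : Monotone (sortKey J g ∘ σ) := Tuple.monotone_sort _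
  have hgσ : g ∘ σ = fun x => (K.index x : ℕ) := by
    refine eq_of_monotone_of_map_eq (fun x y h => (sortKey_le_iff.1 (hσ h)).1)
      (fun x y h => index_mono K h) ?_
    rw [← Multiset.map_map, Multiset.map_univ_val_equiv]
    ext c
    rw [Multiset.count_map, Multiset.count_map, ← Finset.filter_val, ← Finset.filter_val,
      Finset.card_val, Finset.card_val]
    simp only [@eq_comm _ c]
    have h1 : exponent K c = (Finset.univ.filter fun x => (K.index x : ℕ) = c).card :=
      sum_single_apply _ _ _
    rw [← h1, ← hcol, Finsupp.finsetSum_apply,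
      Finset.card_eq_sum_card_fiberwise (t := Finset.univ) (f := J.index)
        fun _ _ => Finset.mem_coe.2 (Finset.mem_univ _)]
    refine Finset.sum_congr rfl fun b _ => ?_
    rw [← hcount, Finset.filter_filter]
    simp only [and_comm]
  have hw : ∀ p, (K.index (σ⁻¹ p) : ℕ) = g p := fun p => by
    rw [← congrFun hgσ, Function.comp_apply, apply_inv_apply]
  refine ⟨σ⁻¹, mem_minCosetReps.2 fun i hi' => ?_, fun i hi' => ?_, fun b => ?_⟩
  · refine (lt_or_gt' i σ⁻¹).resolve_right fun h => ?_
    have h1 := sortKey_le_iff.1 (hσ h.le)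
    rw [apply_inv_apply, apply_inv_apply] at h1
    have h2 := hμ (lo_lt_hi i).le
    rw [hμg, blockValue, blockValue, Prod.Lex.toLex_le_toLex'] at h2
    exact ((h1.2 (h1.1.antisymm (h2.2 hi'))).2 hi'.symm).not_gt (lo_lt_hi i)
  · rw [inv_inv]
    refine ((sortKey_le_iff.1 (hσ (lo_lt_hi i).le)).2 ?_).1
    change (g ∘ σ) _ = (g ∘ σ) _
    rw [hgσ]
    exact congrArg Fin.val hi'
  · ext c
    rw [matrixRow_apply, ← hcount]
    simp only [hw]

theorem forced_iff {J K : Composition n} {w : Perm (Fin n)} (hw : w ∈ minCosetReps J)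
    (hd : BlockDecreasing J K w) {j : Fin (n - 1)} (hj : Internal J j) :
    Forced K w j ↔ K.index (w (lo j)) = K.index (w (hi j)) := by
  constructor
  · rintro ⟨i, hi', h1, h2⟩
    rw [h1, h2, hi']
  · intro h
    have hlt := mem_minCosetReps.1 hw j hj
    have hlt' := Fin.lt_def.1 hlt
    have hbound := (w (hi j)).2
    let i : Fin (n - 1) := ⟨w (lo j), by omega⟩
    have hlo : lo i = w (lo j) := rfl
    have hhi : hi i ≤ w (hi j) := hlt
    have hi' : Internal K i := internal_of_index_eq h hlo.ge hhi
    -- the value following `w (lo j)` lies in the same block of `J`, hence comes next in `w`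
    have h1 := hd i hi'
    have h2 := hd.le (show K.index (hi i) = K.index (w (hi j)) by rw [← h, ← hlo, hi']) hhi
    rw [inv_apply_apply, ← hj] at h2
    rw [hlo, inv_apply_apply] at h1
    have h3 : J.index (w⁻¹ (lo i)) = J.index (w⁻¹ (hi i)) := by
      rw [hlo, inv_apply_apply]
      exact h2.antisymm h1
    obtain ⟨j', _, e1, e2⟩ := exists_internal_of_index_eq hw h3
    have : j' = j := by
      have := w.injective (e1.trans hlo)
      exact Fin.ext (by simpa [lo] using this)
    exact ⟨i, hi', hlo.symm, this ▸ e2⟩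

/-- A monotone sequence takes as many values as it has jumps, plus one. -/
theorem card_image_range_of_monotone (f : ℕ → ℕ) (m : ℕ) (hf : ∀ k < m, f k ≤ f (k + 1)) :
    ((Finset.range (m + 1)).image f).card =
      ((Finset.range m).filter fun k => ¬ f k = f (k + 1)).card + 1 := by
  induction m with
  | zero => simp
  | succ m ih =>
    have ih := ih fun k hk => hf k (by omega)
    have hmono : ∀ k ≤ m, f k ≤ f m := fun k hk =>
      Nat.le_induction (m := k) (P := fun t _ => t ≤ m → f k ≤ f t) (fun _ => le_rfl)
        (fun t _ h ht => (h (by omega)).trans (hf t (by omega))) m hk le_rfl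
    rw [Finset.range_add_one, Finset.image_insert, Finset.range_add_one (n := m),
      Finset.filter_insert, ← Finset.range_add_one (n := m)]
    by_cases h : f m = f (m + 1)
    · rw [if_neg (not_not.2 h), Finset.insert_eq_of_mem, ih]
      exact Finset.mem_image.2 ⟨m, by simp, h⟩
    · rw [if_pos h, Finset.card_insert_of_notMem, Finset.card_insert_of_notMem, ih]
      · simp
      · intro hm
        obtain ⟨k, hk, e⟩ := Finset.mem_image.1 hm
        have h1 := hmono k (Nat.lt_succ_iff.1 (Finset.mem_range.1 hk))
        have h2 := hf m (Nat.lt_succ_self m)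
        omega

variable {A : Type*} [CommRing A]

theorem prod_internalList (J : Composition n) (f : Fin (n - 1) → A) :
    ∏ j ∈ (internalList J).toFinset, f j = ∏ b, ∏ k, f (blockGen J b k) := by
  have hnd : (internalList J).Nodup := (internalList_pairwise J).imp fun h => h.ne
  rw [List.prod_toFinset _ hnd, internalList, List.map_flatten, List.prod_flatten, List.map_ofFn,
    List.map_ofFn, List.prod_ofFn]
  refine Finset.prod_congr rfl fun b _ => ?_
  simp only [Function.comp_apply, List.map_ofFn, List.prod_ofFn]

/-- In a block of `J`, the generators that are not forced are the jumps of the monotone sequence of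
blocks of `K` met by the values of `w`. -/
theorem weight_eq {J K : Composition n} (z : Fin J.length → A) {w : Perm (Fin n)}
    (hw : w ∈ minCosetReps J) (hd : BlockDecreasing J K w) :
    weight J K z w = ∏ b, z b ^ (J.blocksFun b - (matrixRow J K w b).support.card) *
      (1 + z b) ^ ((matrixRow J K w b).support.card - 1) := by
  classical
  rw [weight, if_pos hd, prod_internalList]
  refine Finset.prod_congr rfl fun b _ => ?_
  simp only [forced_iff hw hd (internal_blockGen J b _), index_lo_blockGen]
  have hs := J.sizeUpTo_succ' b
  have hle := J.sizeUpTo_le (b + 1)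
  have hpos := J.one_le_blocksFun b
  let f : ℕ → ℕ := fun k => if h : J.sizeUpTo b + k < n then
    (K.index (w ⟨J.sizeUpTo b + k, h⟩) : ℕ) else 0
  have hidx : ∀ k (h : J.sizeUpTo b + k < n), k < J.blocksFun b →
      J.index ⟨J.sizeUpTo b + k, h⟩ = b := fun k h hk => by
    rw [index_eq_iff]
    simp only
    omega
  have hf : ∀ k < J.blocksFun b - 1, f k ≤ f (k + 1) := by
    intro k hk
    have h1 : J.sizeUpTo b + k < n := by omega
    have h2 : J.sizeUpTo b + (k + 1) < n := by omega
    simp only [f, dif_pos h1, dif_pos h2]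
    refine index_mono K (le_of_minCosetReps hw ?_ ?_)
    · rw [hidx k h1 (by omega), hidx (k + 1) h2 (by omega)]
    · rw [Fin.mk_le_mk]
      omega
  have himg : (matrixRow J K w b).support = (Finset.range (J.blocksFun b)).image f := by
    rw [matrixRow, support_sum_single]
    ext c
    simp only [Finset.mem_image, Finset.mem_filter, Finset.mem_univ, true_and, Finset.mem_range]
    constructor
    · rintro ⟨p, hp, rfl⟩
      have h := index_eq_iff.1 hp
      refine ⟨p - J.sizeUpTo b, by omega, ?_⟩
      have e : J.sizeUpTo b + (p - J.sizeUpTo b) = p := by omega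
      simp only [f, e, p.2, dite_true]
    · rintro ⟨k, hk, rfl⟩
      have h : J.sizeUpTo b + k < n := by omega
      exact ⟨⟨_, h⟩, hidx k h hk, by simp only [f, dif_pos h]⟩
  have hcard := card_image_range_of_monotone f _ hf
  rw [Nat.sub_add_cancel hpos, ← himg] at hcard
  have hterm : ∀ k : Fin (J.blocksFun b - 1),
      (if K.index (w (lo (blockGen J b k))) = K.index (w (hi (blockGen J b k))) then z b
        else 1 + z b) = (fun k : ℕ => if f k = f (k + 1) then z b else 1 + z b) k := by
    intro k
    have h1 : J.sizeUpTo b + (k : ℕ) < n := by omega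
    have h2 : J.sizeUpTo b + ((k : ℕ) + 1) < n := by omega
    simp only [f, dif_pos h1, dif_pos h2]
    exact if_congr Fin.ext_iff rfl rfl
  rw [Finset.prod_congr rfl fun k _ => hterm k,
    Fin.prod_univ_eq_prod_range (fun k : ℕ => if f k = f (k + 1) then z b else 1 + z b),
    Finset.prod_ite, Finset.prod_const, Finset.prod_const, hcard, Nat.add_sub_cancel]
  congr 2
  have := Finset.card_filter_add_card_filter_not (s := Finset.range (J.blocksFun b - 1))
    (fun k => f k = f (k + 1))
  rw [Finset.card_range] at this
  omega

theorem hookProd_eq (J : Composition n) (z : Fin J.length → A) :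
    hookProd A J z = ∏ b, hookSum (J.blocksFun b) (z b) := rfl

/-- Block-decreasing minimal coset representatives are in bijection with the matrices indexing the
terms of the coefficient of a product of power series. -/
theorem coeff_hookProd_exponent (J K : Composition n) (z : Fin J.length → A) :
    MvPowerSeries.coeff (exponent K) (hookProd A J z) = ∑ w ∈ minCosetReps J, weight J K z w := by
  classical
  rw [hookProd_eq, MvPowerSeries.coeff_prod]
  simp only [coeff_hookSum (J.one_le_blocksFun _)]
  rw [← Finset.sum_filter_of_ne (s := minCosetReps J) (p := BlockDecreasing J K) fun w _ h => by
      by_contra hd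
      exact h (if_neg hd),
    ← Finset.sum_filter_of_ne (s := Finset.finsuppAntidiag _ _)
      (p := fun l => ∀ b, (l b).degree = J.blocksFun b) fun l _ h b => by
        by_contra hb
        exact h (Finset.prod_eq_zero (Finset.mem_univ b) (if_neg hb))]
  symm
  refine Finset.sum_bij (fun w _ => Finsupp.equivFunOnFinite.symm (matrixRow J K w))
    ?_ ?_ ?_ ?_
  · intro w _
    rw [Finset.mem_filter, Finset.mem_finsuppAntidiag]
    exact ⟨⟨sum_matrixRow J K w, Finset.subset_univ _⟩, fun b => degree_matrixRow J K w b⟩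
  · intro w hw w' hw' h
    rw [Finset.mem_filter] at hw hw'
    exact eq_of_matrixRow_eq hw.1 hw.2 hw'.1 hw'.2
      fun b => congrFun (Finsupp.equivFunOnFinite.symm.injective h) b
  · intro l hl
    rw [Finset.mem_filter, Finset.mem_finsuppAntidiag] at hl
    obtain ⟨w, hw, hd, h⟩ := exists_matrixRow_eq l hl.2 hl.1.1
    exact ⟨w, Finset.mem_filter.2 ⟨hw, hd⟩, Finsupp.ext h⟩
  · intro w hw
    rw [Finset.mem_filter] at hw
    rw [weight_eq z hw.1 hw.2]
    exact Finset.prod_congr rfl fun b _ => (if_pos (degree_matrixRow J K w b)).symm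

end Matrices

/-! ### Symmetry and the expansion in monomial functions -/

section Expansion

variable {A : Type*} [CommRing A] {n : ℕ}

/-- A power series invariant under all permutations of the variables. -/
def IsSymm (f : MvPowerSeries ℕ A) : Prop :=
  ∀ (σ : Perm ℕ) (d : ℕ →₀ ℕ),
    MvPowerSeries.coeff (Finsupp.domCongr σ d) f = MvPowerSeries.coeff d f

theorem IsSymm.one : IsSymm (1 : MvPowerSeries ℕ A) := by
  classical
  intro σ d
  rw [MvPowerSeries.coeff_one, MvPowerSeries.coeff_one]
  exact if_congr (EmbeddingLike.map_eq_zero_iff (f := Finsupp.domCongr σ)) rfl rfl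

theorem IsSymm.mul {f g : MvPowerSeries ℕ A} (hf : IsSymm f) (hg : IsSymm g) :
    IsSymm (f * g) := by
  classical
  intro σ d
  rw [MvPowerSeries.coeff_mul, MvPowerSeries.coeff_mul]
  let e : (ℕ →₀ ℕ) ≃+ (ℕ →₀ ℕ) := Finsupp.domCongr σ
  refine (Finset.sum_bij (fun p _ => (e p.1, e p.2)) ?_ ?_ ?_ ?_).symm
  · intro p hp
    rw [Finset.HasAntidiagonal.mem_antidiagonal] at hp ⊢
    rw [← map_add, hp]
  · intro p _ p' _ h
    rw [Prod.mk.injEq] at h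
    exact Prod.ext (e.injective h.1) (e.injective h.2)
  · intro p hp
    rw [Finset.HasAntidiagonal.mem_antidiagonal] at hp
    refine ⟨(e.symm p.1, e.symm p.2), ?_, by simp⟩
    rw [Finset.HasAntidiagonal.mem_antidiagonal, ← map_add, hp]
    exact e.symm_apply_apply d
  · intro p _
    rw [hf, hg]

theorem IsSymm.prod {ι : Type*} (t : Finset ι) {f : ι → MvPowerSeries ℕ A}
    (hf : ∀ i ∈ t, IsSymm (f i)) : IsSymm (∏ i ∈ t, f i) :=
  Finset.prod_induction f IsSymm (fun _ _ => IsSymm.mul) IsSymm.one hf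

theorem support_domCongr (σ : Perm ℕ) (d : ℕ →₀ ℕ) :
    (Finsupp.domCongr σ d).support = d.support.map σ.toEmbedding := by
  ext x
  simp [Finsupp.domCongr_apply, Finset.mem_map_equiv]

theorem isSymm_hookSum {j : ℕ} (hj : 0 < j) (z : A) : IsSymm (hookSum j z) := by
  intro σ d
  have h : (Finsupp.domCongr σ d).degree = d.degree := by
    rw [Finsupp.degree_apply, Finsupp.degree_apply, support_domCongr, Finset.sum_map]
    simp [Finsupp.domCongr_apply]
  rw [coeff_hookSum hj, coeff_hookSum hj, h, support_domCongr, Finset.card_map]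

theorem isSymm_hookProd (J : Composition n) (z : Fin J.length → A) :
    IsSymm (hookProd A J z) := by
  rw [hookProd_eq]
  exact IsSymm.prod _ fun b _ => isSymm_hookSum (J.one_le_blocksFun b) _

theorem degree_eq_of_coeff_hookProd_ne_zero {J : Composition n} {z : Fin J.length → A}
    {d : ℕ →₀ ℕ} (h : MvPowerSeries.coeff d (hookProd A J z) ≠ 0) : d.degree = n := by
  classical
  rw [hookProd_eq, MvPowerSeries.coeff_prod] at h
  obtain ⟨l, hl, hne⟩ := Finset.exists_ne_zero_of_sum_ne_zero h
  rw [Finset.mem_finsuppAntidiag] at hl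
  rw [← hl.1, map_sum]
  refine Eq.trans (Finset.sum_congr rfl fun b _ => ?_) J.sum_blocksFun
  by_contra hb
  refine hne (Finset.prod_eq_zero (Finset.mem_univ b) ?_)
  rw [coeff_hookSum (J.one_le_blocksFun b), if_neg hb]

/-- Two exponents with the same multiset of nonzero values differ by a permutation of the
variables. -/
theorem exists_domCongr_eq {d d' : ℕ →₀ ℕ} (h : d.support.val.map d = d'.support.val.map d') :
    ∃ σ : Perm ℕ, Finsupp.domCongr σ d = d' := by
  classical
  have hcount : ∀ (d : ℕ →₀ ℕ) (v : ℕ), v ≠ 0 →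
      Nat.card {x // d x = v} = (d.support.val.map d).count v := by
    intro d v hv
    have : ∀ x, d x = v ↔ x ∈ d.support.filter fun x => v = d x := fun x => by
      rw [Finset.mem_filter, Finsupp.mem_support_iff]
      constructor
      · rintro rfl
        exact ⟨hv, rfl⟩
      · exact fun h => h.2.symm
    rw [Multiset.count_map, ← Finset.filter_val, Finset.card_val,
      Nat.card_congr (Equiv.subtypeEquivRight this), Nat.card_eq_fintype_card, Fintype.card_coe]
  have hfin : ∀ (d : ℕ →₀ ℕ) (v : ℕ), v ≠ 0 → Finite {x // d x = v} := fun d v hv =>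
    (d.support.finite_toSet.subset fun x (hx : d x = v) => by
      rw [Finset.mem_coe, Finsupp.mem_support_iff, hx]
      exact hv)
  have hinf : ∀ d : ℕ →₀ ℕ, Infinite {x // d x = 0} := fun d => by
    have := d.support.finite_toSet.infinite_compl
    refine Set.infinite_coe_iff.2 (this.mono fun x hx => ?_)
    have hx' : ¬ x ∈ d.support := hx
    exact Finsupp.notMem_support_iff.1 hx'
  have key : ∀ v, Nonempty ({x // d x = v} ≃ {x // d' x = v}) := fun v => by
    by_cases hv : v = 0
    · subst hv
      have := hinf d
      have := hinf d'
      exact nonempty_equiv_of_countable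
    · have := hfin d v hv
      have := hfin d' v hv
      exact Finite.card_eq.1 (by rw [hcount d v hv, hcount d' v hv, h])
  let e := fun v => (key v).some
  refine ⟨Equiv.ofFiberEquiv e, ?_⟩
  ext x
  obtain ⟨y, rfl⟩ := (Equiv.ofFiberEquiv e).surjective x
  rw [Finsupp.domCongr_apply, Finsupp.equivMapDomain_apply, Equiv.symm_apply_apply]
  exact (Equiv.ofFiberEquiv_map e y).symm

theorem exponent_apply (K : Composition n) (b : Fin K.length) :
    exponent K b = K.blocksFun b := by
  rw [exponent, sum_single_apply, ← card_index_eq]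
  simp only [Fin.val_inj]

theorem map_exponent (K : Composition n) :
    (exponent K).support.val.map (exponent K) = K.blocks := by
  have h : (exponent K).support =
      (Finset.univ : Finset (Fin K.length)).map Fin.valEmbedding := by
    rw [exponent, support_sum_single]
    ext c
    simp only [Finset.mem_image, Finset.mem_univ, true_and, Finset.mem_map, Fin.valEmbedding_apply]
    constructor
    · rintro ⟨x, rfl⟩
      exact ⟨_, rfl⟩
    · rintro ⟨b, rfl⟩
      have hb := K.one_le_blocksFun b
      exact ⟨K.embedding b ⟨0, hb⟩, by rw [K.index_embedding]⟩
  rw [h, Finset.map_val, Multiset.map_map]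
  have h2 : ⇑(exponent K) ∘ Fin.valEmbedding = K.blocksFun := funext (exponent_apply K)
  rw [h2, Fin.univ_val_map, K.ofFn_blocksFun]

open scoped Classical in
theorem coeff_sum_monomialSymm (c : n.Partition → A) (d : ℕ →₀ ℕ) :
    MvPowerSeries.coeff d (∑ p, c p • monomialSymm A p) =
      ∑ p, if d.support.val.map d = p.parts then c p else 0 := by
  rw [map_sum]
  refine Finset.sum_congr rfl fun p _ => ?_
  rw [MvPowerSeries.coeff_smul]
  have : MvPowerSeries.coeff d (monomialSymm A p) =
      if d.support.val.map d = p.parts then 1 else 0 := rfl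
  rw [this, mul_ite, mul_one, mul_zero]

theorem coeff_exponent_sum_monomialSymm (c : n.Partition → A) (K : Composition n) :
    MvPowerSeries.coeff (exponent K) (∑ p, c p • monomialSymm A p) =
      c (Nat.Partition.ofComposition n K) := by
  classical
  rw [coeff_sum_monomialSymm, map_exponent,
    Finset.sum_eq_single (Nat.Partition.ofComposition n K)]
  · exact if_pos rfl
  · intro p _ hp
    exact if_neg fun h => hp (Nat.Partition.ext h.symm)
  · exact fun h => absurd (Finset.mem_univ _) h

theorem exists_hookProd_eq (J : Composition n) (z : Fin J.length → A) :
    ∃ c : n.Partition → A, hookProd A J z = ∑ p, c p • monomialSymm A p := by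
  classical
  choose comp hcomp using Nat.Partition.ofComposition_surj (n := n)
  refine ⟨fun p => MvPowerSeries.coeff (exponent (comp p)) (hookProd A J z), ?_⟩
  ext d
  have hsum : (d.support.val.map d).sum = d.degree := (Finsupp.degree_apply d).symm
  rw [coeff_sum_monomialSymm]
  by_cases hd : d.degree = n
  · let p₀ : n.Partition := ⟨d.support.val.map d, fun {i} hi => by
      obtain ⟨x, hx, rfl⟩ := Multiset.mem_map.1 hi
      exact Nat.pos_of_ne_zero (Finsupp.mem_support_iff.1 hx), hsum.trans hd⟩
    rw [Finset.sum_eq_single p₀]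
    · rw [if_pos rfl]
      have h : (exponent (comp p₀)).support.val.map (exponent (comp p₀)) =
          d.support.val.map d := by
        rw [map_exponent]
        exact congrArg Nat.Partition.parts (hcomp p₀)
      obtain ⟨σ, hσ⟩ := exists_domCongr_eq h
      rw [← hσ]
      exact isSymm_hookProd J z σ _
    · intro p _ hp
      exact if_neg fun h => hp (Nat.Partition.ext h.symm)
    · exact fun h => absurd (Finset.mem_univ _) h
  · rw [Finset.sum_eq_zero]
    · by_contra h
      exact hd (degree_eq_of_coeff_hookProd_ne_zero h)
    · intro p _
      refine if_neg fun h => hd ?_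
      rw [← hsum, h, p.parts_sum]

end Expansion

end IwahoriHecke

theorem mainTheorem1 {R : Type*} [CommRing R] (q Q : Rˣ) (hQ : (Q : R) = (q : R) - (q⁻¹ : Rˣ))
    (n : ℕ) (J K : Composition n) :
    -- the two scalar products coincide
    IwahoriHecke.pairing
        (∑ w ∈ IwahoriHecke.minCosetReps J,
          IwahoriHecke.T (MvPolynomial (Fin J.length) R) (MvPolynomial.C (Q : R)) w *
            IwahoriHecke.E (MvPolynomial.C (Q : R)) J MvPolynomial.X)
        (IwahoriHecke.L (MvPolynomial (Fin J.length) R) (MvPolynomial.C (Q : R)) K) =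
      IwahoriHecke.pairing
        (IwahoriHecke.normalization J
          (IwahoriHecke.EXi (MvPolynomial.C (Q : R)) J MvPolynomial.X))
        (IwahoriHecke.zeta (MvPolynomial (Fin J.length) R) (MvPolynomial.C (Q : R)) K) *
          MvPolynomial.C ((Q ^ ((K.length : ℤ) - (n : ℤ)) : Rˣ) : R) ∧
    -- the product of sums of hook Schur functions has an expansion in monomial functions
    (∃ c : n.Partition → MvPolynomial (Fin J.length) R,
      IwahoriHecke.hookProd (MvPolynomial (Fin J.length) R) J MvPolynomial.X =
        ∑ p, c p • IwahoriHecke.monomialSymm (MvPolynomial (Fin J.length) R) p) ∧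
    -- in such an expansion, the coefficient of `m_K` is the common value of the scalar products
    ∀ c : n.Partition → MvPolynomial (Fin J.length) R,
      IwahoriHecke.hookProd (MvPolynomial (Fin J.length) R) J MvPolynomial.X =
          ∑ p, c p • IwahoriHecke.monomialSymm (MvPolynomial (Fin J.length) R) p →
        IwahoriHecke.pairing
          (∑ w ∈ IwahoriHecke.minCosetReps J,
            IwahoriHecke.T (MvPolynomial (Fin J.length) R) (MvPolynomial.C (Q : R)) w *
              IwahoriHecke.E (MvPolynomial.C (Q : R)) J MvPolynomial.X)
          (IwahoriHecke.L (MvPolynomial (Fin J.length) R) (MvPolynomial.C (Q : R)) K) =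
        c (Nat.Partition.ofComposition n K) := by
  have hQ1 : (MvPolynomial.C (Q : R) : MvPolynomial (Fin J.length) R) ^ (n - K.length) *
      MvPolynomial.C ((Q ^ ((K.length : ℤ) - (n : ℤ)) : Rˣ) : R) = 1 := by
    have h : ((K.length : ℤ) - (n : ℤ)) = -((n - K.length : ℕ) : ℤ) := by
      have := K.length_le
      omega
    rw [h, zpow_neg, zpow_natCast, ← map_pow, ← map_mul, ← Units.val_pow_eq_pow_val,
      Units.mul_inv, map_one]
  refine ⟨?_, IwahoriHecke.exists_hookProd_eq J _, fun c hc => ?_⟩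
  · rw [IwahoriHecke.pairing_sum_E_L, IwahoriHecke.pairing_normalization_EXi_zeta, mul_right_comm,
      hQ1, one_mul]
  · rw [IwahoriHecke.pairing_sum_E_L, ← IwahoriHecke.coeff_hookProd_exponent, hc,
      IwahoriHecke.coeff_exponent_sum_monomialSymm]
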